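/- Let $\Omega$ be a countably infinite set, let $\mathrm{Inj}(\Omega)$ be the monoid of all injective maps $\Omega\to\Omega$ (maps are written on the right, so $fg$ means first $f$, then $g$), and let $\mathrm{Sym}(\Omega)\subseteq \mathrm{Inj}(\Omega)$ be the group of permutations of $\Omega$. Let $\mathrm{Fin}(\Omega)$ be the group of permutations with finite support and $\mathrm{Alt}(\Omega)$ the group of even finitary permutations (products of an even number of transpositions). Put $\mathrm{Inj}_{\mathrm{fin}}(\Omega)=\{f : 1\le |\Omega\setminus(\Omega)f|<\aleph_0\}$ and $\mathrm{Inj}_{\infty}(\Omega)=\{f : |\Omega\setminus(\Omega)f|=\aleph_0\}$. A subset of $\mathrm{Inj}(\Omega)$ is *normal* if it is closed under $f\mapsto afa^{-1}$ for all $a\in\mathrm{Sym}(\Omega)$. For an additive submonoid $N\subseteq\mathbb N=\{0,1,2,\dots\}$, let $\mathrm{Gn}(N)$ be its unique minimal generating set as a monoid. A *cycle* of $f\in\mathrm{Inj}(\Omega)$ is a nonempty set $\Sigma\subseteq\Omega$ such that, for all $\alpha\in\Omega$, $(\alpha)f\in\Sigma\iff\alpha\in\Sigma$, and which has no proper nonempty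 subset with this property. An infinite cycle $\Sigma$ is *forward* if $\Sigma\setminus(\Omega)f\ne\emptyset$, and *open* otherwise. Let $(f)\mathrm C_n$, $(f)\mathrm C_{\mathrm{open}}$, $(f)\mathrm C_{\mathrm{fwd}}$ be the numbers of cycles of $f$ of finite cardinality $n\ge 1$, of open cycles, and of forward cycles. Write $f\approx_{\mathrm{fin}}g$ if $(f)\mathrm C_{\mathrm{open}}=(g)\mathrm C_{\mathrm{open}}$, $(f)\mathrm C_{\mathrm{fwd}}=(g)\mathrm C_{\mathrm{fwd}}$, $(f)\mathrm C_n\neq(g)\mathrm C_n$ for only finitely many $n\geq 1$, and $(f)\mathrm C_n,(g)\mathrm C_n$ are both finite whenever they differ. Write $f\approx_{\mathrm{even}}g$ if $f\approx_{\mathrm{fin}}g$ and $\sum_{n\ge1}\bigl((f)\mathrm C_n-(g)\mathrm C_n\bigr)$ is even, where a term with $(f)\mathrm C_n=(g)\mathrm C_n$ counts as $0$ even if both are infinite. For either relation $\approx$, a set $B\subseteq \mathrm{Inj}(\Omega)$ is *$\approx$-closed* if $f\approx g$ implies $(f\in B\iff g\in B)$, for all $f,g\in\mathrm{Inj}(\Omega)$.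 **Theorem.** Let $M\subseteq\mathrm{Inj}(\Omega)$ be a normal submonoid, and put $M_{\mathrm{gp}}=M\cap\mathrm{Sym}(\Omega)$, $M_{\mathrm{fin}}=M\cap\mathrm{Inj}_{\mathrm{fin}}(\Omega)$, $M_\infty=M\cap\mathrm{Inj}_\infty(\Omega)$. Then $M=M_{\mathrm{gp}}\cup M_{\mathrm{fin}}\cup M_\infty$, where 1. $M_{\mathrm{gp}}\in\{\{1\},\mathrm{Alt}(\Omega),\mathrm{Fin}(\Omega),\mathrm{Sym}(\Omega)\}$; 2. $M_{\mathrm{fin}}=B\cup\{f\in\mathrm{Inj}(\Omega): |\Omega\setminus(\Omega)f|\in N\setminus(\mathrm{Gn}(N)\cup\{0\})\}$ for some additive submonoid $N\subseteq\mathbb N$ and some normal subset $B\subseteq\mathrm{Inj}(\Omega)$ with $\{|\Omega\setminus(\Omega)f| : f\in B\}=\mathrm{Gn}(N)$; 3. $M_\infty\in\{\emptyset,\mathrm{Inj}_\infty(\Omega)\}$. Moreover, any such $N$ and $B$ satisfy the following additional conditions. * If $M_{\mathrm{gp}}=\mathrm{Alt}(\Omega)$, then (i) the set of those $f\in B$ that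 have at least two infinite cycles, or infinitely many cycles of some finite cardinality $n$, is $\approx_{\mathrm{fin}}$-closed; and (ii) the set of those $f\in B$ that have exactly one infinite cycle and only finitely many cycles of each finite cardinality is $\approx_{\mathrm{even}}$-closed. * If $M_{\mathrm{gp}}=\mathrm{Fin}(\Omega)$, then $B$ is $\approx_{\mathrm{fin}}$-closed. * If $M_{\mathrm{gp}}=\mathrm{Sym}(\Omega)$, then $B=\{f\in\mathrm{Inj}(\Omega):|\Omega\setminus(\Omega)f|\in\mathrm{Gn}(N)\}$. Conversely, let $M_{\mathrm{gp}}$, $M_{\mathrm{fin}}$, $M_\infty$ be any subsets of $\mathrm{Inj}(\Omega)$ such that $M_{\mathrm{gp}}$ satisfies 1, $M_{\mathrm{fin}}$ satisfies 2 with some $N$ and $B$, $M_\infty$ satisfies 3, and $B$ satisfies the additional condition belonging to $M_{\mathrm{gp}}$ (none if $M_{\mathrm{gp}}=\{1\}$). Then $M_{\mathrm{gp}}\cup M_{\mathrm{fin}}\cup M_\infty$ is a normal submonoid of $\mathrm{Inj}(\Omega)$. -/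

import Mathlib

namespace NormalInj

/-- The set of injective maps from `Ω` to itself. -/
def Inj (Ω : Type*) : Type _ := {f : Ω → Ω // Function.Injective f}

/-- Maps act on the right of their arguments, so `f * g` is "first `f`, then `g`". -/
instance instMonoidInj (Ω : Type*) : Monoid (Inj Ω) where
  mul f g := ⟨g.1 ∘ f.1, g.2.comp f.2⟩
  one := ⟨id, Function.injective_id⟩
  mul_assoc _ _ _ := rfl
  one_mul _ := rfl
  mul_one _ := rfl

/-- A permutation, viewed as an injective map. -/
def ofPerm {Ω : Type*} (a : Equiv.Perm Ω) : Inj Ω := ⟨a, a.injective⟩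

/-- A set of injective maps is normal if it is closed under conjugation by permutations. -/
def IsNormal {Ω : Type*} (B : Set (Inj Ω)) : Prop :=
  ∀ a : Equiv.Perm Ω, ∀ f ∈ B, ofPerm a * f * ofPerm a⁻¹ ∈ B

/-- The cardinality of the complement of the image of `f` (`⊤` if it is infinite). -/
noncomputable def coimageCard {Ω : Type*} (f : Inj Ω) : ℕ∞ := ((Set.range f.1)ᶜ).encard

/-! ### Permutations -/

/-- The permutations, as a set of injective maps. -/
def symSet (Ω : Type*) : Set (Inj Ω) := Set.range ofPerm

/-- The permutations with finite support. -/
def finSet (Ω : Type*) : Set (Inj Ω) :=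
  {f | ∃ a : Equiv.Perm Ω, {x | a x ≠ x}.Finite ∧ f = ofPerm a}

open Classical in
/-- The even finitary permutations: products of an even number of transpositions. -/
def altSet (Ω : Type*) : Set (Inj Ω) :=
  {f | ∃ l : List (Equiv.Perm Ω), (∀ t ∈ l, t.IsSwap) ∧ Even l.length ∧ f = ofPerm l.prod}

/-- The injective maps whose image has finite nonempty complement. -/
def injFin (Ω : Type*) : Set (Inj Ω) := {f | 1 ≤ coimageCard f ∧ coimageCard f < ⊤}

/-- The injective maps whose image has infinite complement. -/
def injInf (Ω : Type*) : Set (Inj Ω) := {f | coimageCard f = ⊤}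

/-- The set of permutations in `M`. -/
def gpPart {Ω : Type*} (M : Set (Inj Ω)) : Set (Inj Ω) := M ∩ symSet Ω

/-- The set of maps in `M` whose image has finite nonempty complement. -/
def finPart {Ω : Type*} (M : Set (Inj Ω)) : Set (Inj Ω) := M ∩ injFin Ω

/-- The set of maps in `M` whose image has infinite complement. -/
def infPart {Ω : Type*} (M : Set (Inj Ω)) : Set (Inj Ω) := M ∩ injInf Ω

/-! ### Cycles -/

/-- `S` is invariant under `f`: a point is mapped into `S` iff it lies in `S`. -/
def IsInvariant {Ω : Type*} (f : Inj Ω) (S : Set Ω) : Prop := ∀ x, f.1 x ∈ S ↔ x ∈ S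

/-- A cycle under `f` is a minimal nonempty invariant set. -/
def IsCycle {Ω : Type*} (f : Inj Ω) (S : Set Ω) : Prop :=
  S.Nonempty ∧ IsInvariant f S ∧ ∀ T ⊆ S, T.Nonempty → IsInvariant f T → T = S

/-- A forward cycle is an infinite cycle that is not contained in the image. -/
def IsForwardCycle {Ω : Type*} (f : Inj Ω) (S : Set Ω) : Prop :=
  IsCycle f S ∧ S.Infinite ∧ (S \ Set.range f.1).Nonempty

/-- An open cycle is an infinite cycle that is not a forward cycle. -/
def IsOpenCycle {Ω : Type*} (f : Inj Ω) (S : Set Ω) : Prop :=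
  IsCycle f S ∧ S.Infinite ∧ ¬ IsForwardCycle f S

/-- The number of cycles of cardinality `n` under `f`. -/
noncomputable def cycleCount {Ω : Type*} (f : Inj Ω) (n : ℕ+) : ℕ∞ :=
  {S : Set Ω | IsCycle f S ∧ S.encard = ((n : ℕ) : ℕ∞)}.encard

/-- The number of open cycles under `f`. -/
noncomputable def openCount {Ω : Type*} (f : Inj Ω) : ℕ∞ := {S : Set Ω | IsOpenCycle f S}.encard

/-- The number of forward cycles under `f`. -/
noncomputable def fwdCount {Ω : Type*} (f : Inj Ω) : ℕ∞ :=
  {S : Set Ω | IsForwardCycle f S}.encard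

/-- The number of infinite cycles under `f`. -/
noncomputable def infiniteCycleCount {Ω : Type*} (f : Inj Ω) : ℕ∞ :=
  {S : Set Ω | IsCycle f S ∧ S.Infinite}.encard

/-! ### The two equivalence relations -/

/-- The relation `f ≈_fin g`. -/
def FinEquiv {Ω : Type*} (f g : Inj Ω) : Prop :=
  openCount f = openCount g ∧
  fwdCount f = fwdCount g ∧
  {n : ℕ+ | cycleCount f n ≠ cycleCount g n}.Finite ∧
  ∀ n : ℕ+, cycleCount f n ≠ cycleCount g n → cycleCount f n ≠ ⊤ ∧ cycleCount g n ≠ ⊤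

open Classical in
/-- The relation `f ≈_even g`. The terms of the sum with `cycleCount f n = cycleCount g n` are
zero by convention; when `FinEquiv f g`, only finitely many terms are left and both counts in
them are finite. -/
def EvenEquiv {Ω : Type*} (f g : Inj Ω) : Prop :=
  FinEquiv f g ∧
  Even (∑ᶠ n : ℕ+, if cycleCount f n = cycleCount g n then (0 : ℤ)
    else ((cycleCount f n).toNat : ℤ) - ((cycleCount g n).toNat : ℤ))

/-- `B` is closed under the relation `r`. -/
def IsClosedUnder {Ω : Type*} (r : Inj Ω → Inj Ω → Prop) (B : Set (Inj Ω)) : Prop :=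
  ∀ f g : Inj Ω, r f g → (f ∈ B ↔ g ∈ B)

/-! ### Minimal generating sets of additive monoids of natural numbers -/

/-- The minimal generating set of `N`: the intersection of all generating sets. -/
def Gn (N : AddSubmonoid ℕ) : Set ℕ := ⋂₀ {G : Set ℕ | AddSubmonoid.closure G = N}

/-- `Gn N` is a generating set of `N`, and is contained in every generating set. -/
theorem isLeast_Gn (N : AddSubmonoid ℕ) :
    IsLeast {G : Set ℕ | AddSubmonoid.closure G = N} (Gn N) := by
  refine ⟨?_, fun G hG => Set.sInter_subset_of_mem hG⟩
  change AddSubmonoid.closure (Gn N) = N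
  apply le_antisymm
  · rw [AddSubmonoid.closure_le]
    exact Set.sInter_subset_of_mem (AddSubmonoid.closure_eq N)
  · intro n
    induction n using Nat.strong_induction_on with
    | _ n ih =>
    intro hn
    by_cases hG : n ∈ Gn N
    · exact AddSubmonoid.subset_closure hG
    · obtain ⟨G, hGN, hnG⟩ : ∃ G : Set ℕ, AddSubmonoid.closure G = N ∧ n ∉ G := by
        simpa [Gn] using hG
      have key : ∀ m ∈ AddSubmonoid.closure G, m ≤ n → m ∈ AddSubmonoid.closure (Gn N) := by
        intro m hm
        induction hm using AddSubmonoid.closure_induction with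
        | mem x hx =>
          intro hxn
          have hne : x ≠ n := fun h => hnG (h ▸ hx)
          exact ih x (lt_of_le_of_ne hxn hne) (hGN ▸ AddSubmonoid.subset_closure hx)
        | zero => exact fun _ => zero_mem _
        | add x y _ _ h1 h2 =>
          intro hxy
          exact add_mem (h1 (by omega)) (h2 (by omega))
      exact key n (hGN ▸ hn) le_rfl

/-! ### The conditions of the classification -/

/-- The maps `f` whose coimage cardinality lies in `N \ (Gn(N) ∪ {0})`. -/
def decomposablePart (Ω : Type*) (N : AddSubmonoid ℕ) : Set (Inj Ω) :=
  {f | ∃ n : ℕ, n ∈ (N : Set ℕ) \ (Gn N ∪ {0}) ∧ coimageCard f = (n : ℕ∞)}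

/-- The maps `f` whose coimage cardinality lies in `Gn(N)`. -/
def generatorPart (Ω : Type*) (N : AddSubmonoid ℕ) : Set (Inj Ω) :=
  {f | ∃ n ∈ Gn N, coimageCard f = (n : ℕ∞)}

/-- `F` is the union of `B` and `decomposablePart Ω N`, where `B` is normal and the coimage
cardinalities of the elements of `B` are exactly the elements of `Gn(N)`. -/
def HasFinForm {Ω : Type*} (F : Set (Inj Ω)) (N : AddSubmonoid ℕ) (B : Set (Inj Ω)) : Prop :=
  F = B ∪ decomposablePart Ω N ∧
  IsNormal B ∧
  coimageCard '' B = (fun n : ℕ => (n : ℕ∞)) '' Gn N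

/-- The additional conditions on `B`, depending on the set `P` of permutations in the monoid. -/
def ExtraConditions {Ω : Type*} (P : Set (Inj Ω)) (N : AddSubmonoid ℕ) (B : Set (Inj Ω)) : Prop :=
  (P = altSet Ω →
    IsClosedUnder FinEquiv
      {f ∈ B | 2 ≤ infiniteCycleCount f ∨ ∃ n : ℕ+, cycleCount f n = ⊤} ∧
    IsClosedUnder EvenEquiv
      {f ∈ B | infiniteCycleCount f = 1 ∧ ∀ n : ℕ+, cycleCount f n ≠ ⊤}) ∧
  (P = finSet Ω → IsClosedUnder FinEquiv B) ∧
  (P = symSet Ω → B = generatorPart Ω N)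

end NormalInj

/-! The theorem rests on one factorisation, `exists_eq_conj_mul_conj`: if f, g, h each have an
infinite cycle and h omits as many points as f and g together, where f omits at most as many as g,
then h is a product of a conjugate of f and a conjugate of g. A map that is not surjective has a
forward cycle. Hence a normal submonoid with maps omitting m ≠ 0 and k ≠ 0 points contains all maps
omitting m + k points. With m = k = ∞ this is part 3. In part 2 it leaves freedom only at the
irreducible elements of N, and these form Gn(N) (`mem_Gn_iff`). For permutations, 0 = 0 + 0:
infinite support yields a permutation with an infinite cycle, hence all of them, hence Sym. The
finitary case is the classical one: commutators with transpositions give the 3-cycles, hence Alt.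

The factorisation is a back-and-forth construction. Copies f' of f and g' of g with f'g' = h are
built from arrows: an arrow x → y of f' forces the arrow y → h x of g', and conversely, except for
the images under g' of points omitted by f'. Each stage adds finitely many arrows and extends
partial isomorphisms from f to f' and from g to g'. Infinite orbits of f and g absorb stray points,
and an infinite orbit of h supplies fresh ones.

For the additional conditions, B is closed under conjugation and under multiplication by M_gp. A
transposition merges two cycles, splits one, or exchanges the tails of two infinite ones, so
finitary permutations preserve ≈_fin. Conversely, finite cycles can be merged one at a time into a
forward cycle, so ≈_fin-related nonsurjective maps differ by a conjugation and a finitary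
permutation, of parity given by the cycle counts (`FinEquiv.exists_eq_conj_mul`). For Alt this
parity is an invariant if there is one infinite cycle and all counts are finite
(`odd_cycleDiff_mulSwap`). Otherwise the product with some transposition is a conjugate of f, which
cancels the parity (`exists_swap_mul_eq_conj`). -/

namespace NormalInj

open Function Set

/-! ### Partial models of an injection -/

section PartialModel

variable {Ω : Type*}

/-- `z` is reached, along the arrows of `A`, from a point in the image of `α` or from a point
without incoming arrows. -/
inductive Reach (A α : Set (Ω × Ω)) : Ω → Prop
  | placed {u z : Ω} : (u, z) ∈ α → Reach A α z
  | source {z : Ω} : (∀ x, (x, z) ∉ A) → Reach A α z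
  | step {x z : Ω} : (x, z) ∈ A → Reach A α x → Reach A α z

/-- A partial injection with arrow set `A` together with a partial isomorphism `α` from the
injection `F` to it, such that the final injection omits exactly the points of `S`. -/
structure PartialModel (F : Ω → Ω) (S : Set Ω) (A α : Set (Ω × Ω)) : Prop where
  arrow_fun : ∀ {x y y'}, (x, y) ∈ A → (x, y') ∈ A → y = y'
  arrow_inj : ∀ {x x' y}, (x, y) ∈ A → (x', y) ∈ A → x = x'
  arrow_notMem : ∀ {x y}, (x, y) ∈ A → y ∉ S
  map_fun : ∀ {u x x'}, (u, x) ∈ α → (u, x') ∈ α → x = x'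
  map_inj : ∀ {u u' x}, (u, x) ∈ α → (u', x) ∈ α → u = u'
  hom : ∀ {u x y}, (u, x) ∈ α → (F u, y) ∈ α → (x, y) ∈ A
  -- Unplaced points may have arrows, but none that ends in a placed point.
  back : ∀ {u x y}, (F u, y) ∈ α → (x, y) ∈ A → (u, x) ∈ α
  start : ∀ {u x}, (u, x) ∈ α → (x ∈ S ↔ u ∉ range F)
  start_dom : ∀ {u}, u ∉ range F → ∃ x, (u, x) ∈ α
  start_ran : ∀ {x}, x ∈ S → ∃ u, (u, x) ∈ α
  convex : ∀ {u x y} {n i : ℕ}, (u, x) ∈ α → (F^[n] u, y) ∈ α → i ≤ n → ∃ z, (F^[i] u, z) ∈ α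
  -- This excludes closed cycles and infinite backward chains of unplaced points, so that any point
  -- can be absorbed by induction on `Reach`.
  reach : ∀ z, Reach A α z

/-- A point that is involved neither in the arrows nor in the partial isomorphism. -/
def Fresh (A α : Set (Ω × Ω)) (w : Ω) : Prop :=
  (∀ x, (w, x) ∉ A) ∧ (∀ x, (x, w) ∉ A) ∧ ∀ u, (u, w) ∉ α

theorem Reach.mono {A α α' : Set (Ω × Ω)} (h : α ⊆ α') {z : Ω} (hz : Reach A α z) :
    Reach A α' z := by
  induction hz with
  | placed hu => exact .placed (h hu)
  | source hs => exact .source hs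
  | step hx _ ih => exact .step hx ih

namespace PartialModel

variable {F : Ω → Ω} {S : Set Ω} {A α : Set (Ω × Ω)}

theorem notMem_of_fresh (m : PartialModel F S A α) {w : Ω} (hw : Fresh A α w) : w ∉ S :=
  fun h => (m.start_ran h).elim fun u hu => hw.2.2 u hu

/-- Adding an arrow that ends in an unplaced point. -/
theorem insert_arrow (m : PartialModel F S A α) {x y : Ω} (hx : ∀ z, (x, z) ∉ A)
    (hy : ∀ z, (z, y) ∉ A) (hyα : ∀ u, (u, y) ∉ α) (hr : Reach (insert (x, y) A) α x) :
    PartialModel F S (insert (x, y) A) α where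
  arrow_fun h h' := by
    simp only [mem_insert_iff, Prod.mk.injEq] at h h'
    grind [m.arrow_fun]
  arrow_inj h h' := by
    simp only [mem_insert_iff, Prod.mk.injEq] at h h'
    grind [m.arrow_inj]
  arrow_notMem h hS := by
    rcases h with h | h
    · cases h
      exact (m.start_ran hS).elim fun u hu => hyα u hu
    · exact m.arrow_notMem h hS
  map_fun := m.map_fun
  map_inj := m.map_inj
  hom h h' := .inr (m.hom h h')
  back h h' := by
    rcases h' with h' | h'
    · cases h'
      exact absurd h (hyα _)
    · exact m.back h h'
  start := m.start
  start_dom := m.start_dom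
  start_ran := m.start_ran
  convex := m.convex
  reach z := by
    induction m.reach z with
    | placed hu => exact .placed hu
    | @source z hs =>
      by_cases hzy : z = y
      · subst hzy
        exact .step (.inl rfl) hr
      · refine .source fun x' hx' => ?_
        rcases hx' with h | h
        · cases h; exact hzy rfl
        · exact hs _ h
    | step h _ ih => exact .step (.inr h) ih

/-- The new arrow only spoils the source property of `y`, and no derivation for another point passes
through `y`, which has no outgoing arrow. -/
theorem reach_insert_of_fresh (m : PartialModel F S A α) {x y : Ω} (hxy : x ≠ y)
    (hy : ∀ z, (y, z) ∉ A) : Reach (insert (x, y) A) α x := by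
  have key : ∀ z, Reach A α z → z ≠ y → Reach (insert (x, y) A) α z := by
    intro z hz
    induction hz with
    | placed hu => exact fun _ => .placed hu
    | source hs =>
      refine fun hzy => .source fun x' hx' => ?_
      rcases hx' with h | h
      · cases h; exact hzy rfl
      · exact hs _ h
    | @step x' z h _ ih =>
      refine fun hzy => .step (.inr h) (ih ?_)
      rintro rfl
      exact hy _ h
  exact key x (m.reach x) hxy

/-- The domain remains convex when the successor of a point of the domain is added. -/
theorem convex_insert_succ (m : PartialModel F S A α) (hF : Injective F) {u x : Ω}
    (hu : (u, x) ∈ α) (hFu : ∀ y, (F u, y) ∉ α) {w : Ω} {v a b : Ω} {n i : ℕ}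
    (h : (v, a) ∈ insert (F u, w) α) (h' : (F^[n] v, b) ∈ insert (F u, w) α) (hi : i ≤ n) :
    ∃ z, (F^[i] v, z) ∈ insert (F u, w) α := by
  -- By convexity, nothing from `F u` onwards is placed.
  have aux : ∀ {k c}, (F^[k + 1] u, c) ∈ α → False := fun {k c} hk =>
    (m.convex hu hk (Nat.succ_le_succ (Nat.zero_le k))).elim fun z hz => hFu z hz
  rcases Nat.eq_zero_or_pos i with rfl | hi0
  · exact ⟨a, h⟩
  rcases hi.eq_or_lt with rfl | hlt
  · exact ⟨b, h'⟩
  obtain ⟨n, rfl⟩ : ∃ k, n = k + 1 := ⟨n - 1, by omega⟩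
  simp only [mem_insert_iff, Prod.mk.injEq] at h h'
  rcases h with ⟨rfl, rfl⟩ | h <;> rcases h' with ⟨h', rfl⟩ | h'
  · rw [iterate_succ_apply'] at h'
    have h2 := hF h'
    rw [← iterate_succ_apply F n u] at h2
    exact (aux (h2.symm ▸ hu)).elim
  · rw [← iterate_succ_apply F (n + 1) u] at h'
    exact (aux h').elim
  · rw [iterate_succ_apply'] at h'
    have h2 := hF h'
    obtain ⟨z, hz⟩ := m.convex h (h2.symm ▸ hu) (Nat.le_of_lt_succ hlt)
    exact ⟨z, .inr hz⟩
  · obtain ⟨z, hz⟩ := m.convex h h' hi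
    exact ⟨z, .inr hz⟩

/-- A position of `y` would be some `F v'`, because arrows avoid `S`. Then `back` places `v'` at
`x`, so `v' = u` and `F u` would be placed. -/
theorem notMem_of_pending (m : PartialModel F S A α) {u x y : Ω}
    (hu : (u, x) ∈ α) (hFu : ∀ y, (F u, y) ∉ α) (hxy : (x, y) ∈ A) (v : Ω) : (v, y) ∉ α := by
  intro hv
  obtain ⟨v', rfl⟩ : v ∈ range F := by
    by_contra h
    exact m.arrow_notMem hxy ((m.start hv).2 h)
  have := m.map_inj hu (m.back hv hxy)
  subst this
  exact hFu _ hv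

/-- Extending the partial isomorphism along an arrow. -/
theorem insert_succ (m : PartialModel F S A α) (hF : Injective F) {u x y : Ω}
    (hu : (u, x) ∈ α) (hFu : ∀ y, (F u, y) ∉ α) (hxy : (x, y) ∈ A) :
    PartialModel F S A (insert (F u, y) α) where
  arrow_fun := m.arrow_fun
  arrow_inj := m.arrow_inj
  arrow_notMem := m.arrow_notMem
  map_fun h h' := by
    simp only [mem_insert_iff, Prod.mk.injEq] at h h'
    grind [m.map_fun]
  map_inj h h' := by
    have := m.notMem_of_pending hu hFu hxy
    simp only [mem_insert_iff, Prod.mk.injEq] at h h'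
    grind [m.map_inj]
  hom {v a b} h h' := by
    simp only [mem_insert_iff, Prod.mk.injEq] at h h'
    rcases h with ⟨rfl, rfl⟩ | h <;> rcases h' with ⟨h', rfl⟩ | h'
    · have := hF h'
      exact absurd (this.symm ▸ hu) (hFu x)
    · obtain ⟨z, hz⟩ := m.convex (n := 2) hu h' one_le_two
      exact absurd hz (hFu z)
    · have := hF h'
      subst this
      rwa [m.map_fun h hu]
    · exact m.hom h h'
  back {v a b} h h' := by
    simp only [mem_insert_iff, Prod.mk.injEq] at h
    rcases h with ⟨h, rfl⟩ | h
    · rw [hF h, m.arrow_inj h' hxy]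
      exact .inr hu
    · exact .inr (m.back h h')
  start {v a} h := by
    simp only [mem_insert_iff, Prod.mk.injEq] at h
    rcases h with ⟨rfl, rfl⟩ | h
    · simp [m.arrow_notMem hxy]
    · exact m.start h
  start_dom h := (m.start_dom h).imp fun _ => .inr
  start_ran h := (m.start_ran h).imp fun _ => .inr
  convex h h' hi := m.convex_insert_succ hF hu hFu h h' hi
  reach z := (m.reach z).mono (subset_insert _ _)

/-- Prepending a fresh point to a placed point without predecessor. -/
theorem insert_pred (m : PartialModel F S A α) (hF : Injective F) {u w y : Ω}
    (hu : (F u, y) ∈ α) (huα : ∀ y, (u, y) ∉ α) (hw : Fresh A α w) :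
    PartialModel F S (insert (w, y) A) (insert (u, w) α) where
  arrow_fun h h' := by
    have := hw.1
    simp only [mem_insert_iff, Prod.mk.injEq] at h h'
    grind [m.arrow_fun]
  arrow_inj h h' := by
    have : ∀ z, (z, y) ∉ A := fun z hz => huα _ (m.back hu hz)
    simp only [mem_insert_iff, Prod.mk.injEq] at h h'
    grind [m.arrow_inj]
  arrow_notMem h hS := by
    simp only [mem_insert_iff, Prod.mk.injEq] at h
    rcases h with ⟨rfl, rfl⟩ | h
    · exact (m.start hu).1 hS ⟨u, rfl⟩
    · exact m.arrow_notMem h hS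
  map_fun h h' := by
    simp only [mem_insert_iff, Prod.mk.injEq] at h h'
    grind [m.map_fun]
  map_inj h h' := by
    have := hw.2.2
    simp only [mem_insert_iff, Prod.mk.injEq] at h h'
    grind [m.map_inj]
  hom {v a b} h h' := by
    simp only [mem_insert_iff, Prod.mk.injEq] at h h' ⊢
    rcases h with ⟨rfl, rfl⟩ | h <;> rcases h' with ⟨h', rfl⟩ | h'
    · rw [h'] at hu
      exact absurd hu (huα _)
    · exact .inl ⟨rfl, m.map_fun h' hu⟩
    · subst h'
      obtain ⟨z, hz⟩ := m.convex (n := 2) (i := 1) h hu one_le_two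
      exact absurd hz (huα z)
    · exact .inr (m.hom h h')
  back {v a b} h h' := by
    simp only [mem_insert_iff, Prod.mk.injEq] at h h' ⊢
    rcases h with ⟨rfl, rfl⟩ | h <;> rcases h' with ⟨rfl, rfl⟩ | h'
    · exact absurd hu (hw.2.2 _)
    · exact absurd h' (hw.2.1 _)
    · exact .inl ⟨hF (m.map_inj h hu), rfl⟩
    · exact .inr (m.back h h')
  start {v a} h := by
    simp only [mem_insert_iff, Prod.mk.injEq] at h
    rcases h with ⟨rfl, rfl⟩ | h
    · have : v ∈ range F := by
        by_contra h
        exact (m.start_dom h).elim fun z hz => huα z hz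
      simp [m.notMem_of_fresh hw, this]
    · exact m.start h
  start_dom h := (m.start_dom h).imp fun _ => .inr
  start_ran h := (m.start_ran h).imp fun _ => .inr
  convex {v a b n i} h h' hi := by
    rcases Nat.eq_zero_or_pos i with rfl | hi0
    · exact ⟨a, h⟩
    rcases hi.eq_or_lt with rfl | hlt
    · exact ⟨b, h'⟩
    obtain ⟨n, rfl⟩ : ∃ k, n = k + 1 := ⟨n - 1, by omega⟩
    obtain ⟨i, rfl⟩ : ∃ k, i = k + 1 := ⟨i - 1, by omega⟩
    simp only [mem_insert_iff, Prod.mk.injEq] at h h'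
    rcases h with ⟨rfl, rfl⟩ | h <;> rcases h' with ⟨h', rfl⟩ | h'
    · have h2 : (F^[n + 1] (F v), y) ∈ α := by
        rw [← iterate_succ_apply, iterate_succ_apply', h']
        exact hu
      obtain ⟨z, hz⟩ := m.convex hu h2 (Nat.le_succ n)
      rw [← iterate_succ_apply, h'] at hz
      exact absurd hz (huα z)
    · rw [iterate_succ_apply] at h'
      obtain ⟨z, hz⟩ := m.convex hu h' (Nat.le_of_succ_le_succ hi)
      exact ⟨z, .inr hz⟩
    · have h2 : (F^[n + 2] v, y) ∈ α := by
        rw [iterate_succ_apply', h']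
        exact hu
      obtain ⟨z, hz⟩ := m.convex h h2 (Nat.le_succ (n + 1))
      rw [h'] at hz
      exact absurd hz (huα z)
    · obtain ⟨z, hz⟩ := m.convex h h' hi
      exact ⟨z, .inr hz⟩
  reach z := by
    induction m.reach z with
    | placed hu => exact .placed (.inr hu)
    | @source z hs =>
      by_cases hzy : z = y
      · subst hzy
        exact .placed (.inr hu)
      · refine .source fun x' hx' => ?_
        rcases hx' with h | h
        · cases h; exact hzy rfl
        · exact hs _ h
    | step h _ ih => exact .step (.inr h) ih

/-- Adding an arrow, one end of which is fresh, extending the partial isomorphism if needed. -/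
theorem insert_arrow_of_fresh (m : PartialModel F S A α) (hF : Injective F) {x y : Ω}
    (hx : ∀ z, (x, z) ∉ A) (hy : ∀ z, (z, y) ∉ A) (hyS : y ∉ S) (hxy : x ≠ y)
    (hfr : Fresh A α x ∨ Fresh A α y) :
    ∃ α', α ⊆ α' ∧ (α' \ α).Finite ∧ (∀ u z, (u, z) ∈ α' → (u, z) ∈ α ∨ z = x) ∧
      PartialModel F S (insert (x, y) A) α' := by
  by_cases hyα : ∀ u, (u, y) ∉ α
  · refine ⟨α, subset_rfl, by simp, fun _ _ => .inl, m.insert_arrow hx hy hyα ?_⟩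
    rcases hfr with h | h
    · refine .source fun z hz => ?_
      rcases hz with hz | hz
      · cases hz; exact hxy rfl
      · exact h.2.1 _ hz
    · exact m.reach_insert_of_fresh hxy h.1
  -- A placed `y` is not fresh, so `x` is. The position of `x` is forced: it precedes that of `y`.
  · push Not at hyα
    obtain ⟨v, hv⟩ := hyα
    have hxf : Fresh A α x := hfr.resolve_right fun h => h.2.2 _ hv
    obtain ⟨u, rfl⟩ : v ∈ range F := by
      by_contra h
      exact hyS ((m.start hv).2 h)
    refine ⟨insert (u, x) α, subset_insert _ _, (finite_singleton (u, x)).subset ?_, ?_,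
      m.insert_pred hF hv (fun z hz => hy z (m.hom hz hv)) hxf⟩
    · rintro p ⟨hp | hp, hp'⟩
      · exact hp
      · exact absurd hp hp'
    · rintro v z (h | h)
      · cases h; exact .inr rfl
      · exact .inl h

/-- Adding isolated arrows between fresh points. -/
theorem union_isolated (m : PartialModel F S A α) {ι : Type*} {I : Set ι} {c d : ι → Ω}
    (hc : InjOn c I) (hd : InjOn d I) (hcd : ∀ i ∈ I, ∀ j ∈ I, c i ≠ d j)
    (hcf : ∀ i ∈ I, Fresh A α (c i)) (hdf : ∀ i ∈ I, Fresh A α (d i)) :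
    PartialModel F S (A ∪ (fun i => (c i, d i)) '' I) α where
  arrow_fun {x y y'} h h' := by
    simp only [mem_union, mem_image, Prod.mk.injEq] at h h'
    rcases h with h | ⟨i, hi, rfl, rfl⟩ <;> rcases h' with h' | ⟨j, hj, h', rfl⟩
    · exact m.arrow_fun h h'
    · subst h'
      exact absurd h ((hcf j hj).1 _)
    · exact absurd h' ((hcf i hi).1 _)
    · rw [hc hj hi h']
  arrow_inj {x x' y} h h' := by
    simp only [mem_union, mem_image, Prod.mk.injEq] at h h'
    rcases h with h | ⟨i, hi, rfl, rfl⟩ <;> rcases h' with h' | ⟨j, hj, rfl, h'⟩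
    · exact m.arrow_inj h h'
    · subst h'
      exact absurd h ((hdf j hj).2.1 _)
    · exact absurd h' ((hdf i hi).2.1 _)
    · rw [hd hj hi h']
  arrow_notMem {x y} h := by
    simp only [mem_union, mem_image, Prod.mk.injEq] at h
    rcases h with h | ⟨i, hi, rfl, rfl⟩
    · exact m.arrow_notMem h
    · exact m.notMem_of_fresh (hdf i hi)
  map_fun := m.map_fun
  map_inj := m.map_inj
  hom h h' := .inl (m.hom h h')
  back {u x y} h h' := by
    simp only [mem_union, mem_image, Prod.mk.injEq] at h'
    rcases h' with h' | ⟨i, hi, rfl, rfl⟩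
    · exact m.back h h'
    · exact absurd h ((hdf i hi).2.2 _)
  start := m.start
  start_dom := m.start_dom
  start_ran := m.start_ran
  convex := m.convex
  reach z := by
    induction m.reach z with
    | placed hu => exact .placed hu
    | @source z hs =>
      by_cases hz : ∃ i ∈ I, d i = z
      · obtain ⟨i, hi, rfl⟩ := hz
        refine .step (.inr ⟨i, hi, rfl⟩) (.source fun x' hx' => ?_)
        simp only [mem_union, mem_image, Prod.mk.injEq] at hx'
        rcases hx' with h | ⟨j, hj, -, h⟩
        · exact (hcf i hi).2.1 _ h
        · exact hcd i hi j hj h.symm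
      · refine .source fun x' hx' => ?_
        simp only [mem_union, mem_image, Prod.mk.injEq] at hx'
        rcases hx' with h | ⟨j, hj, -, h⟩
        · exact hs _ h
        · exact hz ⟨j, hj, h⟩
    | step h _ ih => exact .step (.inl h) ih

/-- Placing a new convex set of positions, that is not linked to the domain, on fresh points. -/
theorem union_component (m : PartialModel F S A α) (hF : Injective F) {U : Set Ω} {ω : Ω → Ω}
    (hω : Injective ω) (hωf : ∀ i, Fresh A α (ω i))
    (hUc : ∀ u ∈ U, ∀ n i : ℕ, F^[n] u ∈ U → i ≤ n → F^[i] u ∈ U)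
    (hU1 : ∀ u ∈ U, ∀ (n : ℕ) x, (F^[n] u, x) ∉ α)
    (hU2 : ∀ u x, (u, x) ∈ α → ∀ n : ℕ, F^[n] u ∉ U) :
    PartialModel F S (A ∪ (fun i => (ω i, ω (F i))) '' {u | u ∈ U ∧ F u ∈ U})
      (α ∪ (fun i => (i, ω i)) '' U) where
  arrow_fun {x y y'} h h' := by
    simp only [mem_union, mem_image, Prod.mk.injEq] at h h'
    rcases h with h | ⟨i, hi, rfl, rfl⟩ <;> rcases h' with h' | ⟨j, hj, h', rfl⟩
    · exact m.arrow_fun h h'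
    · subst h'
      exact absurd h ((hωf j).1 _)
    · exact absurd h' ((hωf i).1 _)
    · rw [hω h']
  arrow_inj {x x' y} h h' := by
    simp only [mem_union, mem_image, Prod.mk.injEq] at h h'
    rcases h with h | ⟨i, hi, rfl, rfl⟩ <;> rcases h' with h' | ⟨j, hj, rfl, h'⟩
    · exact m.arrow_inj h h'
    · subst h'
      exact absurd h ((hωf _).2.1 _)
    · exact absurd h' ((hωf _).2.1 _)
    · rw [hF (hω h')]
  arrow_notMem {x y} h := by
    simp only [mem_union, mem_image, Prod.mk.injEq] at h
    rcases h with h | ⟨i, hi, rfl, rfl⟩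
    · exact m.arrow_notMem h
    · exact m.notMem_of_fresh (hωf _)
  map_fun {u x x'} h h' := by
    simp only [mem_union, mem_image, Prod.mk.injEq] at h h'
    rcases h with h | ⟨i, hi, rfl, rfl⟩ <;> rcases h' with h' | ⟨j, hj, h', rfl⟩
    · exact m.map_fun h h'
    · subst h'
      exact absurd h (hU1 _ hj 0 _)
    · exact absurd h' (hU1 _ hi 0 _)
    · rw [h']
  map_inj {u u' x} h h' := by
    simp only [mem_union, mem_image, Prod.mk.injEq] at h h'
    rcases h with h | ⟨i, hi, rfl, rfl⟩ <;> rcases h' with h' | ⟨j, hj, rfl, h'⟩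
    · exact m.map_inj h h'
    · subst h'
      exact absurd h ((hωf _).2.2 _)
    · exact absurd h' ((hωf _).2.2 _)
    · rw [hω h']
  hom {u x y} h h' := by
    simp only [mem_union, mem_image, Prod.mk.injEq] at h h' ⊢
    rcases h with h | ⟨i, hi, rfl, rfl⟩ <;> rcases h' with h' | ⟨j, hj, rfl, rfl⟩
    · exact .inl (m.hom h h')
    · exact absurd hj (hU2 _ _ h 1)
    · exact absurd h' (hU1 _ hi 1 _)
    · exact .inr ⟨i, ⟨hi, hj⟩, rfl, rfl⟩
  back {u x y} h h' := by
    simp only [mem_union, mem_image, Prod.mk.injEq] at h h' ⊢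
    rcases h with h | ⟨i, hi, rfl, rfl⟩ <;> rcases h' with h' | ⟨j, hj, rfl, h'⟩
    · exact .inl (m.back h h')
    · subst h'
      exact absurd h ((hωf _).2.2 _)
    · exact absurd h' ((hωf _).2.1 _)
    · have := hF (hω h')
      subst this
      exact .inr ⟨j, hj.1, rfl, rfl⟩
  start {u x} h := by
    simp only [mem_union, mem_image, Prod.mk.injEq] at h
    rcases h with h | ⟨i, hi, rfl, rfl⟩
    · exact m.start h
    · have : i ∈ range F := by
        by_contra h
        exact (m.start_dom h).elim fun z hz => hU1 _ hi 0 z hz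
      simp [m.notMem_of_fresh (hωf i), this]
  start_dom h := (m.start_dom h).imp fun _ => .inl
  start_ran h := (m.start_ran h).imp fun _ => .inl
  convex {u x y n i} h h' hi := by
    simp only [mem_union, mem_image, Prod.mk.injEq] at h h' ⊢
    rcases h with h | ⟨j, hj, rfl, rfl⟩ <;> rcases h' with h' | ⟨k, hk, h', rfl⟩
    · exact (m.convex h h' hi).imp fun _ => .inl
    · subst h'
      exact absurd hk (hU2 _ _ h n)
    · exact absurd h' (hU1 _ hj n _)
    · subst h'
      exact ⟨_, .inr ⟨_, hUc _ hj _ _ hk hi, rfl, rfl⟩⟩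
  reach z := by
    induction m.reach z with
    | placed hu => exact .placed (.inl hu)
    | @source z hs =>
      by_cases hz : ∃ i ∈ U, ω i = z
      · obtain ⟨i, hi, rfl⟩ := hz
        exact .placed (.inr ⟨i, hi, rfl⟩)
      · refine .source fun x' hx' => ?_
        simp only [mem_union, mem_image, Prod.mk.injEq] at hx'
        rcases hx' with h | ⟨j, hj, -, h⟩
        · exact hs _ h
        · exact hz ⟨_, hj.2, h⟩
    | step h _ ih => exact .step (.inl h) ih

/-- A forward orbit that meets the domain of the partial isomorphism in a finite nonempty set has
a last point in the domain; the partial isomorphism can be extended along the existing arrows such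
that the corresponding point has no outgoing arrow. -/
theorem exists_tip (hF : Injective F) {u₀ x₀ : Ω} (hinj : Injective fun n : ℕ => F^[n] u₀) :
    ∀ (k : ℕ) (α : Set (Ω × Ω)), PartialModel F S A α → (u₀, x₀) ∈ α →
    {n : ℕ | ∃ x, (F^[n] u₀, x) ∈ α}.Finite →
    {p | p ∈ A ∧ ∀ u, (u, p.2) ∉ α}.Finite → {p | p ∈ A ∧ ∀ u, (u, p.2) ∉ α}.ncard = k →
    ∃ α', α ⊆ α' ∧ (α' \ α).Finite ∧ PartialModel F S A α' ∧
      ∃ u x, (u, x) ∈ α' ∧ (∀ y, (F u, y) ∉ α') ∧ (∀ y, (x, y) ∉ A) ∧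
        ∀ y, (F (F u), y) ∉ α' := by
  intro k
  induction k using Nat.strong_induction_on with
  | _ k ih =>
  intro α m h0 hfin hpend hk
  obtain ⟨n, ⟨x, hn⟩, hmax⟩ := hfin.exists_maximal ⟨0, x₀, h0⟩
  have hsucc : ∀ j, n < j → ∀ y, (F^[j] u₀, y) ∉ α := fun j hj y hy =>
    absurd (hmax ⟨y, hy⟩ hj.le) (not_le.2 hj)
  have hFu : ∀ y, (F (F^[n] u₀), y) ∉ α := fun y => by
    rw [← iterate_succ_apply' F]
    exact hsucc _ (Nat.lt_succ_self n) y
  by_cases hx : ∀ y, (x, y) ∉ A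
  · refine ⟨α, subset_rfl, by simp, m, _, x, hn, hFu, hx, fun y => ?_⟩
    rw [← iterate_succ_apply' F, ← iterate_succ_apply' F]
    exact hsucc _ (by omega) y
  · push Not at hx
    obtain ⟨y, hxy⟩ := hx
    -- Following an existing arrow uses up a pending one, so the walk along the orbit must stop.
    have hsub : {p | p ∈ A ∧ ∀ u, (u, p.2) ∉ insert (F (F^[n] u₀), y) α} ⊂
        {p | p ∈ A ∧ ∀ u, (u, p.2) ∉ α} := by
      refine ⟨fun p hp => ⟨hp.1, fun u hu => hp.2 u (.inr hu)⟩, fun h => ?_⟩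
      exact (h ⟨hxy, m.notMem_of_pending hn hFu hxy⟩).2 _ (.inl rfl)
    have hfin' : {j : ℕ | ∃ z, (F^[j] u₀, z) ∈ insert (F (F^[n] u₀), y) α}.Finite := by
      refine (hfin.union (finite_singleton (n + 1))).subset ?_
      rintro j ⟨z, hz | hz⟩
      · refine .inr (hinj ?_)
        rw [Prod.mk.injEq, ← iterate_succ_apply' F] at hz
        exact hz.1
      · exact .inl ⟨z, hz⟩
    obtain ⟨α', h1, h2, h3⟩ := ih _ (hk ▸ ncard_lt_ncard hsub hpend) _
      (m.insert_succ hF hn hFu hxy) (.inr h0) hfin' (hpend.subset hsub.subset) rfl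
    refine ⟨α', (subset_insert _ _).trans h1,
      (h2.union (finite_singleton (F (F^[n] u₀), y))).subset ?_, h3⟩
    rintro p ⟨hp, hp'⟩
    by_cases h : p = (F (F^[n] u₀), y)
    · exact .inr h
    · exact .inl ⟨hp, fun h' => h'.elim h hp'⟩

end PartialModel

end PartialModel

/-! ### Simultaneous extension of two partial models -/

/-- Two injections `F` and `G` that are modelled simultaneously. An arrow `(a, b)` of the model
of `F` gives rise to the arrow `(r b, l a)` of the model of `G`. -/
structure Frame (Ω : Type*) where
  F : Ω → Ω
  G : Ω → Ω
  l : Ω → Ω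
  r : Ω → Ω
  S : Set Ω
  S' : Set Ω
  Y : Set Ω
  pool : Set Ω
  u₀ : Ω
  hF : Injective F
  hG : Injective G
  hl : Injective l
  hr : InjOn r Y
  pool_subset : pool ⊆ Y
  pool_infinite : pool.Infinite
  pool_ne : ∀ w ∈ pool, ∀ w' ∈ pool, r w ≠ l w'
  orbit : Injective fun n : ℕ => F^[n] u₀

/-- A pair of partial models that are compatible in the sense of the frame `Φ`. -/
structure Conf {Ω : Type*} (Φ : Frame Ω) where
  A : Set (Ω × Ω)
  α : Set (Ω × Ω)
  B : Set (Ω × Ω)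
  β : Set (Ω × Ω)
  mA : PartialModel Φ.F Φ.S A α
  mB : PartialModel Φ.G Φ.S' B β
  -- `left` and `right` ensure that the dual of a newly added arrow never clashes with an arrow of
  -- `B`.
  left : ∀ a, (∀ b, (a, b) ∉ A) → (∀ c, (c, Φ.l a) ∉ B) ∧ Φ.l a ∉ Φ.S'
  right : ∀ b, (∀ a, (a, b) ∉ A) → b ∉ Φ.S → b ∈ Φ.Y ∧ ∀ c, (Φ.r b, c) ∉ B
  fresh : {w | w ∈ Φ.pool ∧ ¬ (Fresh A α w ∧ Fresh B β (Φ.l w) ∧ Fresh B β (Φ.r w))}.Finite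
  pending : {p | p ∈ A ∧ ∀ u, (u, p.2) ∉ α}.Finite
  orbit : {n : ℕ | ∃ x, (Φ.F^[n] Φ.u₀, x) ∈ α}.Finite

namespace Conf

variable {Ω : Type*} {Φ : Frame Ω}

/-- `C'` extends `C` by finitely many arrows. -/
def Extends (C C' : Conf Φ) : Prop :=
  ∃ E : Set (Ω × Ω), E.Finite ∧ (∀ e ∈ E, e.2 ∈ Φ.Y) ∧ C'.A = C.A ∪ E ∧
    C'.B = C.B ∪ (fun e => (Φ.r e.2, Φ.l e.1)) '' E ∧ C.α ⊆ C'.α ∧ C.β ⊆ C'.β ∧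
    (C'.α \ C.α).Finite ∧ (C'.β \ C.β).Finite

theorem Extends.refl (C : Conf Φ) : C.Extends C :=
  ⟨∅, finite_empty, by simp, by simp, by simp, subset_rfl, subset_rfl, by simp, by simp⟩

theorem Extends.trans {C C' C'' : Conf Φ} (h : C.Extends C') (h' : C'.Extends C'') :
    C.Extends C'' := by
  obtain ⟨E, h1, h2, h3, h4, h5, h6, h7, h8⟩ := h
  obtain ⟨E', h1', h2', h3', h4', h5', h6', h7', h8'⟩ := h'
  refine ⟨E ∪ E', h1.union h1', ?_, ?_, ?_, h5.trans h5', h6.trans h6',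
    (h7.union h7').subset ?_, (h8.union h8').subset ?_⟩
  · rintro e (he | he)
    exacts [h2 e he, h2' e he]
  · rw [h3', h3, union_assoc]
  · rw [h4', h4, image_union, union_assoc]
  · rintro e ⟨he, he'⟩
    by_cases h : e ∈ C'.α
    exacts [.inl ⟨h, he'⟩, .inr ⟨he, h⟩]
  · rintro e ⟨he, he'⟩
    by_cases h : e ∈ C'.β
    exacts [.inl ⟨h, he'⟩, .inr ⟨he, h⟩]

theorem finite_not_fresh_union {A α E γ : Set (Ω × Ω)} (hE : E.Finite) (hγ : (γ \ α).Finite) :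
    {w | Fresh A α w ∧ ¬ Fresh (A ∪ E) γ w}.Finite := by
  refine (((hE.image Prod.fst).union (hE.image Prod.snd)).union (hγ.image Prod.snd)).subset ?_
  rintro w ⟨hw, hw'⟩
  by_contra h
  refine hw' ⟨?_, ?_, ?_⟩
  · rintro x (hx | hx)
    · exact hw.1 x hx
    · exact h (.inl (.inl ⟨_, hx, rfl⟩))
  · rintro x (hx | hx)
    · exact hw.2.1 x hx
    · exact h (.inl (.inr ⟨_, hx, rfl⟩))
  · intro x hx
    exact h (.inr ⟨_, ⟨hx, hw.2.2 x⟩, rfl⟩)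

/-- Constructor for extensions of a configuration. -/
theorem exists_extends (C : Conf Φ) {E α' β' : Set (Ω × Ω)} (hE : E.Finite)
    (hY : ∀ e ∈ E, e.2 ∈ Φ.Y) (hα : C.α ⊆ α') (hα' : (α' \ C.α).Finite) (hβ : C.β ⊆ β')
    (hβ' : (β' \ C.β).Finite) (mA : PartialModel Φ.F Φ.S (C.A ∪ E) α')
    (mB : PartialModel Φ.G Φ.S' (C.B ∪ (fun e => (Φ.r e.2, Φ.l e.1)) '' E) β') :
    ∃ C' : Conf Φ, C.Extends C' ∧ C'.A = C.A ∪ E ∧ C'.α = α' := by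
  refine ⟨⟨C.A ∪ E, α', C.B ∪ (fun e => (Φ.r e.2, Φ.l e.1)) '' E, β', mA, mB, ?_, ?_, ?_, ?_, ?_⟩,
    ⟨E, hE, hY, rfl, rfl, hα, hβ, hα', hβ'⟩, rfl, rfl⟩
  · intro a ha
    obtain ⟨h1, h2⟩ := C.left a fun b hb => ha b (.inl hb)
    refine ⟨?_, h2⟩
    rintro c (hc | ⟨⟨x, y⟩, he, hc⟩)
    · exact h1 c hc
    · have := Φ.hl (Prod.mk.inj hc).2
      subst this
      exact ha _ (.inr he)
  · intro b hb hbS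
    obtain ⟨h1, h2⟩ := C.right b (fun a ha => hb a (.inl ha)) hbS
    refine ⟨h1, ?_⟩
    rintro c (hc | ⟨⟨x, y⟩, he, hc⟩)
    · exact h2 c hc
    · have := Φ.hr (hY _ he) h1 (Prod.mk.inj hc).1
      dsimp only at this
      subst this
      exact hb _ (.inr he)
  · have hB := finite_not_fresh_union (A := C.B) (hE.image fun e => (Φ.r e.2, Φ.l e.1)) hβ'
    have hl := hB.preimage Φ.hl.injOn
    have hr : {w | w ∈ Φ.pool ∧ Φ.r w ∈ {w | Fresh C.B C.β w ∧
        ¬ Fresh (C.B ∪ (fun e => (Φ.r e.2, Φ.l e.1)) '' E) β' w}}.Finite :=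
      Finite.of_finite_image (hB.subset (by rintro _ ⟨w, hw, rfl⟩; exact hw.2))
        (Φ.hr.mono fun w hw => Φ.pool_subset hw.1)
    refine (((C.fresh.union (finite_not_fresh_union (A := C.A) hE hα')).union hl).union
      hr).subset ?_
    rintro w ⟨hw, hw'⟩
    by_contra h
    simp only [mem_union, mem_ofPred_eq, mem_preimage] at h
    tauto
  · refine (C.pending.union hE).subset ?_
    rintro p ⟨hp | hp, hp'⟩
    · exact .inl ⟨hp, fun u hu => hp' u (hα hu)⟩
    · exact .inr hp
  · refine (C.orbit.union ((hα'.image Prod.fst).preimage Φ.orbit.injOn)).subset ?_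
    rintro n ⟨x, hx⟩
    by_cases h : (Φ.F^[n] Φ.u₀, x) ∈ C.α
    · exact .inl ⟨x, h⟩
    · exact .inr ⟨_, ⟨hx, h⟩, rfl⟩

/-- A point of the pool that is not yet involved. -/
structure Avail (C : Conf Φ) (w : Ω) : Prop where
  mem : w ∈ Φ.pool
  freshA : Fresh C.A C.α w
  freshl : Fresh C.B C.β (Φ.l w)
  freshr : Fresh C.B C.β (Φ.r w)

theorem infinite_avail (C : Conf Φ) : {w | C.Avail w}.Infinite := by
  refine (Φ.pool_infinite.sdiff C.fresh).mono ?_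
  rintro w ⟨hw, hw'⟩
  have : Fresh C.A C.α w ∧ Fresh C.B C.β (Φ.l w) ∧ Fresh C.B C.β (Φ.r w) := by
    by_contra h
    exact hw' ⟨hw, h⟩
  exact ⟨hw, this.1, this.2.1, this.2.2⟩

/-- The inequalities keep the arrows `(x, w)` and `(w, y)` and their duals from being loops. Each
excludes at most one point of the pool. -/
theorem exists_avail (C : Conf Φ) (x y : Ω) :
    ∃ w, C.Avail w ∧ w ≠ x ∧ w ≠ y ∧ Φ.r w ≠ Φ.l x ∧ Φ.l w ≠ Φ.r y := by
  have hr : {w | w ∈ Φ.pool ∧ Φ.r w ∈ ({Φ.l x} : Set Ω)}.Finite :=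
    Finite.of_finite_image ((finite_singleton (Φ.l x)).subset (by rintro _ ⟨w, hw, rfl⟩; exact hw.2))
      (Φ.hr.mono fun w hw => Φ.pool_subset hw.1)
  have hl := (finite_singleton (Φ.r y)).preimage Φ.hl.injOn
  obtain ⟨w, hw, hw'⟩ := (C.infinite_avail.sdiff
    (((finite_singleton x).union (finite_singleton y)).union (hr.union hl))).nonempty
  simp only [mem_union, mem_singleton_iff, mem_ofPred_eq, mem_preimage, not_or, not_and] at hw'
  exact ⟨w, hw, hw'.1.1, hw'.1.2, hw'.2.1 hw.mem, hw'.2.2⟩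

theorem right_of_placed (C : Conf Φ) {u x : Ω} (hu : ∀ y, (u, y) ∉ C.α)
    (hx : (Φ.F u, x) ∈ C.α) : (∀ a, (a, x) ∉ C.A) ∧ x ∉ Φ.S :=
  ⟨fun a ha => hu a (C.mA.back hx ha), fun h => (C.mA.start hx).1 h ⟨u, rfl⟩⟩

/-- The position following a placed position can be placed. -/
theorem exists_place_succ (C : Conf Φ) {u x : Ω} (hu : (u, x) ∈ C.α) :
    ∃ C', C.Extends C' ∧ ∃ y, (Φ.F u, y) ∈ C'.α := by
  by_cases hFu : ∃ y, (Φ.F u, y) ∈ C.α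
  · exact ⟨C, .refl C, hFu⟩
  push Not at hFu
  by_cases hx : ∃ y, (x, y) ∈ C.A
  · obtain ⟨y, hy⟩ := hx
    obtain ⟨C', h1, -, h2⟩ := C.exists_extends (E := ∅) finite_empty (by simp)
      (subset_insert (Φ.F u, y) C.α) ((finite_singleton (Φ.F u, y)).subset (by
        rintro p ⟨hp | hp, hp'⟩
        exacts [hp, absurd hp hp'])) (subset_refl C.β) (by simp)
      (by simpa using C.mA.insert_succ Φ.hF hu hFu hy) (by simpa using C.mB)
    exact ⟨C', h1, y, h2 ▸ .inl rfl⟩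
  push Not at hx
  obtain ⟨w, hw, hwx, -, hwl, -⟩ := C.exists_avail x x
  obtain ⟨hl1, hl2⟩ := C.left x hx
  obtain ⟨β', hβ1, hβ2, -, hβ3⟩ := C.mB.insert_arrow_of_fresh Φ.hG hw.freshr.1 hl1 hl2 hwl
    (.inl hw.freshr)
  have mA := C.mA.insert_arrow hx hw.freshA.2.1 hw.freshA.2.2 (.placed hu)
  obtain ⟨C', h1, -, h2⟩ := C.exists_extends (E := {(x, w)}) (finite_singleton _)
    (by simpa using Φ.pool_subset hw.mem)
    (subset_insert (Φ.F u, w) C.α) ((finite_singleton (Φ.F u, w)).subset (by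
      rintro p ⟨hp | hp, hp'⟩
      exacts [hp, absurd hp hp'])) hβ1 hβ2
    (by simpa using mA.insert_succ Φ.hF hu hFu (.inl rfl)) (by simpa using hβ3)
  exact ⟨C', h1, w, h2 ▸ .inl rfl⟩

/-- The position preceding a placed position can be placed. -/
theorem exists_place_pred (C : Conf Φ) {u y : Ω} (hu : (Φ.F u, y) ∈ C.α) :
    ∃ C', C.Extends C' ∧ ∃ x, (u, x) ∈ C'.α := by
  by_cases huα : ∃ x, (u, x) ∈ C.α
  · exact ⟨C, .refl C, huα⟩
  push Not at huα
  obtain ⟨hy1, hy2⟩ := C.right_of_placed huα hu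
  obtain ⟨hy3, hy4⟩ := C.right y hy1 hy2
  obtain ⟨w, hw, -, hwy, -, hwr⟩ := C.exists_avail y y
  obtain ⟨β', hβ1, hβ2, -, hβ3⟩ := C.mB.insert_arrow_of_fresh Φ.hG hy4 hw.freshl.2.1
    (C.mB.notMem_of_fresh hw.freshl) hwr.symm (.inr hw.freshl)
  obtain ⟨C', h1, -, h2⟩ := C.exists_extends (E := {(w, y)}) (finite_singleton _)
    (by simpa using hy3)
    (subset_insert (u, w) C.α) ((finite_singleton (u, w)).subset (by
      rintro p ⟨hp | hp, hp'⟩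
      exacts [hp, absurd hp hp'])) hβ1 hβ2
    (by simpa using C.mA.insert_pred Φ.hF hu huα hw.freshA) (by simpa using hβ3)
  exact ⟨C', h1, w, h2 ▸ .inl rfl⟩

/-- A position whose orbit does not meet the domain can be placed. -/
theorem exists_place_new [Countable Ω] (C : Conf Φ) (u : Ω)
    (h1 : ∀ (n : ℕ) x, (Φ.F^[n] u, x) ∉ C.α) (h2 : ∀ v x, (v, x) ∈ C.α → ∀ n : ℕ, Φ.F^[n] v ≠ u) :
    ∃ C', C.Extends C' ∧ ∃ x, (u, x) ∈ C'.α := by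
  obtain ⟨ω, hω, hωf⟩ : ∃ ω : Ω → Ω, Injective ω ∧ ∀ v, C.Avail (ω v) := by
    obtain ⟨k, hk⟩ := exists_injective_nat Ω
    have e := C.infinite_avail.natEmbedding
    exact ⟨fun v => e (k v), Subtype.val_injective.comp (e.injective.comp hk), fun v => (e (k v)).2⟩
  obtain ⟨U, hUu, hUfin, hUc, hU1, hU2⟩ : ∃ U : Set Ω, u ∈ U ∧ U.Finite ∧
      (∀ u ∈ U, ∀ n i : ℕ, Φ.F^[n] u ∈ U → i ≤ n → Φ.F^[i] u ∈ U) ∧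
      (∀ u ∈ U, ∀ (n : ℕ) x, (Φ.F^[n] u, x) ∉ C.α) ∧
      (∀ u x, (u, x) ∈ C.α → ∀ n : ℕ, Φ.F^[n] u ∉ U) := by
    -- Convexity forbids placing a proper part of a finite cycle, so the whole cycle is placed at
    -- once.
    by_cases hper : u ∈ periodicPts Φ.F
    · refine ⟨{v | ∃ n : ℕ, Φ.F^[n] u = v}, ⟨0, rfl⟩, ?_, ?_, ?_, ?_⟩
      · refine ((finite_lt_nat (minimalPeriod Φ.F u)).image fun n => Φ.F^[n] u).subset ?_
        rintro _ ⟨n, rfl⟩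
        exact ⟨n % minimalPeriod Φ.F u, Nat.mod_lt _ (minimalPeriod_pos_of_mem_periodicPts hper),
          iterate_mod_minimalPeriod_eq⟩
      · rintro _ ⟨k, rfl⟩ n i - -
        exact ⟨i + k, iterate_add_apply _ _ _ _⟩
      · rintro _ ⟨k, rfl⟩ n x
        rw [← iterate_add_apply]
        exact h1 _ _
      · rintro v x hv n ⟨k, hk⟩
        obtain ⟨p, hp, hper⟩ := hper
        have hm : Φ.F^[p * (k + 1)] u = u := (hper.mul_const (k + 1))
        refine h2 v x hv (n + (p * (k + 1) - k)) ?_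
        have : k ≤ p * (k + 1) := by nlinarith
        rw [add_comm, iterate_add_apply, ← hk, ← iterate_add_apply, Nat.sub_add_cancel this, hm]
    · refine ⟨{u}, rfl, finite_singleton u, ?_, ?_, ?_⟩
      · rintro _ rfl n i hn hi
        rcases Nat.eq_zero_or_pos n with rfl | hn0
        · rw [Nat.le_zero.1 hi]; rfl
        · exact absurd ⟨n, hn0, hn⟩ hper
      · rintro _ rfl
        exact h1
      · exact h2
  set I := {v | v ∈ U ∧ Φ.F v ∈ U} with hI
  have hIfin : I.Finite := hUfin.subset fun v hv => hv.1
  have hpool : ∀ v, ω v ∈ Φ.Y := fun v => Φ.pool_subset (hωf v).mem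
  have mB := C.mB.union_isolated (I := I) (c := fun v => Φ.r (ω (Φ.F v)))
    (d := fun v => Φ.l (ω v)) (fun v _ v' _ h => Φ.hF (hω (Φ.hr (hpool _) (hpool _) h)))
    (fun v _ v' _ h => hω (Φ.hl h)) (fun v _ v' _ => Φ.pool_ne _ (hωf _).mem _ (hωf _).mem)
    (fun v _ => (hωf _).freshr) (fun v _ => (hωf _).freshl)
  have mA := C.mA.union_component Φ.hF hω (fun v => (hωf v).freshA) hUc hU1 hU2
  obtain ⟨C', h1, -, h2⟩ := C.exists_extends (E := (fun i => (ω i, ω (Φ.F i))) '' I)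
    (hIfin.image _) (by rintro _ ⟨v, -, rfl⟩; exact hpool _)
    (subset_union_left (t := (fun i => (i, ω i)) '' U)) ((hUfin.image _).subset (by
      rintro p ⟨hp | hp, hp'⟩
      exacts [absurd hp hp', hp])) (subset_refl C.β) (by simp) mA
    (by rw [image_image]; exact mB)
  exact ⟨C', h1, ω u, h2 ▸ .inr ⟨u, hUu, rfl⟩⟩

/-- Every position can be placed. -/
theorem exists_place [Countable Ω] (C : Conf Φ) (u : Ω) :
    ∃ C', C.Extends C' ∧ ∃ x, (u, x) ∈ C'.α := by
  by_cases h1 : ∃ (n : ℕ) (x : Ω), (Φ.F^[n] u, x) ∈ C.α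
  · obtain ⟨n, x, hx⟩ := h1
    induction n generalizing u x with
    | zero => exact ⟨C, .refl C, x, hx⟩
    | succ n ih =>
      obtain ⟨C', hC', y, hy⟩ := ih (Φ.F u) x hx
      obtain ⟨C'', hC'', h⟩ := C'.exists_place_pred hy
      exact ⟨C'', hC'.trans hC'', h⟩
  by_cases h2 : ∃ (v x : Ω) (n : ℕ), (v, x) ∈ C.α ∧ Φ.F^[n] v = u
  · obtain ⟨v, x, n, hx, rfl⟩ := h2
    clear h1
    induction n with
    | zero => exact ⟨C, .refl C, x, hx⟩
    | succ n ih =>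
      obtain ⟨C', hC', y, hy⟩ := ih
      obtain ⟨C'', hC'', h⟩ := C'.exists_place_succ hy
      rw [← iterate_succ_apply' Φ.F] at h
      exact ⟨C'', hC'.trans hC'', h⟩
  push Not at h1 h2
  exact C.exists_place_new u h1 fun v x hv n => h2 v x n hv

/-- A point without incoming arrow can be absorbed at the end of the orbit of `u₀`. -/
theorem exists_absorb_source (C : Conf Φ) {x₀ z : Ω} (h0 : (Φ.u₀, x₀) ∈ C.α)
    (hz : ∀ x, (x, z) ∉ C.A) : ∃ C', C.Extends C' ∧ ∃ u, (u, z) ∈ C'.α := by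
  obtain ⟨α₁, hα, hα', mA, p, x, hp, hFp, hx, hFFp⟩ := PartialModel.exists_tip Φ.hF Φ.orbit _ C.α
    C.mA h0 C.orbit C.pending rfl
  obtain ⟨C₁, hC₁, hA, rfl⟩ := C.exists_extends (E := ∅) finite_empty (by simp) hα hα'
    (subset_refl C.β) (by simp) (by simpa using mA) (by simpa using C.mB)
  rw [union_empty] at hA
  rw [← hA] at hx hz
  by_cases hzα : ∃ u, (u, z) ∈ C₁.α
  · exact ⟨C₁, hC₁, hzα⟩
  push Not at hzα
  have hzS : z ∉ Φ.S := fun h => (C₁.mA.start_ran h).elim fun u hu => hzα u hu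
  -- The tip `x` is joined to `z` through a fresh `w`. A direct arrow would have the dual `(r z, l
  -- x)`, neither end of which need be fresh; the duals of the two arrows through `w` each have a
  -- fresh end when added.
  obtain ⟨w, hw, hwx, hwz, hwl, hwr⟩ := C₁.exists_avail x z
  obtain ⟨hl1, hl2⟩ := C₁.left x hx
  obtain ⟨hr1, hr2⟩ := C₁.right z hz hzS
  have hwY := Φ.pool_subset hw.mem
  have hrne : Φ.r z ≠ Φ.r w := fun h => hwz (Φ.hr hwY hr1 h.symm)
  obtain ⟨β₁, hβ1, hβ2, hβ3, hβ4⟩ := C₁.mB.insert_arrow_of_fresh Φ.hG hw.freshr.1 hl1 hl2 hwl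
    (.inl hw.freshr)
  have hlw : Fresh (insert (Φ.r w, Φ.l x) C₁.B) β₁ (Φ.l w) := by
    have h1 := Φ.pool_ne w hw.mem w hw.mem
    have h2 : Φ.l w ≠ Φ.l x := fun h => hwx (Φ.hl h)
    refine ⟨?_, ?_, ?_⟩
    · rintro c (hc | hc)
      exacts [h1 (Prod.mk.inj hc).1.symm, hw.freshl.1 c hc]
    · rintro c (hc | hc)
      exacts [h2 (Prod.mk.inj hc).2, hw.freshl.2.1 c hc]
    · intro c hc
      rcases hβ3 _ _ hc with hc | hc
      exacts [hw.freshl.2.2 c hc, h1 hc.symm]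
  obtain ⟨β₂, hβ5, hβ6, -, hβ7⟩ := hβ4.insert_arrow_of_fresh Φ.hG (x := Φ.r z) (y := Φ.l w)
    (by rintro c (hc | hc)
        exacts [hrne (Prod.mk.inj hc).1, hr2 c hc]) hlw.2.1 (hβ4.notMem_of_fresh hlw)
    hwr.symm (.inr hlw)
  have m1 := C₁.mA.insert_arrow hx hw.freshA.2.1 hw.freshA.2.2 (.placed hp)
  have m2 := m1.insert_succ Φ.hF hp hFp (.inl rfl)
  have hpw : Φ.F (Φ.F p) ≠ Φ.F p := fun h => hFp x (by rwa [Φ.hF h])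
  have hFFp' : ∀ y, (Φ.F (Φ.F p), y) ∉ insert (Φ.F p, w) C₁.α := by
    rintro y (hy | hy)
    exacts [hpw (Prod.mk.inj hy).1, hFFp y hy]
  have m3 := m2.insert_arrow (x := w) (y := z)
    (by rintro c (hc | hc)
        exacts [hwx (Prod.mk.inj hc).1, hw.freshA.1 c hc])
    (by rintro c (hc | hc)
        exacts [hwz (Prod.mk.inj hc).2.symm, hz c hc])
    (by rintro c (hc | hc)
        exacts [hwz (Prod.mk.inj hc).2.symm, hzα c hc])
    (.placed (.inl rfl))
  have m4 := m3.insert_succ Φ.hF (.inl rfl) hFFp' (.inl rfl)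
  have hE : insert (w, z) (insert (x, w) C₁.A) = C₁.A ∪ {(w, z), (x, w)} := by
    ext e; simp only [mem_insert_iff, mem_union, mem_singleton_iff]; tauto
  have hE' : insert (Φ.r z, Φ.l w) (insert (Φ.r w, Φ.l x) C₁.B) =
      C₁.B ∪ (fun e : Ω × Ω => (Φ.r e.2, Φ.l e.1)) '' {(w, z), (x, w)} := by
    rw [image_pair]
    ext e; simp only [mem_insert_iff, mem_union, mem_singleton_iff]; tauto
  obtain ⟨C', h1, -, h2⟩ := C₁.exists_extends (E := {(w, z), (x, w)}) (toFinite _)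
    (by simp [hwY, hr1])
    ((subset_insert (Φ.F p, w) C₁.α).trans (subset_insert (Φ.F (Φ.F p), z) _))
    ((toFinite {(Φ.F p, w), (Φ.F (Φ.F p), z)}).subset (by
      rintro e ⟨he | he | he, he'⟩
      exacts [.inr he, .inl he, absurd he he'])) (hβ1.trans hβ5)
    ((hβ6.union hβ2).subset (by
      rintro e ⟨he, he'⟩
      by_cases h : e ∈ β₁
      exacts [.inr ⟨h, he'⟩, .inl ⟨he, h⟩]))
    (hE ▸ m4) (hE' ▸ hβ7)
  exact ⟨C', hC₁.trans h1, Φ.F (Φ.F p), h2 ▸ .inl rfl⟩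

/-- Every point can be absorbed. -/
theorem exists_absorb [Countable Ω] (C : Conf Φ) (z : Ω) :
    ∃ C', C.Extends C' ∧ ∃ u, (u, z) ∈ C'.α := by
  obtain ⟨C₁, hC₁, x₀, h0⟩ := C.exists_place Φ.u₀
  suffices h : ∃ C', C₁.Extends C' ∧ ∃ u, (u, z) ∈ C'.α by
    obtain ⟨C', h, h'⟩ := h
    exact ⟨C', hC₁.trans h, h'⟩
  induction C₁.mA.reach z with
  | placed hu => exact ⟨C₁, .refl _, _, hu⟩
  | source hs => exact C₁.exists_absorb_source h0 hs
  | @step x z hxz _ ih =>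
    obtain ⟨C', h, u, hu⟩ := ih
    obtain ⟨C'', h', y, hy⟩ := C'.exists_place_succ hu
    refine ⟨C'', h.trans h', Φ.F u, ?_⟩
    obtain ⟨E, -, -, hA, -⟩ := h.trans h'
    obtain ⟨-, -, -, -, -, hα, -⟩ := h'
    -- The old arrow from `x` to `z` persists, so the image of `F u`, which follows `x`, is `z`.
    have h1 := C''.mA.hom (hα hu) hy
    have h2 : (x, z) ∈ C''.A := hA ▸ .inl hxz
    exact C''.mA.arrow_fun h2 h1 ▸ hy

end Conf

/-! ### Products of conjugates of two injections -/

/-- Three injections such that the points omitted by `h` are labelled by the points omitted by `f`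
and the points omitted by `g`. -/
structure Splice (Ω : Type*) where
  f : Ω → Ω
  g : Ω → Ω
  h : Ω → Ω
  hf : Injective f
  hg : Injective g
  hh : Injective h
  -- The points omitted by the conjugate of `f` will be chosen, by means of `ι`, among those omitted
  -- by the conjugate of `g`.
  ι : {i // i ∉ range f} → {j // j ∉ range g}
  hι : Injective ι
  r : {i // i ∉ range f} → Ω
  q : {j // j ∉ range g} → Ω
  r_inj : Injective r
  q_inj : Injective q
  r_ne_q : ∀ i j, r i ≠ q j
  r_notMem : ∀ i, r i ∉ range h
  q_notMem : ∀ j, q j ∉ range h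
  cover : ∀ x, x ∉ range h → x ∈ range r ∨ x ∈ range q
  uf : Ω
  ug : Ω
  uh : Ω
  orbit_f : Injective fun n : ℕ => f^[n] uf
  orbit_g : Injective fun n : ℕ => g^[n] ug
  orbit_h : Injective fun n : ℕ => h^[n] uh

namespace Splice

variable {Ω : Type*} (σ : Splice Ω)

/-- The points to be omitted by the conjugate of `f`. -/
def Sf : Set Ω := range fun i => σ.q (σ.ι i)

/-- The points to be omitted by the conjugate of `g`. -/
def Sg : Set Ω := range σ.q

/-- The initial partial isomorphism from `f`. -/
def α₀ : Set (Ω × Ω) := range fun i : {i // i ∉ range σ.f} => ((i : Ω), σ.q (σ.ι i))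

/-- The initial partial isomorphism from `g`. -/
def β₀ : Set (Ω × Ω) :=
  range (fun j : {j // j ∉ range σ.g} => ((j : Ω), σ.q j)) ∪ range fun i => (σ.g (σ.ι i), σ.r i)

/-- The initial arrows of the conjugate of `g`. -/
def init : Set (Ω × Ω) := range fun i => (σ.q (σ.ι i), σ.r i)

/-- The arrows of the conjugate of `g` that belong to the set `T` of arrows of the conjugate of
`f`. -/
def dual (T : Set (Ω × Ω)) : Set (Ω × Ω) := σ.init ∪ (fun p => (p.2, σ.h p.1)) '' T

theorem mem_dual {T : Set (Ω × Ω)} {y z : Ω} : (y, z) ∈ σ.dual T ↔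
    (∃ i, σ.q (σ.ι i) = y ∧ σ.r i = z) ∨ ∃ x, (x, y) ∈ T ∧ σ.h x = z := by
  simp only [dual, init, mem_union, mem_range, mem_image, Prod.mk.injEq, Prod.exists]
  refine or_congr Iff.rfl ⟨?_, ?_⟩
  · rintro ⟨x, y, h, rfl, rfl⟩
    exact ⟨x, h, rfl⟩
  · rintro ⟨x, h, rfl⟩
    exact ⟨x, y, h, rfl, rfl⟩

theorem mem_α₀ {u x : Ω} : (u, x) ∈ σ.α₀ ↔ ∃ i : {i // i ∉ range σ.f}, ↑i = u ∧ σ.q (σ.ι i) = x := by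
  simp only [α₀, mem_range, Prod.mk.injEq]

theorem mem_β₀ {u x : Ω} : (u, x) ∈ σ.β₀ ↔
    (∃ j : {j // j ∉ range σ.g}, ↑j = u ∧ σ.q j = x) ∨ ∃ i, σ.g (σ.ι i) = u ∧ σ.r i = x := by
  simp only [β₀, mem_union, mem_range, Prod.mk.injEq]

theorem model_f_init : PartialModel σ.f σ.Sf ∅ σ.α₀ where
  arrow_fun h := absurd h (notMem_empty _)
  arrow_inj h := absurd h (notMem_empty _)
  arrow_notMem h := absurd h (notMem_empty _)
  map_fun h h' := by
    obtain ⟨i, rfl, rfl⟩ := σ.mem_α₀.1 h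
    obtain ⟨j, hj, rfl⟩ := σ.mem_α₀.1 h'
    rw [Subtype.ext hj]
  map_inj h h' := by
    obtain ⟨i, rfl, rfl⟩ := σ.mem_α₀.1 h
    obtain ⟨j, rfl, hj⟩ := σ.mem_α₀.1 h'
    rw [σ.hι (σ.q_inj hj)]
  hom {u x y} h h' := by
    obtain ⟨j, hj, rfl⟩ := σ.mem_α₀.1 h'
    exact absurd ⟨u, hj.symm⟩ j.2
  back h h' := absurd h' (notMem_empty _)
  start h := by
    obtain ⟨i, rfl, rfl⟩ := σ.mem_α₀.1 h
    exact iff_of_true ⟨i, rfl⟩ i.2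
  start_dom {u} h := ⟨_, σ.mem_α₀.2 ⟨⟨u, h⟩, rfl, rfl⟩⟩
  start_ran := by
    rintro _ ⟨i, rfl⟩
    exact ⟨_, σ.mem_α₀.2 ⟨i, rfl, rfl⟩⟩
  convex {u x y n i} h h' hi := by
    obtain ⟨j, hj, rfl⟩ := σ.mem_α₀.1 h'
    rcases n with _ | n
    · rw [Nat.le_zero.1 hi]
      exact ⟨x, h⟩
    · rw [iterate_succ_apply'] at hj
      exact absurd ⟨_, hj.symm⟩ j.2
  reach z := .source fun x => notMem_empty _

/-- A point omitted by the conjugate of `f` must be sent by that of `g` to a point omitted by `h`;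
this is the arrow from `q (ι i)` to `r i`. Since `q (ι i)` is also omitted by the conjugate of `g`,
the positions of both ends are known: `ι i` and `g (ι i)`. -/
theorem model_g_init : PartialModel σ.g σ.Sg (σ.dual ∅) σ.β₀ where
  arrow_fun h h' := by
    simp only [mem_dual, mem_empty_iff_false, false_and, exists_false, or_false] at h h'
    obtain ⟨i, rfl, rfl⟩ := h
    obtain ⟨j, hj, rfl⟩ := h'
    rw [σ.hι (σ.q_inj hj)]
  arrow_inj h h' := by
    simp only [mem_dual, mem_empty_iff_false, false_and, exists_false, or_false] at h h'
    obtain ⟨i, rfl, rfl⟩ := h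
    obtain ⟨j, rfl, hj⟩ := h'
    rw [σ.r_inj hj]
  arrow_notMem h := by
    simp only [mem_dual, mem_empty_iff_false, false_and, exists_false, or_false] at h
    obtain ⟨i, rfl, rfl⟩ := h
    rintro ⟨j, hj⟩
    exact σ.r_ne_q _ _ hj.symm
  map_fun h h' := by
    rcases σ.mem_β₀.1 h with ⟨i, rfl, rfl⟩ | ⟨i, rfl, rfl⟩ <;>
      rcases σ.mem_β₀.1 h' with ⟨j, hj, rfl⟩ | ⟨j, hj, rfl⟩
    · rw [Subtype.ext hj]
    · exact absurd ⟨_, hj⟩ i.2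
    · exact absurd ⟨_, hj.symm⟩ j.2
    · rw [σ.hι (Subtype.ext (σ.hg hj))]
  map_inj h h' := by
    rcases σ.mem_β₀.1 h with ⟨i, rfl, rfl⟩ | ⟨i, rfl, rfl⟩ <;>
      rcases σ.mem_β₀.1 h' with ⟨j, rfl, hj⟩ | ⟨j, rfl, hj⟩
    · rw [σ.q_inj hj]
    · exact absurd hj (σ.r_ne_q _ _)
    · exact absurd hj.symm (σ.r_ne_q _ _)
    · rw [σ.r_inj hj]
  hom {u x y} h h' := by
    rcases σ.mem_β₀.1 h' with ⟨i, hi, rfl⟩ | ⟨i, hi, rfl⟩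
    · exact absurd ⟨_, hi.symm⟩ i.2
    · have := σ.hg hi
      subst this
      refine σ.mem_dual.2 (.inl ⟨i, ?_, rfl⟩)
      rcases σ.mem_β₀.1 h with ⟨j, hj, rfl⟩ | ⟨j, hj, rfl⟩
      · rw [Subtype.ext hj]
      · exact absurd ⟨_, hj⟩ (σ.ι i).2
  back {u x y} h h' := by
    simp only [mem_dual, mem_empty_iff_false, false_and, exists_false, or_false] at h'
    obtain ⟨i, rfl, rfl⟩ := h'
    rcases σ.mem_β₀.1 h with ⟨j, hj, h2⟩ | ⟨j, hj, h2⟩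
    · exact absurd h2.symm (σ.r_ne_q _ _)
    · rw [σ.r_inj h2] at hj
      exact σ.mem_β₀.2 (.inl ⟨_, σ.hg hj, rfl⟩)
  start h := by
    rcases σ.mem_β₀.1 h with ⟨i, rfl, rfl⟩ | ⟨i, rfl, rfl⟩
    · exact iff_of_true ⟨i, rfl⟩ i.2
    · refine iff_of_false ?_ (not_not.2 ⟨_, rfl⟩)
      rintro ⟨j, hj⟩
      exact σ.r_ne_q _ _ hj.symm
  start_dom {u} h := ⟨_, σ.mem_β₀.2 (.inl ⟨⟨u, h⟩, rfl, rfl⟩)⟩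
  start_ran := by
    rintro _ ⟨i, rfl⟩
    exact ⟨_, σ.mem_β₀.2 (.inl ⟨i, rfl, rfl⟩)⟩
  convex {u x y n i} h h' hi := by
    rcases Nat.eq_zero_or_pos i with rfl | hi0
    · exact ⟨x, h⟩
    rcases hi.eq_or_lt with rfl | hlt
    · exact ⟨y, h'⟩
    obtain ⟨n, rfl⟩ : ∃ k, n = k + 2 := ⟨n - 2, by omega⟩
    rw [iterate_succ_apply'] at h'
    rcases σ.mem_β₀.1 h' with ⟨j, hj, rfl⟩ | ⟨j, hj, rfl⟩
    · exact absurd ⟨_, hj.symm⟩ j.2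
    · have := σ.hg hj
      rw [iterate_succ_apply'] at this
      exact absurd ⟨_, this.symm⟩ (σ.ι j).2
  reach z := by
    by_cases hz : ∃ i, σ.r i = z
    · obtain ⟨i, rfl⟩ := hz
      exact .placed (σ.mem_β₀.2 (.inr ⟨i, rfl, rfl⟩))
    · refine .source fun x hx => hz ?_
      simp only [mem_dual, mem_empty_iff_false, false_and, exists_false, or_false] at hx
      exact hx.imp fun i => And.right

/-- A stage of the construction. -/
structure Stage where
  T : Set (Ω × Ω)
  α : Set (Ω × Ω)
  β : Set (Ω × Ω)
  mf : PartialModel σ.f σ.Sf T α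
  mg : PartialModel σ.g σ.Sg (σ.dual T) β
  finT : T.Finite
  finα : (α \ σ.α₀).Finite
  finβ : (β \ σ.β₀).Finite
  subα : σ.α₀ ⊆ α
  subβ : σ.β₀ ⊆ β

/-- The initial stage. -/
def initialStage : σ.Stage :=
  ⟨∅, σ.α₀, σ.β₀, σ.model_f_init, σ.model_g_init, finite_empty, by simp, by simp, subset_rfl,
    subset_rfl⟩

namespace Stage

variable {σ}

instance : Preorder σ.Stage where
  le s t := s.T ⊆ t.T ∧ s.α ⊆ t.α ∧ s.β ⊆ t.β
  le_refl s := ⟨subset_rfl, subset_rfl, subset_rfl⟩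
  le_trans _ _ _ h h' := ⟨h.1.trans h'.1, h.2.1.trans h'.2.1, h.2.2.trans h'.2.2⟩

variable (s : σ.Stage)

theorem finite_not_fresh_f : {w | w ∈ range σ.h ∧ ¬ Fresh s.T s.α w}.Finite := by
  refine (Conf.finite_not_fresh_union (A := ∅) s.finT s.finα).subset ?_
  rintro w ⟨hw, hw'⟩
  refine ⟨⟨fun x => notMem_empty _, fun x => notMem_empty _, fun u hu => ?_⟩, by rwa [empty_union]⟩
  obtain ⟨i, rfl, rfl⟩ := σ.mem_α₀.1 hu
  exact σ.q_notMem _ hw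

theorem finite_not_fresh_g : {w | w ∈ range σ.h ∧ ¬ Fresh (σ.dual s.T) s.β w}.Finite := by
  refine (Conf.finite_not_fresh_union (A := σ.init) (s.finT.image fun p => (p.2, σ.h p.1))
    s.finβ).subset ?_
  rintro w ⟨hw, hw'⟩
  refine ⟨⟨?_, ?_, ?_⟩, hw'⟩
  · rintro x ⟨i, hi⟩
    rw [← (Prod.mk.inj hi).1] at hw
    exact σ.q_notMem _ hw
  · rintro x ⟨i, hi⟩
    rw [← (Prod.mk.inj hi).2] at hw
    exact σ.r_notMem _ hw
  · intro u hu
    rcases σ.mem_β₀.1 hu with ⟨i, rfl, rfl⟩ | ⟨i, rfl, rfl⟩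
    exacts [σ.q_notMem _ hw, σ.r_notMem _ hw]

theorem mem_dual_of_mem {x y : Ω} (h : (x, y) ∈ s.T) : (y, σ.h x) ∈ σ.dual s.T :=
  σ.mem_dual.2 (.inr ⟨x, h, rfl⟩)

end Stage

/-- The points that are used as fresh points. -/
def pool : Set Ω := range fun n : ℕ => σ.h^[2 * n + 2] σ.uh

theorem pool_subset : σ.pool ⊆ range σ.h := by
  rintro _ ⟨n, rfl⟩
  exact ⟨σ.h^[2 * n + 1] σ.uh, (iterate_succ_apply' _ _ _).symm⟩

theorem pool_infinite : σ.pool.Infinite :=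
  infinite_range_of_injective fun n m h => by
    have := σ.orbit_h h
    omega

/-- The pool consists of even iterates, and `h` sends them to odd ones. -/
theorem pool_ne {w w' : Ω} (hw : w ∈ σ.pool) (hw' : w' ∈ σ.pool) : w ≠ σ.h w' := by
  obtain ⟨n, rfl⟩ := hw
  obtain ⟨m, rfl⟩ := hw'
  intro h
  dsimp only at h
  rw [← iterate_succ_apply' σ.h] at h
  have := σ.orbit_h h
  omega

/-- The frame for extending the partial model of `f`. -/
def frameF : Frame Ω where
  F := σ.f
  G := σ.g
  l := σ.h
  r := id
  S := σ.Sf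
  S' := σ.Sg
  Y := univ
  pool := σ.pool
  u₀ := σ.uf
  hF := σ.hf
  hG := σ.hg
  hl := σ.hh
  hr := injOn_id _
  pool_subset := subset_univ _
  pool_infinite := σ.pool_infinite
  pool_ne _ hw _ hw' := σ.pool_ne hw hw'
  orbit := σ.orbit_f

theorem inv_apply [Nonempty Ω] {x : Ω} (hx : x ∈ range σ.h) : σ.h (invFun σ.h x) = x :=
  invFun_eq hx

/-- The frame for extending the partial model of `g`. -/
noncomputable def frameG [Nonempty Ω] : Frame Ω where
  F := σ.g
  G := σ.f
  l := id
  r := invFun σ.h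
  S := σ.Sg
  S' := σ.Sf
  Y := range σ.h
  pool := σ.pool
  u₀ := σ.ug
  hF := σ.hg
  hG := σ.hf
  hl := injective_id
  hr x hx y hy h := by rw [← σ.inv_apply hx, ← σ.inv_apply hy, h]
  pool_subset := σ.pool_subset
  pool_infinite := σ.pool_infinite
  pool_ne w hw w' hw' h := by
    refine σ.pool_ne hw hw' ?_
    rw [← σ.inv_apply (σ.pool_subset hw), h, id]
  orbit := σ.orbit_g

namespace Stage

variable {σ} (s : σ.Stage)

/-- A stage as a configuration for extending the partial model of `f`. -/
def confF : Conf σ.frameF where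
  A := s.T
  α := s.α
  B := σ.dual s.T
  β := s.β
  mA := s.mf
  mB := s.mg
  left a ha := by
    refine ⟨fun c hc => ?_, ?_⟩
    · rcases σ.mem_dual.1 hc with ⟨i, -, hi⟩ | ⟨x, hx, h⟩
      · exact σ.r_notMem i ⟨a, hi.symm⟩
      · rw [σ.hh h] at hx
        exact ha _ hx
    · rintro ⟨j, hj⟩
      exact σ.q_notMem j ⟨a, hj.symm⟩
  right b hb hbS := by
    refine ⟨mem_univ _, fun c hc => ?_⟩
    rcases σ.mem_dual.1 hc with ⟨i, hi, -⟩ | ⟨x, hx, h⟩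
    · exact hbS ⟨i, hi⟩
    · exact hb _ hx
  fresh := by
    refine ((s.finite_not_fresh_f.union s.finite_not_fresh_g).union
      (s.finite_not_fresh_g.preimage σ.hh.injOn)).subset ?_
    rintro w ⟨hw, hw'⟩
    have h1 := σ.pool_subset hw
    have h2 : σ.h w ∈ range σ.h := ⟨w, rfl⟩
    by_contra h
    simp only [mem_union, mem_ofPred_eq, mem_preimage] at h
    change ¬ (_ ∧ Fresh (σ.dual s.T) s.β (σ.h w) ∧ Fresh (σ.dual s.T) s.β w) at hw'
    tauto
  pending := s.finT.subset fun p hp => hp.1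
  orbit := by
    refine (((s.finα.image Prod.fst).preimage σ.orbit_f.injOn).union (finite_singleton 0)).subset ?_
    rintro n ⟨x, hx⟩
    by_cases h : (σ.f^[n] σ.uf, x) ∈ σ.α₀
    · obtain ⟨i, hi, -⟩ := σ.mem_α₀.1 h
      rcases n with _ | n
      · exact .inr rfl
      · rw [iterate_succ_apply'] at hi
        exact absurd ⟨_, hi.symm⟩ i.2
    · exact .inl ⟨_, ⟨hx, h⟩, rfl⟩

theorem exists_le_of_extends_confF {C : Conf σ.frameF} (h : s.confF.Extends C) :
    ∃ t : σ.Stage, s ≤ t ∧ t.α = C.α := by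
  obtain ⟨E, hE, -, hA, hB, hα, hβ, hα', hβ'⟩ := h
  have hdual : σ.dual C.A = C.B := by
    rw [hA, hB]
    simp only [dual, image_union, ← union_assoc]
    rfl
  refine ⟨⟨C.A, C.α, C.β, C.mA, hdual ▸ C.mB, hA ▸ s.finT.union hE, ?_, ?_, s.subα.trans hα,
    s.subβ.trans hβ⟩, ⟨hA ▸ subset_union_left, hα, hβ⟩, rfl⟩
  · refine (s.finα.union hα').subset ?_
    rintro e ⟨he, he'⟩
    by_cases h : e ∈ s.α
    exacts [.inl ⟨h, he'⟩, .inr ⟨he, h⟩]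
  · refine (s.finβ.union hβ').subset ?_
    rintro e ⟨he, he'⟩
    by_cases h : e ∈ s.β
    exacts [.inl ⟨h, he'⟩, .inr ⟨he, h⟩]

/-- A stage as a configuration for extending the partial model of `g`. -/
noncomputable def confG [Nonempty Ω] : Conf σ.frameG where
  A := σ.dual s.T
  α := s.β
  B := s.T
  β := s.α
  mA := s.mg
  mB := s.mf
  left a ha := by
    refine ⟨fun c hc => ha _ (s.mem_dual_of_mem hc), ?_⟩
    rintro ⟨i, hi⟩
    exact ha _ (σ.mem_dual.2 (.inl ⟨i, hi, rfl⟩))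
  right b hb hbS := by
    have hbh : b ∈ range σ.h := by
      by_contra h
      rcases σ.cover b h with ⟨i, hi⟩ | hi
      · exact hb _ (σ.mem_dual.2 (.inl ⟨i, rfl, hi⟩))
      · exact hbS hi
    refine ⟨hbh, fun c hc => hb c ?_⟩
    have := s.mem_dual_of_mem hc
    change (c, σ.h (invFun σ.h b)) ∈ _ at this
    rwa [σ.inv_apply hbh] at this
  fresh := by
    refine ((s.finite_not_fresh_f.union s.finite_not_fresh_g).union
      (s.finite_not_fresh_f.image σ.h)).subset ?_
    rintro w ⟨hw, hw'⟩
    have h1 := σ.pool_subset hw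
    have h2 : invFun σ.h w ∈ range σ.h := by
      obtain ⟨n, rfl⟩ := hw
      -- The exponent `2 * n + 2` leaves room for two preimages under `h`.
      refine ⟨σ.h^[2 * n] σ.uh, σ.hh ?_⟩
      rw [σ.inv_apply h1, ← iterate_succ_apply' σ.h, ← iterate_succ_apply' σ.h]
    by_contra h
    have h3 : ¬ (Fresh (σ.dual s.T) s.β w ∧ Fresh s.T s.α w ∧ Fresh s.T s.α (invFun σ.h w)) := hw'
    refine h3 ⟨?_, ?_, ?_⟩ <;> by_contra h4
    · exact h (.inl (.inr ⟨h1, h4⟩))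
    · exact h (.inl (.inl ⟨h1, h4⟩))
    · exact h (.inr ⟨_, ⟨h2, h4⟩, σ.inv_apply h1⟩)
  pending := by
    refine (s.finT.image fun p => (p.2, σ.h p.1)).subset ?_
    rintro p ⟨⟨i, rfl⟩ | hp, hp'⟩
    -- The possibly infinitely many initial arrows are not pending, because `β₀` places their ends.
    · exact absurd (s.subβ (σ.mem_β₀.2 (.inr ⟨i, rfl, rfl⟩))) (hp' _)
    · exact hp
  orbit := by
    -- `β₀` places only points omitted by `g` and their images under `g`. An orbit can meet these
    -- only at times 0 and 1.
    refine (((s.finβ.image Prod.fst).preimage σ.orbit_g.injOn).union (finite_le_nat 1)).subset ?_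
    rintro n ⟨x, hx⟩
    by_cases h : (σ.g^[n] σ.ug, x) ∈ σ.β₀
    · refine .inr ?_
      by_contra hn
      obtain ⟨n, rfl⟩ : ∃ k, n = k + 2 := ⟨n - 2, by simp at hn; omega⟩
      rw [iterate_succ_apply'] at h
      rcases σ.mem_β₀.1 h with ⟨j, hj, -⟩ | ⟨j, hj, -⟩
      · exact absurd ⟨_, hj.symm⟩ j.2
      · have := σ.hg hj
        rw [iterate_succ_apply'] at this
        exact absurd ⟨_, this.symm⟩ (σ.ι j).2
    · exact .inl ⟨_, ⟨hx, h⟩, rfl⟩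

theorem exists_le_of_extends_confG [Nonempty Ω] {C : Conf σ.frameG} (h : s.confG.Extends C) :
    ∃ t : σ.Stage, s ≤ t ∧ t.β = C.α := by
  obtain ⟨E, hE, hY, hA, hB, hα, hβ, hα', hβ'⟩ := h
  have hdual : σ.dual C.B = C.A := by
    rw [hA, hB]
    change σ.dual (s.T ∪ (fun e => (invFun σ.h e.2, e.1)) '' E) = σ.dual s.T ∪ E
    have : (fun p : Ω × Ω => (p.2, σ.h p.1)) '' ((fun e => (invFun σ.h e.2, e.1)) '' E) = E := by
      rw [image_image]
      refine (image_congr fun e he => ?_).trans (image_id E)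
      exact Prod.ext rfl (σ.inv_apply (hY e he))
    simp only [dual, image_union, this, union_assoc]
  refine ⟨⟨C.B, C.β, C.α, C.mB, hdual ▸ C.mA, hB ▸ s.finT.union (hE.image _), ?_, ?_,
    s.subα.trans hβ, s.subβ.trans hα⟩, ⟨hB ▸ subset_union_left, hβ, hα⟩, rfl⟩
  · refine (s.finα.union hβ').subset ?_
    rintro e ⟨he, he'⟩
    by_cases h : e ∈ s.α
    exacts [.inl ⟨h, he'⟩, .inr ⟨he, h⟩]
  · refine (s.finβ.union hα').subset ?_
    rintro e ⟨he, he'⟩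
    by_cases h : e ∈ s.β
    exacts [.inl ⟨h, he'⟩, .inr ⟨he, h⟩]

end Stage

/-- The requirements to be met in the course of the construction. -/
def requirements [Countable Ω] [Nonempty Ω] : Fin 4 × Ω → Order.Cofinal σ.Stage
  | (0, u) => ⟨{s | ∃ x, (u, x) ∈ s.α}, fun s => by
      obtain ⟨C, h, x, hx⟩ := s.confF.exists_place u
      obtain ⟨t, ht, h'⟩ := s.exists_le_of_extends_confF h
      exact ⟨t, ⟨x, h' ▸ hx⟩, ht⟩⟩
  | (1, x) => ⟨{s | ∃ u, (u, x) ∈ s.α}, fun s => by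
      obtain ⟨C, h, u, hu⟩ := s.confF.exists_absorb x
      obtain ⟨t, ht, h'⟩ := s.exists_le_of_extends_confF h
      exact ⟨t, ⟨u, h' ▸ hu⟩, ht⟩⟩
  | (2, u) => ⟨{s | ∃ x, (u, x) ∈ s.β}, fun s => by
      obtain ⟨C, h, x, hx⟩ := s.confG.exists_place u
      obtain ⟨t, ht, h'⟩ := s.exists_le_of_extends_confG h
      exact ⟨t, ⟨x, h' ▸ hx⟩, ht⟩⟩
  | (3, x) => ⟨{s | ∃ u, (u, x) ∈ s.β}, fun s => by
      obtain ⟨C, h, u, hu⟩ := s.confG.exists_absorb x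
      obtain ⟨t, ht, h'⟩ := s.exists_le_of_extends_confG h
      exact ⟨t, ⟨u, h' ▸ hu⟩, ht⟩⟩

/-- A relation that is functional and injective, total and surjective is a permutation. -/
theorem _root_.NormalInj.exists_perm_of_rel {R : Ω → Ω → Prop}
    (hfun : ∀ {u x x'}, R u x → R u x' → x = x') (hinj : ∀ {u u' x}, R u x → R u' x → u = u')
    (htot : ∀ u, ∃ x, R u x) (hsur : ∀ x, ∃ u, R u x) :
    ∃ a : Equiv.Perm Ω, ∀ u, R u (a u) := by
  choose a ha using htot
  refine ⟨.ofBijective a ⟨fun u v h => hinj (ha u) (h ▸ ha v), fun x => ?_⟩, ha⟩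
  obtain ⟨u, hu⟩ := hsur x
  exact ⟨u, hfun (ha u) hu⟩

/-- `h` is a product of a conjugate of `f` and a conjugate of `g`. -/
theorem exists_conj [Countable Ω] :
    ∃ a b : Equiv.Perm Ω, ∀ x, σ.h (a x) = b (σ.g (b.symm (a (σ.f x)))) := by
  have : Nonempty Ω := ⟨σ.uf⟩
  have : Encodable (Fin 4 × Ω) := Encodable.ofCountable _
  -- Meeting all requirements makes the unions of the `α` and of the `β` along the ideal total and
  -- surjective, hence permutations.
  set I := Order.idealOfCofinals σ.initialStage σ.requirements with hI
  have hmeet := Order.cofinal_meets_idealOfCofinals σ.initialStage σ.requirements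
  have hdir : ∀ {s t}, s ∈ I → t ∈ I → ∃ k ∈ I, s ≤ k ∧ t ≤ k := fun hs ht => I.directed _ hs _ ht
  obtain ⟨a, ha⟩ : ∃ a : Equiv.Perm Ω, ∀ u, ∃ s ∈ I, (u, a u) ∈ s.α := by
    refine exists_perm_of_rel (R := fun u x => ∃ s ∈ I, (u, x) ∈ s.α) ?_ ?_ ?_ ?_
    · rintro u x x' ⟨s, hs, h⟩ ⟨t, ht, h'⟩
      obtain ⟨k, -, hsk, htk⟩ := hdir hs ht
      exact k.mf.map_fun (hsk.2.1 h) (htk.2.1 h')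
    · rintro u u' x ⟨s, hs, h⟩ ⟨t, ht, h'⟩
      obtain ⟨k, -, hsk, htk⟩ := hdir hs ht
      exact k.mf.map_inj (hsk.2.1 h) (htk.2.1 h')
    · intro u
      obtain ⟨s, ⟨x, hx⟩, hs⟩ := hmeet (0, u)
      exact ⟨x, s, hs, hx⟩
    · intro x
      obtain ⟨s, ⟨u, hu⟩, hs⟩ := hmeet (1, x)
      exact ⟨u, s, hs, hu⟩
  obtain ⟨b, hb⟩ : ∃ b : Equiv.Perm Ω, ∀ u, ∃ s ∈ I, (u, b u) ∈ s.β := by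
    refine exists_perm_of_rel (R := fun u x => ∃ s ∈ I, (u, x) ∈ s.β) ?_ ?_ ?_ ?_
    · rintro u x x' ⟨s, hs, h⟩ ⟨t, ht, h'⟩
      obtain ⟨k, -, hsk, htk⟩ := hdir hs ht
      exact k.mg.map_fun (hsk.2.2 h) (htk.2.2 h')
    · rintro u u' x ⟨s, hs, h⟩ ⟨t, ht, h'⟩
      obtain ⟨k, -, hsk, htk⟩ := hdir hs ht
      exact k.mg.map_inj (hsk.2.2 h) (htk.2.2 h')
    · intro u
      obtain ⟨s, ⟨x, hx⟩, hs⟩ := hmeet (2, u)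
      exact ⟨x, s, hs, hx⟩
    · intro x
      obtain ⟨s, ⟨u, hu⟩, hs⟩ := hmeet (3, x)
      exact ⟨u, s, hs, hu⟩
  refine ⟨a, b, fun x => ?_⟩
  obtain ⟨s₁, hs₁, h₁⟩ := ha x
  obtain ⟨s₂, hs₂, h₂⟩ := ha (σ.f x)
  obtain ⟨s₃, hs₃, h₃⟩ := hb (b.symm (a (σ.f x)))
  obtain ⟨s₄, hs₄, h₄⟩ := hb (σ.g (b.symm (a (σ.f x))))
  obtain ⟨k₁, hk₁, l₁, l₂⟩ := hdir hs₁ hs₂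
  obtain ⟨k₂, hk₂, l₃, l₄⟩ := hdir hs₃ hs₄
  obtain ⟨k, -, l₅, l₆⟩ := hdir hk₁ hk₂
  rw [Equiv.apply_symm_apply] at h₃
  -- In a common stage, the dual of this arrow of the first copy and the arrow `e2` of the second
  -- copy leave the same point, so they coincide.
  have e1 := k.mf.hom (l₅.2.1 (l₁.2.1 h₁)) (l₅.2.1 (l₂.2.1 h₂))
  have e2 := k.mg.hom (l₆.2.2 (l₃.2.2 h₃)) (l₆.2.2 (l₄.2.2 h₄))
  exact k.mg.arrow_fun (k.mem_dual_of_mem e1) e2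

end Splice

/-! ### Injective maps: basic facts -/

/-- `ENat.card` does not distinguish infinite cardinals; countability leaves only one. -/
theorem nonempty_equiv_of_card_eq {α β : Type*} [Countable α] [Countable β]
    (h : ENat.card α = ENat.card β) : Nonempty (α ≃ β) := by
  have h' : Cardinal.toENat (Cardinal.lift.{u_2} (Cardinal.mk α)) =
      Cardinal.toENat (Cardinal.lift.{u_1} (Cardinal.mk β)) := by
    simpa [ENat.card] using h
  exact Cardinal.lift_mk_eq'.1 (Cardinal.toENat_injOn (by simp) (by simp) h')

theorem nonempty_embedding_of_card_le {α β : Type*} [Countable α]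
    (h : ENat.card α ≤ ENat.card β) : Nonempty (α ↪ β) := by
  have h' : Cardinal.toENat (Cardinal.lift.{u_2} (Cardinal.mk α)) ≤
      Cardinal.toENat (Cardinal.lift.{u_1} (Cardinal.mk β)) := by
    simpa [ENat.card] using h
  exact Cardinal.lift_mk_le'.1 ((Cardinal.toENat_le_iff_of_le_aleph0 (by simp)).1 h')

section Basic

variable {Ω : Type*}

@[ext] theorem Inj.ext {f g : Inj Ω} (h : ∀ x, f.1 x = g.1 x) : f = g := Subtype.ext (funext h)

@[simp] theorem mul_apply (f g : Inj Ω) (x : Ω) : (f * g).1 x = g.1 (f.1 x) := rfl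

@[simp] theorem one_apply (x : Ω) : (1 : Inj Ω).1 x = x := rfl

@[simp] theorem ofPerm_apply (a : Equiv.Perm Ω) (x : Ω) : (ofPerm a).1 x = a x := rfl

/-- The order is reversed because `Equiv.Perm` composes from right to left and `Inj` from left to
right. -/
theorem ofPerm_mul (a b : Equiv.Perm Ω) : ofPerm a * ofPerm b = ofPerm (b * a) := rfl

theorem ofPerm_one : ofPerm (1 : Equiv.Perm Ω) = 1 := rfl

theorem mul_ofPerm_cancel (f : Inj Ω) (a : Equiv.Perm Ω) : f * ofPerm a * ofPerm a⁻¹ = f := by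
  ext x; simp

/-- The conjugate of `f` by the permutation `a`. -/
def conj (a : Equiv.Perm Ω) (f : Inj Ω) : Inj Ω := ofPerm a * f * ofPerm a⁻¹

@[simp] theorem conj_apply (a : Equiv.Perm Ω) (f : Inj Ω) (x : Ω) :
    (conj a f).1 x = a.symm (f.1 (a x)) := rfl

theorem conj_mul (a : Equiv.Perm Ω) (f g : Inj Ω) : conj a (f * g) = conj a f * conj a g := by
  ext x; simp

theorem conj_conj (a b : Equiv.Perm Ω) (f : Inj Ω) : conj a (conj b f) = conj (b * a) f := rfl

theorem conj_ofPerm (a b : Equiv.Perm Ω) : conj a (ofPerm b) = ofPerm (a⁻¹ * b * a) := rfl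

theorem conj_one (a : Equiv.Perm Ω) : conj a (1 : Inj Ω) = 1 := by
  ext x; simp

theorem IsNormal.conj_mem {B : Set (Inj Ω)} (hB : IsNormal B) (a : Equiv.Perm Ω) {f : Inj Ω}
    (hf : f ∈ B) : conj a f ∈ B := hB a f hf

theorem coimageCard_mul (f g : Inj Ω) : coimageCard (f * g) = coimageCard f + coimageCard g := by
  have h : (range (f * g).1)ᶜ = g.1 '' (range f.1)ᶜ ∪ (range g.1)ᶜ := by
    ext x
    simp only [mem_compl_iff, mem_union, mem_image]
    constructor
    · intro hx
      by_cases hg : x ∈ range g.1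
      · obtain ⟨y, rfl⟩ := hg
        refine .inl ⟨y, ?_, rfl⟩
        rintro ⟨z, rfl⟩
        exact hx ⟨z, rfl⟩
      · exact .inr hg
    · rintro (⟨y, hy, rfl⟩ | hx) ⟨z, hz⟩
      · exact hy ⟨z, g.2 hz⟩
      · exact hx ⟨_, hz⟩
  rw [coimageCard, h, encard_union_eq, g.2.encard_image]
  · rfl
  · rw [disjoint_left]
    rintro _ ⟨y, -, rfl⟩ h
    exact h ⟨y, rfl⟩

@[simp] theorem coimageCard_ofPerm (a : Equiv.Perm Ω) : coimageCard (ofPerm a) = 0 := by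
  rw [coimageCard, encard_eq_zero, compl_empty_iff]
  exact a.surjective.range_eq

@[simp] theorem coimageCard_one : coimageCard (1 : Inj Ω) = 0 := coimageCard_ofPerm 1

theorem coimageCard_eq_zero {f : Inj Ω} : coimageCard f = 0 ↔ f ∈ symSet Ω := by
  constructor
  · intro h
    rw [coimageCard, encard_eq_zero, compl_empty_iff] at h
    exact ⟨.ofBijective f.1 ⟨f.2, range_eq_univ.1 h⟩, rfl⟩
  · rintro ⟨a, rfl⟩
    exact coimageCard_ofPerm a

@[simp] theorem coimageCard_conj (a : Equiv.Perm Ω) (f : Inj Ω) :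
    coimageCard (conj a f) = coimageCard f := by
  rw [conj, coimageCard_mul, coimageCard_mul, coimageCard_ofPerm, coimageCard_ofPerm]
  simp

@[simp] theorem coimageCard_mul_ofPerm (f : Inj Ω) (a : Equiv.Perm Ω) :
    coimageCard (f * ofPerm a) = coimageCard f := by
  simp [coimageCard_mul]

/-- `f` has an infinite cycle. -/
def HasInfiniteOrbit (f : Inj Ω) : Prop := ∃ u, Injective fun n : ℕ => f.1^[n] u

/-! ### Infinite orbits and the factorisation of an injection into conjugates. -/

theorem injective_iterate_of_notMem_range {f : Ω → Ω} (hf : Injective f) {u : Ω}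
    (hu : u ∉ range f) : Injective fun n : ℕ => f^[n] u := by
  have key : ∀ n k : ℕ, f^[n] u ≠ f^[n + (k + 1)] u := fun n k h => by
    rw [iterate_add_apply] at h
    have := hf.iterate n h
    rw [iterate_succ_apply'] at this
    exact hu ⟨_, this.symm⟩
  intro n m h
  rcases lt_trichotomy n m with hlt | rfl | hlt
  · obtain ⟨k, rfl⟩ := Nat.exists_eq_add_of_lt hlt
    exact absurd h (key n k)
  · rfl
  · obtain ⟨k, rfl⟩ := Nat.exists_eq_add_of_lt hlt
    exact absurd h.symm (key m k)

theorem hasInfiniteOrbit_of_coimageCard_ne_zero {f : Inj Ω} (hf : coimageCard f ≠ 0) :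
    HasInfiniteOrbit f := by
  obtain ⟨u, hu⟩ := encard_ne_zero.1 hf
  exact ⟨u, injective_iterate_of_notMem_range f.2 hu⟩

/-- `hcard` splits the points omitted by `h` into copies of those omitted by `f` and by `g`, and
`hle` supplies the embedding `ι`; `Splice.exists_conj` does the rest. -/
theorem exists_eq_conj_mul_conj [Countable Ω] {f g h : Inj Ω} (hf : HasInfiniteOrbit f)
    (hg : HasInfiniteOrbit g) (hh : HasInfiniteOrbit h)
    (hcard : coimageCard h = coimageCard f + coimageCard g)
    (hle : coimageCard f ≤ coimageCard g) : ∃ a b, h = conj a f * conj b g := by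
  obtain ⟨uf, huf⟩ := hf
  obtain ⟨ug, hug⟩ := hg
  obtain ⟨uh, huh⟩ := hh
  obtain ⟨e⟩ : Nonempty ({x // x ∉ range h.1} ≃ {i // i ∉ range f.1} ⊕ {j // j ∉ range g.1}) :=
    nonempty_equiv_of_card_eq (by rw [ENat.card_sum]; exact hcard)
  obtain ⟨ι⟩ : Nonempty ({i // i ∉ range f.1} ↪ {j // j ∉ range g.1}) :=
    nonempty_embedding_of_card_le hle
  let σ : Splice Ω :=
    { f := f.1, g := g.1, h := h.1, hf := f.2, hg := g.2, hh := h.2, ι := ι, hι := ι.injective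
      r := fun i => e.symm (.inl i)
      q := fun j => e.symm (.inr j)
      r_inj := Subtype.val_injective.comp (e.symm.injective.comp Sum.inl_injective)
      q_inj := Subtype.val_injective.comp (e.symm.injective.comp Sum.inr_injective)
      r_ne_q := fun i j hij => Sum.inl_ne_inr (e.symm.injective (Subtype.val_injective hij))
      r_notMem := fun i => (e.symm (.inl i)).2
      q_notMem := fun j => (e.symm (.inr j)).2
      cover := fun x hx => by
        rcases h' : e ⟨x, hx⟩ with i | j
        · exact .inl ⟨i, congrArg Subtype.val (e.symm_apply_eq.2 h'.symm)⟩
        · exact .inr ⟨j, congrArg Subtype.val (e.symm_apply_eq.2 h'.symm)⟩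
      uf := uf, ug := ug, uh := uh, orbit_f := huf, orbit_g := hug, orbit_h := huh }
  obtain ⟨a, b, hab⟩ := σ.exists_conj
  refine ⟨a⁻¹, b⁻¹, Inj.ext fun x => ?_⟩
  have := hab (a.symm x)
  rw [a.apply_symm_apply] at this
  exact this

/-- The factor omitting fewer points goes first; for membership in `M` the order is irrelevant. -/
theorem IsNormal.mem_of_coimageCard_eq_add [Countable Ω] {M : Submonoid (Inj Ω)}
    (hM : IsNormal (M : Set (Inj Ω))) {f g h : Inj Ω} (hf : f ∈ M) (hg : g ∈ M)
    (hf' : HasInfiniteOrbit f) (hg' : HasInfiniteOrbit g) (hh : HasInfiniteOrbit h)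
    (hcard : coimageCard h = coimageCard f + coimageCard g) : h ∈ M := by
  rcases le_total (coimageCard f) (coimageCard g) with hle | hle
  · obtain ⟨a, b, rfl⟩ := exists_eq_conj_mul_conj hf' hg' hh hcard hle
    exact mul_mem (hM.conj_mem a hf) (hM.conj_mem b hg)
  · obtain ⟨a, b, rfl⟩ := exists_eq_conj_mul_conj hg' hf' hh (hcard.trans (add_comm _ _)) hle
    exact mul_mem (hM.conj_mem a hg) (hM.conj_mem b hf)

/-- Maps with equal coimage cardinality differ by a permutation. -/
theorem exists_mul_ofPerm_eq [Countable Ω] {f g : Inj Ω} (h : coimageCard f = coimageCard g) :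
    ∃ a, f * ofPerm a = g := by
  classical
  obtain ⟨e⟩ : Nonempty ({x // x ∉ range f.1} ≃ {x // x ∉ range g.1}) :=
    nonempty_equiv_of_card_eq h
  let e' : {x // x ∈ range f.1} ≃ {x // x ∈ range g.1} :=
    (Equiv.ofInjective f.1 f.2).symm.trans (Equiv.ofInjective g.1 g.2)
  refine ⟨Equiv.subtypeCongr e' e, Inj.ext fun x => ?_⟩
  have h1 : f.1 x ∈ range f.1 := mem_range_self x
  have h2 : e' ⟨f.1 x, h1⟩ = Equiv.ofInjective g.1 g.2 x :=
    congrArg (Equiv.ofInjective g.1 g.2) (Equiv.ofInjective_symm_apply f.2 x)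
  change Equiv.subtypeCongr e' e (f.1 x) = g.1 x
  simp only [Equiv.subtypeCongr, Equiv.trans_apply, Equiv.sumCompl_symm_apply_of_pos h1]
  exact congrArg Subtype.val h2

end Basic

/-! ### Normal sets of permutations -/

section Group

variable {Ω : Type*}

/-- The permutations that lie in the submonoid `M`. -/
def permSubmonoid (M : Submonoid (Inj Ω)) : Submonoid (Equiv.Perm Ω) where
  carrier := {a | ofPerm a ∈ M}
  mul_mem' {a b} ha hb := by
    change ofPerm b * ofPerm a ∈ M
    exact mul_mem hb ha
  one_mem' := one_mem M

theorem gpPart_eq_image (M : Submonoid (Inj Ω)) :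
    gpPart (M : Set (Inj Ω)) = ofPerm '' (permSubmonoid M : Set (Equiv.Perm Ω)) := by
  ext f
  constructor
  · rintro ⟨hf, a, rfl⟩
    exact ⟨a, hf, rfl⟩
  · rintro ⟨a, ha, rfl⟩
    exact ⟨ha, a, rfl⟩

theorem IsNormal.conj_mem_permSubmonoid {M : Submonoid (Inj Ω)}
    (hM : IsNormal (M : Set (Inj Ω))) {a : Equiv.Perm Ω} (ha : a ∈ permSubmonoid M)
    (b : Equiv.Perm Ω) : b * a * b⁻¹ ∈ permSubmonoid M := by
  have := hM.conj_mem b⁻¹ (f := ofPerm a) ha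
  rwa [conj_ofPerm, inv_inv] at this

/-! #### Permutations with infinite support -/

theorem hasInfiniteOrbit_of_int {c : Equiv.Perm Ω} {x : ℤ → Ω} (hx : Injective x)
    (h : ∀ i, c (x i) = x (i + 1)) : HasInfiniteOrbit (ofPerm c) := by
  refine ⟨x 0, fun n m hnm => ?_⟩
  have key : ∀ n : ℕ, (ofPerm c).1^[n] (x 0) = x n := by
    intro n
    induction n with
    | zero => rfl
    | succ n ih => rw [iterate_succ_apply', ih, ofPerm_apply, h]; norm_cast
  have h' : x n = x m := by rw [← key, ← key]; exact hnm
  exact_mod_cast hx h'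

theorem HasInfiniteOrbit.inv {c : Equiv.Perm Ω} (h : HasInfiniteOrbit (ofPerm c)) :
    HasInfiniteOrbit (ofPerm c⁻¹) := by
  obtain ⟨u, hu⟩ := h
  have key : ∀ (n : ℕ) (x : Ω), (ofPerm c).1^[n] ((ofPerm c⁻¹).1^[n] x) = x :=
    fun n => LeftInverse.iterate (f := (ofPerm c⁻¹).1) (g := (ofPerm c).1) c.apply_symm_apply n
  refine ⟨u, fun n m h => hu ?_⟩
  have h1 := congrArg (ofPerm c).1^[m + n] h
  dsimp only at h1
  rw [iterate_add_apply, key, add_comm, iterate_add_apply, key] at h1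
  exact h1.symm

/-- If the n-th and m-th iterates agree at `u`, then the 2n-th and 2m-th both equal the (n+m)-th. -/
theorem HasInfiniteOrbit.of_mul_self {f : Inj Ω} (h : HasInfiniteOrbit (f * f)) :
    HasInfiniteOrbit f := by
  obtain ⟨u, hu⟩ := h
  have key : ∀ n : ℕ, (f * f).1^[n] u = f.1^[n] (f.1^[n] u) := fun n => by
    rw [← iterate_add_apply, ← two_mul, iterate_mul]; rfl
  refine ⟨u, fun n m h => hu ?_⟩
  dsimp only at h ⊢
  rw [key, key, h, ← iterate_add_apply, ← h, ← iterate_add_apply, add_comm]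

/-- Greedy choice: infinitely many moved points avoid the finitely many chosen ones, their images
and their preimages. -/
theorem exists_int_seq {a : Equiv.Perm Ω} (ha : {x | a x ≠ x}.Infinite) :
    ∃ x : ℤ → Ω, Injective x ∧ ∀ i j, a (x i) ≠ x j := by
  obtain ⟨x, hx, hr⟩ := @exists_seq_of_forall_finset_exists' Ω (fun x => a x ≠ x)
    (fun x y => x ≠ y ∧ a x ≠ y ∧ x ≠ a y)
    ⟨fun x y h => ⟨h.1.symm, h.2.2.symm, h.2.1.symm⟩⟩ (fun s _ => by
      have hfin : (((s : Set Ω) ∪ a '' s) ∪ a ⁻¹' s).Finite :=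
        (s.finite_toSet.union (s.finite_toSet.image a)).union
          (s.finite_toSet.preimage a.injective.injOn)
      obtain ⟨y, hy, hy'⟩ := (ha.sdiff hfin).nonempty
      refine ⟨y, hy, fun x hx => ⟨?_, ?_, ?_⟩⟩
      · rintro rfl; exact hy' (.inl (.inl hx))
      · rintro rfl; exact hy' (.inl (.inr ⟨x, hx, rfl⟩))
      · rintro rfl; exact hy' (.inr hx))
  have e : ℤ ≃ ℕ := Equiv.intEquivNat
  refine ⟨x ∘ e, ?_, fun i j => ?_⟩
  · refine Injective.comp (fun n m h => ?_) e.injective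
    by_contra hnm
    exact (hr hnm).1 h
  · by_cases hij : i = j
    · subst hij; exact hx _
    · exact (hr (e.injective.ne hij)).2.1

/-- With `y i = c (x i)`, both `b * b` and `b * c` shift the sequence `x` by one. -/
theorem exists_zigzag {x y : ℤ → Ω} (hx : Injective x) (hy : Injective y)
    (hxy : ∀ i j, y i ≠ x j) :
    ∃ b : Equiv.Perm Ω, (∀ i, b (x i) = y i) ∧ ∀ i, b (y i) = x (i + 1) := by
  let φ : ℤ ⊕ ℤ ↪ Ω := ⟨Sum.elim x y, by
    rintro (i | i) (j | j) h
    · exact congrArg _ (hx h)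
    · exact absurd h.symm (hxy _ _)
    · exact absurd h (hxy _ _)
    · exact congrArg _ (hy h)⟩
  let p : Equiv.Perm (ℤ ⊕ ℤ) :=
    { toFun := Sum.elim Sum.inr fun i => Sum.inl (i + 1)
      invFun := Sum.elim (fun i => Sum.inr (i - 1)) Sum.inl
      left_inv := by rintro (i | i) <;> simp
      right_inv := by rintro (i | i) <;> simp }
  exact ⟨p.viaEmbedding φ, fun i => p.viaEmbedding_apply φ (.inl i),
    fun i => p.viaEmbedding_apply φ (.inr i)⟩

/-- It follows that `c = b⁻¹ * (b * c)` is a product of two permutations with infinite cycles. If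
`c` is finitary, `b` shifts a sequence of fixed points of `c`. -/
theorem exists_hasInfiniteOrbit_mul [Infinite Ω] (c : Equiv.Perm Ω) :
    ∃ b : Equiv.Perm Ω, HasInfiniteOrbit (ofPerm b) ∧ HasInfiniteOrbit (ofPerm (b * c)) := by
  by_cases hc : {x | c x ≠ x}.Infinite
  · obtain ⟨x, hx, hcx⟩ := exists_int_seq hc
    obtain ⟨b, hb, hb'⟩ := exists_zigzag hx (c.injective.comp hx) hcx
    refine ⟨b, .of_mul_self (hasInfiniteOrbit_of_int (c := b * b) hx fun i => ?_),
      hasInfiniteOrbit_of_int hx hb'⟩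
    rw [Equiv.Perm.mul_apply, hb]
    exact hb' i
  · have hfix : {x | c x ≠ x}ᶜ.Infinite := (not_infinite.1 hc).infinite_compl
    let φ : ℤ ↪ Ω := (Equiv.intEquivNat.toEmbedding.trans hfix.natEmbedding).trans
      (Embedding.subtype (· ∈ {x | c x ≠ x}ᶜ))
    have hφ : ∀ i, c (φ i) = φ i := fun i =>
      not_not.1 (hfix.natEmbedding _ (Equiv.intEquivNat i)).2
    have hb : ∀ i, (Equiv.addRight (1 : ℤ)).viaEmbedding φ (φ i) = φ (i + 1) := fun i =>
      Equiv.Perm.viaEmbedding_apply _ φ i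
    refine ⟨_, hasInfiniteOrbit_of_int φ.injective hb,
      hasInfiniteOrbit_of_int φ.injective fun i => ?_⟩
    rw [Equiv.Perm.mul_apply, hφ, hb]

/-- For a zigzag `b` on `x` and `a ∘ x`, the product `b * a * b⁻¹ * a` shifts `x`. Factorisation
with empty coimages then gives every permutation with an infinite cycle, and these generate the
group. -/
theorem permSubmonoid_eq_top [Countable Ω] [Infinite Ω] {M : Submonoid (Inj Ω)}
    (hM : IsNormal (M : Set (Inj Ω))) {a : Equiv.Perm Ω} (ha : a ∈ permSubmonoid M)
    (hinf : {x | a x ≠ x}.Infinite) : permSubmonoid M = ⊤ := by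
  obtain ⟨d, hd, hd'⟩ : ∃ d ∈ permSubmonoid M, HasInfiniteOrbit (ofPerm d) := by
    obtain ⟨x, hx, hax⟩ := exists_int_seq hinf
    obtain ⟨b, hb, hb'⟩ := exists_zigzag hx (a.injective.comp hx) hax
    refine ⟨b * a * b⁻¹ * a, mul_mem (hM.conj_mem_permSubmonoid ha b) ha,
      hasInfiniteOrbit_of_int hx fun i => ?_⟩
    have : b⁻¹ (a (x i)) = x i := by rw [Equiv.Perm.inv_eq_iff_eq, hb]; rfl
    rw [Equiv.Perm.mul_apply, Equiv.Perm.mul_apply, Equiv.Perm.mul_apply, this]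
    exact hb' i
  have key : ∀ c : Equiv.Perm Ω, HasInfiniteOrbit (ofPerm c) → c ∈ permSubmonoid M :=
    fun c hc => hM.mem_of_coimageCard_eq_add hd hd hd' hd' hc (by simp)
  refine (Submonoid.eq_top_iff' _).2 fun c => ?_
  obtain ⟨b, hb, hbc⟩ := exists_hasInfiniteOrbit_mul c
  have := mul_mem (key _ hb.inv) (key _ hbc)
  rwa [inv_mul_cancel_left] at this

/-! #### Finitary permutations -/

theorem isOfFinOrder_of_finite_support {a : Equiv.Perm Ω} (ha : {x | a x ≠ x}.Finite) :
    IsOfFinOrder a := by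
  classical
  have : Finite {x // a x ≠ x} := ha
  have h1 : ∀ x, a (a x) ≠ a x ↔ a x ≠ x := fun x => a.injective.ne_iff
  rw [← Equiv.Perm.ofSubtype_subtypePerm (p := fun x => a x ≠ x) h1 fun x hx => hx]
  exact MonoidHom.isOfFinOrder _ (isOfFinOrder_of_finite _)

open Classical in
theorem exists_list_swap {a : Equiv.Perm Ω} (ha : {x | a x ≠ x}.Finite) :
    ∃ l : List (Equiv.Perm Ω), (∀ t ∈ l, t.IsSwap) ∧ l.prod = a := by
  have h : a ∈ Subgroup.closure {t : Equiv.Perm Ω | t.IsSwap} := by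
    rw [mem_closure_isSwap']
    exact ha
  rw [← Subgroup.mem_toSubmonoid, Subgroup.closure_toSubmonoid] at h
  obtain ⟨l, hl, hl'⟩ := Submonoid.exists_list_of_mem_closure h
  refine ⟨l, fun t ht => (hl t ht).elim id fun h => ?_, hl'⟩
  obtain ⟨x, y, hxy, h⟩ := h
  exact ⟨x, y, hxy, by rw [← inv_inv t, h, Equiv.swap_inv]⟩

theorem exists_perm_triple {x y z p q r : Ω} (hxy : x ≠ y) (hxz : x ≠ z) (hyz : y ≠ z)
    (hpq : p ≠ q) (hpr : p ≠ r) (hqr : q ≠ r) :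
    ∃ b : Equiv.Perm Ω, b x = p ∧ b y = q ∧ b z = r := by
  classical
  set b₁ := Equiv.swap x p
  have h1 : b₁ x = p := Equiv.swap_apply_left _ _
  set b₂ := Equiv.swap (b₁ y) q
  have h2 : b₂ p = p := Equiv.swap_apply_of_ne_of_ne (by rw [← h1]; exact b₁.injective.ne hxy) hpq
  have h3 : b₂ (b₁ y) = q := Equiv.swap_apply_left _ _
  refine ⟨Equiv.swap (b₂ (b₁ z)) r * b₂ * b₁, ?_, ?_, ?_⟩
  · rw [Equiv.Perm.mul_apply, Equiv.Perm.mul_apply, h1, h2]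
    refine Equiv.swap_apply_of_ne_of_ne ?_ hpr
    nth_rw 1 [← h2, ← h1]
    exact b₂.injective.ne (b₁.injective.ne hxz)
  · rw [Equiv.Perm.mul_apply, Equiv.Perm.mul_apply, h3]
    refine Equiv.swap_apply_of_ne_of_ne ?_ hqr
    nth_rw 1 [← h3]
    exact b₂.injective.ne (b₁.injective.ne hyz)
  · exact Equiv.swap_apply_left _ _

-- The commutator of `a` with the transposition of a moved and a fixed point is a 3-cycle; its
-- conjugates are all the 3-cycles, and these give all products of two transpositions. As `Q` is
-- only a monoid, `a⁻¹` comes from the finite order of `a`.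
open Classical in
theorem mem_of_even_list_swap [Infinite Ω] {Q : Submonoid (Equiv.Perm Ω)}
    (hQ : ∀ a ∈ Q, ∀ b, b * a * b⁻¹ ∈ Q) {a : Equiv.Perm Ω} (ha : a ∈ Q) (ha1 : a ≠ 1)
    (hfin : {x | a x ≠ x}.Finite) :
    ∀ l : List (Equiv.Perm Ω), (∀ t ∈ l, t.IsSwap) → Even l.length → l.prod ∈ Q := by
  have hinv : a⁻¹ ∈ Q := by
    obtain ⟨n, hn, h⟩ := (isOfFinOrder_iff_pow_eq_one).1 (isOfFinOrder_of_finite_support hfin)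
    obtain ⟨k, rfl⟩ : ∃ k, n = k + 1 := ⟨n - 1, by omega⟩
    rw [pow_succ] at h
    rw [← eq_inv_of_mul_eq_one_left h]
    exact pow_mem ha k
  obtain ⟨y, hy⟩ : ∃ y, a y ≠ y := by
    by_contra! h
    exact ha1 (Equiv.ext h)
  obtain ⟨z, hz⟩ : ∃ z, a z = z := by
    obtain ⟨z, hz⟩ := hfin.infinite_compl.nonempty
    exact ⟨z, not_not.1 hz⟩
  have hzy : z ≠ y := fun h => hy (h ▸ hz)
  have hzay : a y ≠ z := fun h => hzy (a.injective (hz.trans h.symm))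
  have h3 : Equiv.swap (a y) z * Equiv.swap y z ∈ Q := by
    have h1 : Equiv.swap (a y) z = a * Equiv.swap y z * a⁻¹ := by
      rw [← Equiv.swap_apply_apply, hz]
    have h2 := mul_mem ha (hQ _ hinv (Equiv.swap y z))
    rw [h1]
    rw [Equiv.swap_inv] at h2
    simpa only [mul_assoc] using h2
  have h3' : ∀ p q r : Ω, p ≠ q → r ≠ q → p ≠ r → Equiv.swap p q * Equiv.swap r q ∈ Q := by
    intro p q r hpq hrq hpr
    obtain ⟨b, hb1, hb2, hb3⟩ := exists_perm_triple hzay hy hzy hpq hpr hrq.symm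
    have := hQ _ h3 b
    have h4 : b * (Equiv.swap (a y) z * Equiv.swap y z) * b⁻¹ =
        (b * Equiv.swap (a y) z * b⁻¹) * (b * Equiv.swap y z * b⁻¹) := by group
    rwa [h4, ← Equiv.swap_apply_apply, ← Equiv.swap_apply_apply, hb1, hb2, hb3] at this
  have h3'' : ∀ p q r : Ω, p ≠ q → r ≠ q → Equiv.swap p q * Equiv.swap r q ∈ Q := by
    intro p q r hpq hrq
    by_cases hpr : p = r
    · subst hpr
      rw [Equiv.swap_mul_self]
      exact one_mem Q
    · exact h3' p q r hpq hrq hpr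
  have h4 : ∀ s t : Equiv.Perm Ω, s.IsSwap → t.IsSwap → s * t ∈ Q := by
    rintro _ _ ⟨p, q, hpq, rfl⟩ ⟨r, s, hrs, rfl⟩
    obtain ⟨w, hw⟩ := Infinite.exists_notMem_finset ({p, q, r, s} : Finset Ω)
    simp only [Finset.mem_insert, Finset.mem_singleton, not_or] at hw
    -- A point `w` off both transpositions breaks the product into pairs of transpositions with a
    -- common point.
    have e : Equiv.swap p q * Equiv.swap r s = (Equiv.swap p q * Equiv.swap w q) *
        (Equiv.swap q w * Equiv.swap s w) * (Equiv.swap w s * Equiv.swap r s) := by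
      rw [Equiv.swap_comm q w, Equiv.swap_comm s w]
      simp only [mul_assoc, Equiv.swap_mul_self_mul]
    rw [e]
    exact mul_mem (mul_mem (h3'' _ _ _ hpq hw.2.1) (h3'' _ _ _ (Ne.symm hw.2.1)
      (Ne.symm hw.2.2.2))) (h3'' _ _ _ hw.2.2.2 hrs)
  intro l
  induction l using List.twoStepInduction with
  | nil => exact fun _ _ => one_mem Q
  | singleton s => exact fun _ h => absurd h (by simp)
  | cons_cons s t l ih _ =>
    intro hl hlen
    rw [List.prod_cons, List.prod_cons, ← mul_assoc]
    refine mul_mem (h4 s t (hl s (by simp)) (hl t (by simp))) (ih (fun u hu => hl u ?_) ?_)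
    · simp [hu]
    · simpa [Nat.even_add_one] using hlen

open Classical in
theorem list_prod_mem_finSet {l : List (Equiv.Perm Ω)} (hl : ∀ t ∈ l, t.IsSwap) :
    ofPerm l.prod ∈ finSet Ω := by
  refine ⟨l.prod, ?_, rfl⟩
  have h : l.prod ∈ Subgroup.closure {t : Equiv.Perm Ω | t.IsSwap} :=
    Subgroup.list_prod_mem _ fun t ht => Subgroup.subset_closure (hl t ht)
  rwa [mem_closure_isSwap'] at h

theorem altSet_subset_finSet : altSet Ω ⊆ finSet Ω := by
  rintro _ ⟨l, hl, -, rfl⟩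
  exact list_prod_mem_finSet hl

theorem gpPart_mem [Countable Ω] [Infinite Ω] {M : Submonoid (Inj Ω)}
    (hM : IsNormal (M : Set (Inj Ω))) :
    gpPart (M : Set (Inj Ω)) ∈ ({{1}, altSet Ω, finSet Ω, symSet Ω} : Set (Set (Inj Ω))) := by
  classical
  simp only [mem_insert_iff, mem_singleton_iff]
  by_cases hinf : ∃ a ∈ permSubmonoid M, {x | a x ≠ x}.Infinite
  · obtain ⟨a, ha, hinf⟩ := hinf
    right; right; right
    rw [gpPart_eq_image, permSubmonoid_eq_top hM ha hinf, symSet, Submonoid.coe_top, image_univ]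
  push Not at hinf
  by_cases hone : ∀ a ∈ permSubmonoid M, a = 1
  · left
    rw [gpPart_eq_image]
    ext f
    constructor
    · rintro ⟨a, ha, rfl⟩
      rw [hone a ha]; rfl
    · rintro rfl
      exact ⟨1, one_mem _, rfl⟩
  push Not at hone
  obtain ⟨a, ha, ha1⟩ := hone
  have heven := mem_of_even_list_swap (fun a ha b => hM.conj_mem_permSubmonoid ha b) ha ha1
    (hinf a ha)
  have hsub : gpPart (M : Set (Inj Ω)) ⊆ finSet Ω := by
    rw [gpPart_eq_image]
    rintro _ ⟨b, hb, rfl⟩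
    exact ⟨b, hinf b hb, rfl⟩
  have hsup : altSet Ω ⊆ gpPart (M : Set (Inj Ω)) := by
    rw [gpPart_eq_image]
    rintro _ ⟨l, hl, hlen, rfl⟩
    exact ⟨_, heven l hl hlen, rfl⟩
  by_cases halt : gpPart (M : Set (Inj Ω)) ⊆ altSet Ω
  · exact .inr (.inl (halt.antisymm hsup))
  right; right; left
  refine hsub.antisymm ?_
  obtain ⟨f, hf, hfalt⟩ := not_subset.1 halt
  rw [gpPart_eq_image] at hf
  obtain ⟨b, hb, rfl⟩ := hf
  obtain ⟨lb, hlb, rfl⟩ := exists_list_swap (hinf b hb)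
  have hlb' : ¬ Even lb.length := fun h => hfalt ⟨lb, hlb, h, rfl⟩
  rintro _ ⟨c, hc, rfl⟩
  obtain ⟨lc, hlc, rfl⟩ := exists_list_swap hc
  by_cases hlc' : Even lc.length
  · exact hsup ⟨lc, hlc, hlc', rfl⟩
  rw [gpPart_eq_image]
  refine ⟨_, ?_, rfl⟩
  -- An odd permutation is an even one times the given odd element of `M`.
  have h1 := heven (lc ++ (lb.map (·⁻¹)).reverse) (by
    intro t ht
    rcases List.mem_append.1 ht with h | h
    · exact hlc t h
    · rw [List.mem_reverse, List.mem_map] at h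
      obtain ⟨s, hs, rfl⟩ := h
      obtain ⟨x, y, hxy, rfl⟩ := hlb s hs
      exact ⟨x, y, hxy, Equiv.swap_inv x y⟩) (by
    rw [List.length_append, List.length_reverse, List.length_map, Nat.even_add]
    tauto)
  rw [List.prod_append, ← List.prod_inv_reverse] at h1
  have h2 := mul_mem h1 hb
  rwa [inv_mul_cancel_right] at h2

end Group

/-! ### Minimal generating sets -/

/-- A reducible generator is a sum of smaller elements, which are generated without it, so it could
be dropped. An irreducible element lies in every generating set. -/
theorem mem_Gn_iff {N : AddSubmonoid ℕ} {n : ℕ} : n ∈ Gn N ↔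
    n ∈ N ∧ n ≠ 0 ∧ ∀ m ∈ N, ∀ k ∈ N, m + k = n → m = 0 ∨ k = 0 := by
  have hcl : AddSubmonoid.closure (Gn N) = N := (isLeast_Gn N).1
  have hle : ∀ G, AddSubmonoid.closure G = N → Gn N ⊆ G := fun G hG => (isLeast_Gn N).2 hG
  constructor
  · intro hn
    have hnN : n ∈ N := hcl ▸ AddSubmonoid.subset_closure hn
    have key : N ≤ AddSubmonoid.closure (Gn N \ {n}) → False := fun h => by
      refine (hle (Gn N \ {n}) (le_antisymm ?_ h) hn).2 rfl
      rw [AddSubmonoid.closure_le]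
      exact fun k hk => hcl ▸ AddSubmonoid.subset_closure hk.1
    have key' : n ∈ AddSubmonoid.closure (Gn N \ {n}) → False := fun h => key <| hcl.ge.trans <| by
      rw [AddSubmonoid.closure_le]
      intro k hk
      by_cases hkn : k = n
      · rw [hkn]
        exact h
      · exact AddSubmonoid.subset_closure ⟨hk, hkn⟩
    refine ⟨hnN, ?_, ?_⟩
    · rintro rfl
      exact key' (zero_mem _)
    · intro m hm k hk hmk
      by_contra! h
      have aux : ∀ m ∈ N, m < n → m ∈ AddSubmonoid.closure (Gn N \ {n}) := by
        intro m hm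
        rw [← hcl] at hm
        induction hm using AddSubmonoid.closure_induction with
        | mem x hx => exact fun hx' => AddSubmonoid.subset_closure ⟨hx, hx'.ne⟩
        | zero => exact fun _ => zero_mem _
        | add x y _ _ h1 h2 => exact fun hxy => add_mem (h1 (by omega)) (h2 (by omega))
      have := add_mem (aux m hm (by omega)) (aux k hk (by omega))
      rw [hmk] at this
      exact key' this
  · rintro ⟨hnN, hn0, hn⟩
    rw [← hcl] at hnN
    have key : ∀ x ∈ AddSubmonoid.closure (Gn N), x = 0 ∨ x ∈ Gn N ∨
        ∃ m ∈ N, ∃ k ∈ N, m ≠ 0 ∧ k ≠ 0 ∧ m + k = x := by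
      intro x hx
      induction hx using AddSubmonoid.closure_induction with
      | mem x hx => exact .inr (.inl hx)
      | zero => exact .inl rfl
      | add x y hx hy h1 h2 =>
        by_cases hx0 : x = 0
        · rwa [hx0, zero_add]
        by_cases hy0 : y = 0
        · rwa [hy0, add_zero]
        rw [hcl] at hx hy
        exact .inr (.inr ⟨x, hx, y, hy, hx0, hy0, rfl⟩)
    rcases key n hnN with h | h | ⟨m, hm, k, hk, hm0, hk0, h⟩
    · exact absurd h hn0
    · exact h
    · exact ((hn m hm k hk h).elim hm0 hk0).elim

/-! ### Cycles -/

section Cycles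

variable {Ω : Type*}

/-- The cycle of `f` that contains `x`. -/
def cyc (f : Inj Ω) (x : Ω) : Set Ω := {y | ∃ i j : ℕ, f.1^[i] x = f.1^[j] y}

theorem mem_cyc_self (f : Inj Ω) (x : Ω) : x ∈ cyc f x := ⟨0, 0, rfl⟩

theorem isInvariant_cyc (f : Inj Ω) (x : Ω) : IsInvariant f (cyc f x) := by
  refine fun y => ⟨?_, ?_⟩
  · rintro ⟨i, j, h⟩
    exact ⟨i, j + 1, by rwa [iterate_succ_apply]⟩
  · rintro ⟨i, j, h⟩
    exact ⟨i + 1, j, by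
      rw [iterate_succ_apply', h, ← iterate_succ_apply' f.1, iterate_succ_apply]⟩

theorem IsInvariant.iterate_mem_iff {f : Inj Ω} {S : Set Ω} (hS : IsInvariant f S) (n : ℕ) (x : Ω) :
    f.1^[n] x ∈ S ↔ x ∈ S := by
  induction n with
  | zero => rfl
  | succ n ih => rw [iterate_succ_apply', hS, ih]

theorem IsInvariant.cyc_subset {f : Inj Ω} {S : Set Ω} (hS : IsInvariant f S) {x : Ω}
    (hx : x ∈ S) : cyc f x ⊆ S := by
  rintro y ⟨i, j, h⟩
  rw [← hS.iterate_mem_iff j, ← h, hS.iterate_mem_iff]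
  exact hx

theorem isCycle_cyc (f : Inj Ω) (x : Ω) : IsCycle f (cyc f x) := by
  refine ⟨⟨x, mem_cyc_self f x⟩, isInvariant_cyc f x, fun T hT ⟨t, ht⟩ hTi => hT.antisymm ?_⟩
  obtain ⟨i, j, h⟩ := hT ht
  refine hTi.cyc_subset ?_
  rw [← hTi.iterate_mem_iff i, h, hTi.iterate_mem_iff]
  exact ht

theorem IsCycle.eq_cyc {f : Inj Ω} {S : Set Ω} (hS : IsCycle f S) {x : Ω} (hx : x ∈ S) :
    S = cyc f x :=
  (hS.2.2 _ (hS.2.1.cyc_subset hx) ⟨x, mem_cyc_self f x⟩ (isInvariant_cyc f x)).symm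

theorem cyc_eq_of_mem {f : Inj Ω} {x y : Ω} (h : y ∈ cyc f x) : cyc f x = cyc f y :=
  (isCycle_cyc f x).eq_cyc h

theorem isCycle_iff {f : Inj Ω} {S : Set Ω} : IsCycle f S ↔ ∃ x, S = cyc f x :=
  ⟨fun h => h.1.imp fun _ hx => h.eq_cyc hx, by rintro ⟨x, rfl⟩; exact isCycle_cyc f x⟩

theorem iterate_mem_cyc (f : Inj Ω) (x : Ω) (n : ℕ) : f.1^[n] x ∈ cyc f x := ⟨n, 0, rfl⟩

/-- Infinite cycles are covered: there the minimal period is 0, and congruence modulo 0 is equality.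
-/
theorem iterate_eq_iterate_iff {f : Ω → Ω} (hf : Injective f) (x : Ω) (p q : ℕ) :
    f^[p] x = f^[q] x ↔ p ≡ q [MOD minimalPeriod f x] := by
  wlog hpq : p ≤ q generalizing p q
  · rw [eq_comm, this q p (by omega)]
    exact ⟨Nat.ModEq.symm, Nat.ModEq.symm⟩
  obtain ⟨k, rfl⟩ := Nat.exists_eq_add_of_le hpq
  rw [iterate_add_apply, (hf.iterate p).eq_iff, eq_comm, Nat.ModEq.comm,
    Nat.add_modEq_left_iff, ← isPeriodicPt_iff_minimalPeriod_dvd]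
  rfl

theorem cyc_eq_image {f : Inj Ω} {x : Ω} (hx : minimalPeriod f.1 x ≠ 0) :
    cyc f x = (fun n => f.1^[n] x) '' {n | n < minimalPeriod f.1 x} := by
  refine ((isCycle_cyc f x).2.2 ((fun n => f.1^[n] x) '' {n | n < minimalPeriod f.1 x}) ?_
    ⟨x, 0, Nat.pos_of_ne_zero hx, rfl⟩ ?_).symm
  · rintro _ ⟨n, -, rfl⟩
    exact iterate_mem_cyc f x n
  · have key : ∀ n, f.1^[n] x ∈ (fun n => f.1^[n] x) '' {n | n < minimalPeriod f.1 x} := fun n =>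
      ⟨n % minimalPeriod f.1 x, Nat.mod_lt _ (Nat.pos_of_ne_zero hx), iterate_mod_minimalPeriod_eq⟩
    intro y
    constructor
    · rintro ⟨n, -, hn⟩
      have : y = f.1^[n + (minimalPeriod f.1 x - 1)] x := by
        apply f.2
        rw [← iterate_succ_apply' f.1, ← hn]
        dsimp only
        rw [iterate_eq_iterate_iff f.2, show (n + (minimalPeriod f.1 x - 1)).succ =
          n + minimalPeriod f.1 x by omega]
        simp
      rw [this]
      exact key _
    · rintro ⟨n, -, rfl⟩
      dsimp only
      rw [← iterate_succ_apply' f.1]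
      exact key _

theorem encard_cyc (f : Inj Ω) (x : Ω) :
    (cyc f x).encard = if minimalPeriod f.1 x = 0 then ⊤ else (minimalPeriod f.1 x : ℕ∞) := by
  split_ifs with h
  · rw [encard_eq_top_iff]
    refine (infinite_range_of_injective (f := fun n => f.1^[n] x) fun n m hnm => ?_).mono ?_
    · have := (iterate_eq_iterate_iff f.2 x n m).1 hnm
      rwa [h, Nat.modEq_zero_iff] at this
    · rintro _ ⟨n, rfl⟩
      exact iterate_mem_cyc f x n
  · rw [cyc_eq_image h, InjOn.encard_image, Nat.encard_range]
    intro n hn m hm hnm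
    exact Nat.ModEq.eq_of_lt_of_lt ((iterate_eq_iterate_iff f.2 x n m).1 hnm) hn hm

theorem minimalPeriod_eq_of_encard_cyc_eq {f g : Inj Ω} {x y : Ω}
    (h : (cyc f x).encard = (cyc g y).encard) : minimalPeriod f.1 x = minimalPeriod g.1 y := by
  rw [encard_cyc, encard_cyc] at h
  split_ifs at h with h1 h2 h2
  · rw [h1, h2]
  · exact absurd h.symm (ENat.natCast_ne_top _)
  · exact absurd h (ENat.natCast_ne_top _)
  · exact_mod_cast h

theorem cyc_finite_iff {f : Inj Ω} {x : Ω} : (cyc f x).Finite ↔ minimalPeriod f.1 x ≠ 0 := by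
  rw [← encard_ne_top_iff, encard_cyc]
  split_ifs with h <;> simp [h]

/-- An injection of a finite cycle into itself is onto. -/
theorem cyc_subset_range_of_finite {f : Inj Ω} {x : Ω} (h : (cyc f x).Finite) :
    cyc f x ⊆ range f.1 := by
  have hm : f.1 '' cyc f x ⊆ cyc f x := by
    rintro _ ⟨y, hy, rfl⟩
    exact (isInvariant_cyc f x y).2 hy
  have := h.eq_of_subset_of_encard_le' hm (f.2.encard_image _).ge
  rw [← this]
  exact image_subset_range _ _

/-! #### Conjugacy -/

/-- Two injections are conjugate if they have families of base points in their cycles with matching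
properties. -/
theorem exists_conj_eq_of_bases {f g : Inj Ω} {C : Type*} {b c : C → Ω}
    (hper : ∀ S p q, f.1^[p] (b S) = f.1^[q] (b S) ↔ g.1^[p] (c S) = g.1^[q] (c S))
    (hb : ∀ S S', b S' ∈ cyc f (b S) → S = S') (hc : ∀ S S', c S' ∈ cyc g (c S) → S = S')
    (hbcov : ∀ x, ∃ S, x ∈ cyc f (b S)) (hccov : ∀ x, ∃ S, x ∈ cyc g (c S))
    (hstart : ∀ S, (b S ∉ range f.1 ∧ c S ∉ range g.1) ∨
      (cyc f (b S) ⊆ range f.1 ∧ cyc g (c S) ⊆ range g.1)) : ∃ a, g = conj a f := by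
  have hsurj : ∀ {f : Inj Ω} {x : Ω}, cyc f x ⊆ range f.1 → ∀ (i : ℕ), ∀ z ∈ cyc f x,
      ∃ y ∈ cyc f x, f.1^[i] y = z := by
    intro f x h i
    induction i with
    | zero => exact fun z hz => ⟨z, hz, rfl⟩
    | succ i ih =>
      intro z hz
      obtain ⟨y, hy, rfl⟩ := ih z hz
      obtain ⟨w, rfl⟩ := h hy
      exact ⟨w, (isInvariant_cyc f x w).1 hy, iterate_succ_apply _ _ _⟩
  have hfun : ∀ {f g : Inj Ω} {b c : C → Ω},
      (∀ S p q, f.1^[p] (b S) = f.1^[q] (b S) ↔ g.1^[p] (c S) = g.1^[q] (c S)) →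
      (∀ S S', b S' ∈ cyc f (b S) → S = S') → ∀ {x y y'},
      (∃ S i j, f.1^[i] x = f.1^[j] (b S) ∧ g.1^[i] y = g.1^[j] (c S)) →
      (∃ S i j, f.1^[i] x = f.1^[j] (b S) ∧ g.1^[i] y' = g.1^[j] (c S)) → y = y' := by
    rintro f g b c hper hb x y y' ⟨S, i, j, h1, h2⟩ ⟨S', i', j', h3, h4⟩
    have e1 : f.1^[i' + j] (b S) = f.1^[i + j'] (b S') := by
      rw [iterate_add_apply, iterate_add_apply, ← h1, ← h3, ← iterate_add_apply,
        ← iterate_add_apply, add_comm]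
    obtain rfl := hb S S' ⟨_, _, e1⟩
    have e2 := (hper S _ _).1 e1
    rw [iterate_add_apply, iterate_add_apply, ← h2, ← h4, ← iterate_add_apply,
      ← iterate_add_apply, add_comm] at e2
    exact g.2.iterate _ e2
  have htot : ∀ {f g : Inj Ω} {b c : C → Ω}, (∀ x, ∃ S, x ∈ cyc f (b S)) →
      (∀ S, (b S ∉ range f.1 ∧ c S ∉ range g.1) ∨
        (cyc f (b S) ⊆ range f.1 ∧ cyc g (c S) ⊆ range g.1)) →
      ∀ x, ∃ y, ∃ S i j, f.1^[i] x = f.1^[j] (b S) ∧ g.1^[i] y = g.1^[j] (c S) := by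
    intro f g b c hcov hstart x
    obtain ⟨S, j, i, h⟩ := hcov x
    rcases hstart S with ⟨h1, h2⟩ | ⟨h1, h2⟩
    · have hij : i ≤ j := by
        by_contra hlt
        obtain ⟨k, rfl⟩ := Nat.exists_eq_add_of_lt (not_le.1 hlt)
        rw [add_assoc, iterate_add_apply] at h
        have := f.2.iterate _ h
        rw [iterate_succ_apply'] at this
        exact h1 ⟨_, this.symm⟩
      obtain ⟨k, rfl⟩ := Nat.exists_eq_add_of_le hij
      rw [iterate_add_apply] at h
      exact ⟨g.1^[k] (c S), S, 0, k, (f.2.iterate _ h).symm, rfl⟩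
    · obtain ⟨y, -, hy⟩ := hsurj h2 i _ (iterate_mem_cyc g (c S) j)
      exact ⟨y, S, i, j, h.symm, hy⟩
  -- Related points have the same displacement `j - i` from the base points of their cycles.
  obtain ⟨a, ha⟩ := exists_perm_of_rel
    (R := fun x y => ∃ S i j, f.1^[i] x = f.1^[j] (b S) ∧ g.1^[i] y = g.1^[j] (c S))
    (hfun hper hb)
    (fun ⟨S, i, j, h1, h2⟩ ⟨S', i', j', h3, h4⟩ => hfun (fun S p q => (hper S p q).symm) hc
      ⟨S, i, j, h2, h1⟩ ⟨S', i', j', h4, h3⟩)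
    (htot hbcov hstart)
    (fun y => by
      obtain ⟨x, S, i, j, h1, h2⟩ := htot hccov (fun S => (hstart S).imp And.symm And.symm) y
      exact ⟨x, S, i, j, h2, h1⟩)
  have hcomm : ∀ x, a (f.1 x) = g.1 (a x) := by
    intro x
    refine hfun hper hb (ha (f.1 x)) ?_
    obtain ⟨S, i, j, h1, h2⟩ := ha x
    refine ⟨S, i, j + 1, ?_, ?_⟩
    · rw [← iterate_succ_apply, iterate_succ_apply', h1, iterate_succ_apply']
    · rw [← iterate_succ_apply, iterate_succ_apply', h2, iterate_succ_apply']
  refine ⟨a⁻¹, Inj.ext fun x => ?_⟩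
  have := hcomm (a.symm x)
  rw [a.apply_symm_apply] at this
  exact this.symm

theorem countable_cycles [Countable Ω] (f : Inj Ω) : Countable {S : Set Ω // IsCycle f S} := by
  choose b hb using fun S : {S : Set Ω // IsCycle f S} => S.2.1
  refine (Injective.countable (f := b) fun S S' h => Subtype.ext ?_)
  rw [S.2.eq_cyc (hb S), S'.2.eq_cyc (hb S'), h]

/-- The type of a cycle. -/
noncomputable def cycleType (f : Inj Ω) (S : {S : Set Ω // IsCycle f S}) : ℕ∞ × Prop :=
  (S.1.encard, (S.1 \ range f.1).Nonempty)

theorem card_fiber (f : Inj Ω) (p : Set Ω → Prop) (t : ℕ∞ × Prop)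
    (h : ∀ S, IsCycle f S → ((S.encard, (S \ range f.1).Nonempty) = t ↔ p S)) :
    ENat.card {S // cycleType f S = t} = {S : Set Ω | IsCycle f S ∧ p S}.encard :=
  ENat.card_congr
    { toFun := fun S => ⟨S.1.1, S.1.2, (h _ S.1.2).1 S.2⟩
      invFun := fun S => ⟨⟨S.1, S.2.1⟩, (h _ S.2.1).2 S.2.2⟩
      left_inv := fun _ => rfl
      right_inv := fun _ => rfl }

/-- The three kinds of counts cover all types that occur; an empty cycle, or a finite one with an
omitted point, is impossible. -/
theorem card_fiber_eq {f g : Inj Ω} (ho : openCount f = openCount g)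
    (hf : fwdCount f = fwdCount g) (hc : ∀ n, cycleCount f n = cycleCount g n) (t : ℕ∞ × Prop) :
    ENat.card {S // cycleType f S = t} = ENat.card {S // cycleType g S = t} := by
  obtain ⟨e, P⟩ := t
  have aux : ∀ (f : Inj Ω) (S : Set Ω), IsCycle f S → (S \ range f.1).Nonempty → S.Infinite := by
    rintro f S hS ⟨x, hx, hx'⟩ hfin
    have e := hS.eq_cyc hx
    rw [e] at hx hfin
    exact hx' (cyc_subset_range_of_finite hfin hx)
  rcases eq_or_ne e ⊤ with rfl | he
  · by_cases hP : P
    · have key : ∀ f : Inj Ω, ENat.card {S // cycleType f S = (⊤, P)} = fwdCount f := fun f =>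
        (card_fiber f (fun S => S.Infinite ∧ (S \ range f.1).Nonempty) _ fun S hS => by
          simp [hP]).trans rfl
      rw [key, key, hf]
    · have key : ∀ f : Inj Ω, ENat.card {S // cycleType f S = (⊤, P)} = openCount f := fun f =>
        (card_fiber f (fun S => S.Infinite ∧ ¬ IsForwardCycle f S) _ fun S hS => by
          simp only [Prod.mk.injEq, encard_eq_top_iff, hP, eq_iff_iff, iff_false, IsForwardCycle]
          tauto).trans rfl
      rw [key, key, ho]
  · lift e to ℕ using he
    by_cases hP : P
    · have key : ∀ f : Inj Ω, ENat.card {S // cycleType f S = ((e : ℕ∞), P)} = 0 := fun f => by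
        rw [card_fiber f (fun _ => False) _ fun S hS => ?_]
        · simp
        · simp only [Prod.mk.injEq, hP, eq_iff_iff, iff_true, iff_false, not_and]
          exact fun h h' => aux f S hS h' (finite_of_encard_eq_coe h)
      rw [key, key]
    · rcases Nat.eq_zero_or_pos e with rfl | hpos
      · have key : ∀ f : Inj Ω, ENat.card {S // cycleType f S = (((0 : ℕ) : ℕ∞), P)} = 0 := fun f => by
          rw [card_fiber f (fun _ => False) _ fun S hS => ?_]
          · simp
          · simp only [Prod.mk.injEq, iff_false, not_and]
            exact fun h _ => hS.1.ne_empty (encard_eq_zero.1 (by simpa using h))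
        rw [key, key]
      · have key : ∀ f : Inj Ω, ENat.card {S // cycleType f S = ((e : ℕ∞), P)} =
            cycleCount f ⟨e, hpos⟩ := fun f =>
          (card_fiber f (fun S => S.encard = e) _ fun S hS => by
            simp only [Prod.mk.injEq, hP, eq_iff_iff, iff_false, and_iff_left_iff_imp]
            exact fun h h' => aux f S hS h' (finite_of_encard_eq_coe h)).trans rfl
        exact (key f).trans ((hc _).trans (key g).symm)

/-- Equal counts give a type-preserving bijection between the cycles, of which there are countably
many. The base point of a forward cycle is its omitted point. -/
theorem exists_conj_eq_of_counts [Countable Ω] {f g : Inj Ω} (ho : openCount f = openCount g)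
    (hf : fwdCount f = fwdCount g) (hc : ∀ n, cycleCount f n = cycleCount g n) :
    ∃ a, g = conj a f := by
  have := countable_cycles f
  have := countable_cycles g
  let Φ := Equiv.ofFiberEquiv (f := cycleType f) (g := cycleType g) fun t =>
    (nonempty_equiv_of_card_eq (card_fiber_eq ho hf hc t)).some
  have hΦ : ∀ S, cycleType g (Φ S) = cycleType f S := fun S => Equiv.ofFiberEquiv_map _ S
  have hbase : ∀ (f : Inj Ω) (S : {S : Set Ω // IsCycle f S}), ∃ x, S.1 = cyc f x ∧
      ((S.1 \ range f.1).Nonempty → x ∉ range f.1) := by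
    rintro f ⟨S, hS⟩
    by_cases h : (S \ range f.1).Nonempty
    · obtain ⟨x, hx, hx'⟩ := h
      exact ⟨x, hS.eq_cyc hx, fun _ => hx'⟩
    · obtain ⟨x, hx⟩ := hS.1
      exact ⟨x, hS.eq_cyc hx, fun h' => absurd h' h⟩
  choose b hb hb' using hbase f
  choose c hc hc' using hbase g
  refine exists_conj_eq_of_bases (b := b) (c := fun S => c (Φ S)) ?_ ?_ ?_ ?_ ?_ ?_
  · intro S p q
    have h1 : (Φ S).1.encard = S.1.encard := congrArg Prod.fst (hΦ S)
    rw [iterate_eq_iterate_iff f.2, iterate_eq_iterate_iff g.2,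
      minimalPeriod_eq_of_encard_cyc_eq (f := f) (g := g) (x := b S) (y := c (Φ S))
        (by rw [← hb, ← hc, h1])]
  · intro S S' h
    exact Subtype.ext (by rw [hb S, hb S', cyc_eq_of_mem h])
  · intro S S' h
    exact Φ.injective (Subtype.ext (by rw [hc (Φ S), hc (Φ S'), cyc_eq_of_mem h]))
  · intro x
    refine ⟨⟨_, isCycle_cyc f x⟩, ?_⟩
    rw [← hb]
    exact mem_cyc_self f x
  · intro x
    refine ⟨Φ.symm ⟨_, isCycle_cyc g x⟩, ?_⟩
    rw [← hc, Φ.apply_symm_apply]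
    exact mem_cyc_self g x
  · intro S
    have h2 : ((Φ S).1 \ range g.1).Nonempty ↔ (S.1 \ range f.1).Nonempty :=
      iff_of_eq (congrArg Prod.snd (hΦ S))
    by_cases h : (S.1 \ range f.1).Nonempty
    · exact .inl ⟨hb' S h, hc' _ (h2.2 h)⟩
    · refine .inr ⟨?_, ?_⟩
      · rw [← hb]
        exact sdiff_eq_empty.1 (not_nonempty_iff_eq_empty.1 h)
      · rw [← hc]
        exact sdiff_eq_empty.1 (not_nonempty_iff_eq_empty.1 (mt h2.1 h))

end Cycles

/-! ### Multiplication by a transposition -/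

section Swap

variable {Ω : Type*}

open Classical in
/-- The product of `f` and the transposition of `a` and `b`. -/
noncomputable def mulSwap (f : Inj Ω) (a b : Ω) : Inj Ω := f * ofPerm (Equiv.swap a b)

theorem mulSwap_mulSwap (f : Inj Ω) (a b : Ω) : mulSwap (mulSwap f a b) a b = f := by
  classical
  exact Inj.ext fun x => Equiv.swap_apply_self a b (f.1 x)

theorem mulSwap_comm (f : Inj Ω) (a b : Ω) : mulSwap f a b = mulSwap f b a := by
  classical
  rw [mulSwap, mulSwap, Equiv.swap_comm]

variable {f : Inj Ω} {a b : Ω}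

theorem mulSwap_apply_of_eq_left {x : Ω} (h : f.1 x = a) : (mulSwap f a b).1 x = b := by
  classical
  subst h
  exact Equiv.swap_apply_left _ _

theorem mulSwap_apply_of_eq_right {x : Ω} (h : f.1 x = b) : (mulSwap f a b).1 x = a := by
  classical
  subst h
  exact Equiv.swap_apply_right _ _

theorem mulSwap_apply_of_ne {x : Ω} (ha : f.1 x ≠ a) (hb : f.1 x ≠ b) :
    (mulSwap f a b).1 x = f.1 x := by
  classical
  exact Equiv.swap_apply_of_ne_of_ne ha hb

theorem mulSwap_apply_mem_iff {S : Set Ω} (hS : a ∈ S ↔ b ∈ S) (x : Ω) :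
    (mulSwap f a b).1 x ∈ S ↔ f.1 x ∈ S := by
  by_cases ha : f.1 x = a
  · rw [mulSwap_apply_of_eq_left ha, ha, hS]
  by_cases hb : f.1 x = b
  · rw [mulSwap_apply_of_eq_right hb, hb, hS]
  rw [mulSwap_apply_of_ne ha hb]

theorem isInvariant_mulSwap_iff {S : Set Ω} (hS : a ∈ S ↔ b ∈ S) :
    IsInvariant (mulSwap f a b) S ↔ IsInvariant f S :=
  forall_congr' fun x => by rw [mulSwap_apply_mem_iff hS]

theorem isCycle_mulSwap_iff {S : Set Ω} (ha : a ∉ S) (hb : b ∉ S) :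
    IsCycle (mulSwap f a b) S ↔ IsCycle f S := by
  unfold IsCycle
  rw [isInvariant_mulSwap_iff (by tauto)]
  refine and_congr_right fun _ => and_congr_right fun _ => forall_congr' fun T =>
    forall_congr' fun hT => ?_
  rw [isInvariant_mulSwap_iff (iff_of_false (fun h => ha (hT h)) fun h => hb (hT h))]

theorem iterate_mulSwap {k : ℕ} (h : ∀ i, 0 < i → i < k → f.1^[i] a ≠ a ∧ f.1^[i] a ≠ b) :
    ∀ i, i < k → (mulSwap f a b).1^[i] a = f.1^[i] a := by
  intro i
  induction i with
  | zero => exact fun _ => rfl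
  | succ i ih =>
    intro hi
    have h1 := h (i + 1) (Nat.succ_pos i) hi
    rw [iterate_succ_apply' f.1] at h1
    rw [iterate_succ_apply', ih (by omega), iterate_succ_apply', mulSwap_apply_of_ne h1.1 h1.2]

/-- A transposition merges a finite cycle with another cycle. -/
theorem mem_cyc_mulSwap_of_finite (hb : b ∉ cyc f a) (hfin : (cyc f a).Finite) :
    b ∈ cyc (mulSwap f a b) a := by
  have hm := Nat.pos_of_ne_zero (cyc_finite_iff.1 hfin)
  obtain ⟨k, hk⟩ : ∃ k, minimalPeriod f.1 a = k + 1 := ⟨minimalPeriod f.1 a - 1, by omega⟩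
  have h1 := iterate_mulSwap (f := f) (a := a) (b := b) (k := minimalPeriod f.1 a)
    (fun i hi hi' => ⟨fun h => ?_, fun h => hb ⟨i, 0, h⟩⟩) k (by omega)
  -- The step that would return to `a` is redirected to `b`.
  · refine ⟨k + 1, 0, ?_⟩
    rw [iterate_succ_apply', h1]
    refine mulSwap_apply_of_eq_left ?_
    rw [← iterate_succ_apply' f.1, Nat.succ_eq_add_one, ← hk, iterate_minimalPeriod]
  · exact not_isPeriodicPt_of_pos_of_lt_minimalPeriod hi.ne' hi' h

/-- The first visit to `b` is redirected to `a`, which closes a finite cycle without `b`. -/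
theorem notMem_cyc_mulSwap_of_iterate_eq (hab : a ≠ b) {k : ℕ} (hk : f.1^[k] a = b) :
    (cyc (mulSwap f a b) a).Finite ∧ b ∉ cyc (mulSwap f a b) a := by
  classical
  have hex : ∃ k : ℕ, f.1^[k] a = b := ⟨k, hk⟩
  set n := Nat.find hex with hn
  have hnb : f.1^[n] a = b := Nat.find_spec hex
  have hmin : ∀ i, i < n → f.1^[i] a ≠ b := fun i hi => Nat.find_min hex hi
  have hn0 : n ≠ 0 := by
    intro h0
    rw [h0] at hnb
    exact hab hnb
  obtain ⟨m, hm⟩ : ∃ m, n = m + 1 := ⟨n - 1, by omega⟩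
  have h1 := iterate_mulSwap (f := f) (a := a) (b := b) (k := n)
    (fun i hi hi' => ⟨fun h => ?_, hmin i hi'⟩)
  · have hper : IsPeriodicPt (mulSwap f a b).1 n a := by
      change (mulSwap f a b).1^[n] a = a
      rw [hm, iterate_succ_apply', h1 m (by omega)]
      refine mulSwap_apply_of_eq_right ?_
      rw [← iterate_succ_apply' f.1, Nat.succ_eq_add_one, ← hm]
      exact hnb
    have hmp := hper.minimalPeriod_pos (Nat.pos_of_ne_zero hn0)
    refine ⟨cyc_finite_iff.2 hmp.ne', ?_⟩
    rw [cyc_eq_image hmp.ne']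
    rintro ⟨i, hi, hib⟩
    have hin : i < n := lt_of_lt_of_le hi (hper.minimalPeriod_le (Nat.pos_of_ne_zero hn0))
    dsimp only at hib
    rw [h1 i hin] at hib
    exact hmin i hin hib
  · refine hmin (n - i) (by omega) ?_
    rw [← hnb]
    conv_rhs => rw [← Nat.sub_add_cancel hi'.le, iterate_add_apply, h]

/-- A transposition splits a cycle that contains both of its points. -/
theorem split_of_mem_cyc (hab : a ≠ b) (hb : b ∈ cyc f a) :
    cyc (mulSwap f a b) a ≠ cyc (mulSwap f a b) b ∧
      ((cyc (mulSwap f a b) a).Finite ∨ (cyc (mulSwap f a b) b).Finite) := by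
  obtain ⟨i, j, h⟩ := hb
  rcases le_total j i with hle | hle
  · obtain ⟨k, rfl⟩ := Nat.exists_eq_add_of_le hle
    rw [iterate_add_apply] at h
    obtain ⟨h1, h2⟩ := notMem_cyc_mulSwap_of_iterate_eq hab (f.2.iterate _ h)
    refine ⟨fun h => h2 ?_, .inl h1⟩
    rw [h]
    exact mem_cyc_self _ _
  · obtain ⟨k, rfl⟩ := Nat.exists_eq_add_of_le hle
    rw [iterate_add_apply] at h
    obtain ⟨h1, h2⟩ := notMem_cyc_mulSwap_of_iterate_eq hab.symm (f.2.iterate _ h.symm)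
    rw [mulSwap_comm] at h1 h2
    refine ⟨fun h => h2 ?_, .inr h1⟩
    rw [← h]
    exact mem_cyc_self _ _

theorem cyc_eq_iff {x y : Ω} : cyc f x = cyc f y ↔ y ∈ cyc f x :=
  ⟨fun h => h ▸ mem_cyc_self f y, cyc_eq_of_mem⟩

/-- If one of two distinct cycles were finite, they would merge. -/
theorem infinite_of_ne_of_ne (h : cyc f a ≠ cyc f b)
    (h' : cyc (mulSwap f a b) a ≠ cyc (mulSwap f a b) b) :
    (cyc f a).Infinite ∧ (cyc f b).Infinite := by
  refine ⟨fun hfin => h' ?_, fun hfin => h' ?_⟩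
  · exact cyc_eq_of_mem (mem_cyc_mulSwap_of_finite (fun hb => h (cyc_eq_of_mem hb)) hfin)
  · have := mem_cyc_mulSwap_of_finite (fun ha => h (cyc_eq_of_mem ha).symm) hfin
    rw [mulSwap_comm] at this
    exact (cyc_eq_of_mem this).symm

/-- The union of the cycles of the two points is the same for `f` and `mulSwap f a b`. -/
theorem union_cyc_mulSwap (f : Inj Ω) (a b : Ω) :
    cyc (mulSwap f a b) a ∪ cyc (mulSwap f a b) b = cyc f a ∪ cyc f b := by
  have key : ∀ f : Inj Ω, cyc (mulSwap f a b) a ∪ cyc (mulSwap f a b) b ⊆ cyc f a ∪ cyc f b := by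
    intro f
    have hinv : IsInvariant f (cyc f a ∪ cyc f b) := fun x =>
      or_congr (isInvariant_cyc f a x) (isInvariant_cyc f b x)
    have ha : a ∈ cyc f a ∪ cyc f b := .inl (mem_cyc_self f a)
    have hb : b ∈ cyc f a ∪ cyc f b := .inr (mem_cyc_self f b)
    rw [← isInvariant_mulSwap_iff (iff_of_true ha hb)] at hinv
    exact union_subset (hinv.cyc_subset ha) (hinv.cyc_subset hb)
  refine (key f).antisymm ?_
  have := key (mulSwap f a b)
  rwa [mulSwap_mulSwap] at this

/-- The number of cycles of `f` through `a` or `b` with the property `p`. -/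
noncomputable def touchCount (f : Inj Ω) (a b : Ω) (p : Set Ω → Prop) : ℕ∞ :=
  {S | (S = cyc f a ∨ S = cyc f b) ∧ p S}.encard

theorem touchCount_ne_top (f : Inj Ω) (a b : Ω) (p : Set Ω → Prop) : touchCount f a b p ≠ ⊤ := by
  rw [touchCount, encard_ne_top_iff]
  exact (toFinite {cyc f a, cyc f b}).subset fun S hS => hS.1

open Classical in
theorem touchCount_of_eq (h : cyc f a = cyc f b) (p : Set Ω → Prop) :
    touchCount f a b p = if p (cyc f a) then 1 else 0 := by
  split_ifs with hp
  · rw [touchCount, encard_eq_one]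
    refine ⟨cyc f a, ?_⟩
    ext S
    simp only [mem_ofPred_eq, mem_singleton_iff, ← h, or_self]
    exact ⟨And.left, fun hS => ⟨hS, hS ▸ hp⟩⟩
  · rw [touchCount, encard_eq_zero, eq_empty_iff_forall_notMem]
    rintro S ⟨hS, hpS⟩
    rw [← h, or_self] at hS
    exact hp (hS ▸ hpS)

open Classical in
theorem touchCount_of_ne (h : cyc f a ≠ cyc f b) (p : Set Ω → Prop) :
    touchCount f a b p = (if p (cyc f a) then 1 else 0) + if p (cyc f b) then 1 else 0 := by
  have key : {S | (S = cyc f a ∨ S = cyc f b) ∧ p S} =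
      {S | S = cyc f a ∧ p S} ∪ {S | S = cyc f b ∧ p S} := by
    ext S
    simp only [mem_ofPred_eq, mem_union]
    tauto
  have single : ∀ T : Set Ω, {S | S = T ∧ p S}.encard = if p T then 1 else 0 := by
    intro T
    split_ifs with hp
    · rw [encard_eq_one]
      refine ⟨T, ?_⟩
      ext S
      simp only [mem_ofPred_eq, mem_singleton_iff]
      exact ⟨And.left, fun hS => ⟨hS, hS ▸ hp⟩⟩
    · rw [encard_eq_zero, eq_empty_iff_forall_notMem]
      rintro S ⟨rfl, hpS⟩
      exact hp hpS
  rw [touchCount, key, encard_union_eq, single, single]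
  rw [disjoint_left]
  rintro S ⟨rfl, -⟩ ⟨hS, -⟩
  exact h hS

/-- The cycle is the union of the two pieces, at least one of which is finite, so it is infinite iff
exactly one piece is. -/
theorem touchCount_infinite_of_eq (hab : a ≠ b) (h : cyc f a = cyc f b) :
    touchCount (mulSwap f a b) a b Set.Infinite = touchCount f a b Set.Infinite := by
  classical
  obtain ⟨h1, h2⟩ := split_of_mem_cyc hab (cyc_eq_iff.1 h)
  have hU := union_cyc_mulSwap f a b
  rw [← h, union_self] at hU
  rw [touchCount_of_eq h, touchCount_of_ne h1, ← hU]
  rcases h2 with h2 | h2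
  · simp [h2, infinite_union]
  · simp [h2, infinite_union]

/-- A transposition does not change the number of infinite cycles through its points. -/
theorem touchCount_infinite (hab : a ≠ b) :
    touchCount (mulSwap f a b) a b Set.Infinite = touchCount f a b Set.Infinite := by
  by_cases h : cyc f a = cyc f b
  · exact touchCount_infinite_of_eq hab h
  by_cases h' : cyc (mulSwap f a b) a = cyc (mulSwap f a b) b
  · have := touchCount_infinite_of_eq hab h'
    rw [mulSwap_mulSwap] at this
    exact this.symm
  obtain ⟨h1, h2⟩ := infinite_of_ne_of_ne h h'
  obtain ⟨h3, h4⟩ := infinite_of_ne_of_ne (f := mulSwap f a b) (a := a) (b := b) h'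
    (by rwa [mulSwap_mulSwap])
  classical
  rw [touchCount_of_ne h, touchCount_of_ne h', if_pos h1, if_pos h2, if_pos h3, if_pos h4]

/-- The number of cycles with the property `p`, split according to whether they contain one of
the points `a` and `b`. -/
theorem encard_isCycle_and (f : Inj Ω) (a b : Ω) (p : Set Ω → Prop) :
    {S | IsCycle f S ∧ p S}.encard =
      {S | IsCycle f S ∧ a ∉ S ∧ b ∉ S ∧ p S}.encard + touchCount f a b p := by
  rw [touchCount, ← encard_union_eq]
  · congr 1
    ext S
    simp only [mem_ofPred_eq, mem_union]
    constructor
    · rintro ⟨hS, hp⟩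
      by_cases ha : a ∈ S
      · exact .inr ⟨.inl (hS.eq_cyc ha), hp⟩
      by_cases hb : b ∈ S
      · exact .inr ⟨.inr (hS.eq_cyc hb), hp⟩
      exact .inl ⟨hS, ha, hb, hp⟩
    · rintro (⟨hS, -, -, hp⟩ | ⟨rfl | rfl, hp⟩)
      exacts [⟨hS, hp⟩, ⟨isCycle_cyc f a, hp⟩, ⟨isCycle_cyc f b, hp⟩]
  · rw [disjoint_left]
    rintro S ⟨-, ha, hb, -⟩ ⟨rfl | rfl, -⟩
    exacts [ha (mem_cyc_self f a), hb (mem_cyc_self f b)]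

/-- Two predicates are needed because being an open cycle depends on the map. -/
theorem encard_isCycle_mulSwap (f : Inj Ω) (a b : Ω) {p q : Set Ω → Prop}
    (hpq : ∀ S, a ∉ S → b ∉ S → (p S ↔ q S)) :
    {S | IsCycle (mulSwap f a b) S ∧ a ∉ S ∧ b ∉ S ∧ p S} =
      {S | IsCycle f S ∧ a ∉ S ∧ b ∉ S ∧ q S} := by
  ext S
  constructor
  · rintro ⟨h, ha, hb, hp⟩
    exact ⟨(isCycle_mulSwap_iff ha hb).1 h, ha, hb, (hpq S ha hb).1 hp⟩
  · rintro ⟨h, ha, hb, hp⟩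
    exact ⟨(isCycle_mulSwap_iff ha hb).2 h, ha, hb, (hpq S ha hb).2 hp⟩

/-! #### Forward and open cycles -/

theorem infinite_of_diff_range_nonempty {S : Set Ω} (hS : IsCycle f S)
    (h : (S \ range f.1).Nonempty) : S.Infinite := by
  obtain ⟨x, hx, hx'⟩ := h
  intro hfin
  have e := hS.eq_cyc hx
  rw [e] at hx hfin
  exact hx' (cyc_subset_range_of_finite hfin hx)

/-- The forward cycles in an invariant set correspond to the points outside the image. -/
theorem encard_forward_subset {U : Set Ω} (hU : IsInvariant f U) :
    {S | IsForwardCycle f S ∧ S ⊆ U}.encard = (U \ range f.1).encard := by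
  have hinj : InjOn (cyc f) (U \ range f.1) := by
    rintro x ⟨-, hx⟩ y ⟨-, hy⟩ hxy
    obtain ⟨i, j, h⟩ := cyc_eq_iff.1 hxy
    rcases lt_trichotomy i j with hlt | rfl | hlt
    · obtain ⟨k, rfl⟩ := Nat.exists_eq_add_of_lt hlt
      rw [add_assoc, iterate_add_apply] at h
      have := f.2.iterate _ h
      rw [iterate_succ_apply'] at this
      exact absurd ⟨_, this.symm⟩ hx
    · exact f.2.iterate _ h
    · obtain ⟨k, rfl⟩ := Nat.exists_eq_add_of_lt hlt
      rw [add_assoc, iterate_add_apply] at h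
      have := f.2.iterate _ h
      rw [iterate_succ_apply'] at this
      exact absurd ⟨_, this⟩ hy
  rw [← hinj.encard_image]
  congr 1
  ext S
  constructor
  · rintro ⟨⟨hS, -, x, hx, hx'⟩, hSU⟩
    exact ⟨x, ⟨hSU hx, hx'⟩, (hS.eq_cyc hx).symm⟩
  · rintro ⟨x, ⟨hx, hx'⟩, rfl⟩
    have hne : (cyc f x \ range f.1).Nonempty := ⟨x, mem_cyc_self f x, hx'⟩
    exact ⟨⟨isCycle_cyc f x, infinite_of_diff_range_nonempty (isCycle_cyc f x) hne, hne⟩,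
      hU.cyc_subset hx⟩

/-- Each forward cycle contains exactly one omitted point. -/
theorem fwdCount_eq_coimageCard (f : Inj Ω) : fwdCount f = coimageCard f := by
  have := encard_forward_subset (f := f) (U := univ) fun x => by simp
  rw [← compl_eq_univ_sdiff] at this
  rw [coimageCard, ← this]
  simp [fwdCount]

theorem coimageCard_mulSwap (f : Inj Ω) (a b : Ω) : coimageCard (mulSwap f a b) = coimageCard f :=
  coimageCard_mul_ofPerm _ _

theorem fwdCount_mulSwap (f : Inj Ω) (a b : Ω) : fwdCount (mulSwap f a b) = fwdCount f := by
  rw [fwdCount_eq_coimageCard, fwdCount_eq_coimageCard, coimageCard_mulSwap]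

theorem encard_diff_range_mulSwap {U : Set Ω} (ha : a ∈ U) (hb : b ∈ U) :
    (U \ range (mulSwap f a b).1).encard = (U \ range f.1).encard := by
  classical
  rw [← (Equiv.swap a b).injective.encard_image (U \ range f.1)]
  congr 1
  have hU : ∀ x, Equiv.swap a b x ∈ U ↔ x ∈ U := by
    intro x
    by_cases hxa : x = a
    · subst hxa
      rw [Equiv.swap_apply_left]
      tauto
    by_cases hxb : x = b
    · subst hxb
      rw [Equiv.swap_apply_right]
      tauto
    rw [Equiv.swap_apply_of_ne_of_ne hxa hxb]
  have hrange : ∀ x, x ∈ range (mulSwap f a b).1 ↔ Equiv.swap a b x ∈ range f.1 := by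
    intro x
    constructor
    · rintro ⟨y, rfl⟩
      refine ⟨y, ?_⟩
      have : (mulSwap f a b).1 y = Equiv.swap a b (f.1 y) := by
        simp only [mulSwap, mul_apply, ofPerm_apply]
      rw [this, Equiv.swap_apply_self]
    · rintro ⟨y, hy⟩
      refine ⟨y, ?_⟩
      have : (mulSwap f a b).1 y = Equiv.swap a b (f.1 y) := by
        simp only [mulSwap, mul_apply, ofPerm_apply]
      rw [this, hy, Equiv.swap_apply_self]
  ext x
  simp only [mem_sdiff, mem_image, hrange]
  constructor
  · rintro ⟨h1, h2⟩
    exact ⟨Equiv.swap a b x, ⟨(hU x).2 h1, h2⟩, Equiv.swap_apply_self _ _ _⟩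
  · rintro ⟨y, ⟨h1, h2⟩, rfl⟩
    exact ⟨(hU y).2 h1, by rwa [Equiv.swap_apply_self]⟩

theorem touchCount_forward (f : Inj Ω) (a b : Ω) :
    touchCount f a b (IsForwardCycle f) = ((cyc f a ∪ cyc f b) \ range f.1).encard := by
  rw [← encard_forward_subset (f := f) fun x =>
    or_congr (isInvariant_cyc f a x) (isInvariant_cyc f b x)]
  rw [touchCount]
  congr 1
  ext S
  constructor
  · rintro ⟨rfl | rfl, h⟩
    exacts [⟨h, subset_union_left⟩, ⟨h, subset_union_right⟩]
  · rintro ⟨h, hS⟩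
    refine ⟨?_, h⟩
    obtain ⟨x, hx⟩ := h.1.1
    rcases hS hx with h' | h'
    · exact .inl (by rw [h.1.eq_cyc hx, cyc_eq_of_mem h'])
    · exact .inr (by rw [h.1.eq_cyc hx, cyc_eq_of_mem h'])

theorem touchCount_open_add_forward (f : Inj Ω) (a b : Ω) :
    touchCount f a b (IsOpenCycle f) + touchCount f a b (IsForwardCycle f) =
      touchCount f a b Set.Infinite := by
  rw [touchCount, touchCount, touchCount, ← encard_union_eq]
  · congr 1
    ext S
    simp only [mem_union, mem_ofPred_eq]
    constructor
    · rintro (⟨h, h'⟩ | ⟨h, h'⟩)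
      exacts [⟨h, h'.2.1⟩, ⟨h, h'.2.1⟩]
    · rintro ⟨h, h'⟩
      have hS : IsCycle f S := by
        rcases h with rfl | rfl
        exacts [isCycle_cyc f a, isCycle_cyc f b]
      by_cases hf : IsForwardCycle f S
      · exact .inr ⟨h, hf⟩
      · exact .inl ⟨h, hS, h', hf⟩
  · rw [disjoint_left]
    rintro S ⟨-, h⟩ ⟨-, h'⟩
    exact h.2.2 h'

/-- Among the cycles through `a` or `b`, the numbers of infinite and of forward ones are unchanged;
both are finite, so their difference is unchanged too. The other cycles are not affected. -/
theorem openCount_mulSwap (hab : a ≠ b) : openCount (mulSwap f a b) = openCount f := by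
  have hfwd : touchCount (mulSwap f a b) a b (IsForwardCycle (mulSwap f a b)) =
      touchCount f a b (IsForwardCycle f) := by
    rw [touchCount_forward, touchCount_forward, union_cyc_mulSwap,
      encard_diff_range_mulSwap (.inl (mem_cyc_self f a)) (.inr (mem_cyc_self f b))]
  have hopen : touchCount (mulSwap f a b) a b (IsOpenCycle (mulSwap f a b)) =
      touchCount f a b (IsOpenCycle f) := by
    have h := touchCount_infinite (f := f) hab
    rw [← touchCount_open_add_forward, ← touchCount_open_add_forward, hfwd] at h
    exact WithTop.add_right_cancel (touchCount_ne_top _ _ _ _) h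
  have key : ∀ f : Inj Ω, openCount f = {S | IsCycle f S ∧ IsOpenCycle f S}.encard := fun f => by
    rw [openCount]
    congr 1
    ext S
    exact ⟨fun h => ⟨h.1, h⟩, And.right⟩
  rw [key, key, encard_isCycle_and _ a b, encard_isCycle_and f a b, hopen]
  congr 2
  refine encard_isCycle_mulSwap f a b fun S ha hb => ?_
  have hr : (S \ range (mulSwap f a b).1).Nonempty ↔ (S \ range f.1).Nonempty := by
    refine exists_congr fun x => and_congr_right fun hx => not_congr (exists_congr fun y => ?_)
    have hxa : x ≠ a := fun h => ha (h ▸ hx)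
    have hxb : x ≠ b := fun h => hb (h ▸ hx)
    constructor
    · rintro rfl
      by_cases h1 : f.1 y = a
      · exact absurd (mulSwap_apply_of_eq_left h1) hxb
      by_cases h2 : f.1 y = b
      · exact absurd (mulSwap_apply_of_eq_right h2) hxa
      exact (mulSwap_apply_of_ne h1 h2).symm
    · rintro rfl
      exact mulSwap_apply_of_ne hxa hxb
  unfold IsOpenCycle IsForwardCycle
  rw [isCycle_mulSwap_iff ha hb, hr]

theorem cycleCount_eq (f : Inj Ω) (a b : Ω) (n : ℕ+) :
    cycleCount f n = {S | IsCycle f S ∧ a ∉ S ∧ b ∉ S ∧ S.encard = ((n : ℕ) : ℕ∞)}.encard +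
      touchCount f a b fun S => S.encard = ((n : ℕ) : ℕ∞) :=
  encard_isCycle_and f a b _

theorem cycleCount_mulSwap (f : Inj Ω) (a b : Ω) (n : ℕ+) :
    cycleCount (mulSwap f a b) n =
      {S | IsCycle f S ∧ a ∉ S ∧ b ∉ S ∧ S.encard = ((n : ℕ) : ℕ∞)}.encard +
      touchCount (mulSwap f a b) a b fun S => S.encard = ((n : ℕ) : ℕ∞) := by
  rw [cycleCount_eq _ a b, encard_isCycle_mulSwap f a b fun S _ _ => Iff.rfl]

/-- Only the sizes of the at most four cycles through `a` or `b` matter. A count that changes has a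
finite unaffected part. -/
theorem finEquiv_mulSwap (hab : a ≠ b) : FinEquiv f (mulSwap f a b) := by
  refine ⟨(openCount_mulSwap hab).symm, (fwdCount_mulSwap f a b).symm, ?_, ?_⟩
  · refine ((toFinite {cyc f a, cyc f b, cyc (mulSwap f a b) a, cyc (mulSwap f a b) b}).image
      Set.encard |>.preimage (f := fun n : ℕ+ => ((n : ℕ) : ℕ∞)) ?_).subset ?_
    · intro n _ m _ h
      have h' : ((n : ℕ) : ℕ∞) = ((m : ℕ) : ℕ∞) := h
      exact PNat.coe_injective (by exact_mod_cast h')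
    · intro n hn
      by_contra h
      have h0 : ∀ S ∈ ({cyc f a, cyc f b, cyc (mulSwap f a b) a, cyc (mulSwap f a b) b} :
          Set (Set Ω)), S.encard ≠ ((n : ℕ) : ℕ∞) := fun S hS hS' => h ⟨S, hS, hS'⟩
      apply hn
      rw [cycleCount_eq f a b, cycleCount_mulSwap]
      congr 1
      rw [touchCount, touchCount, encard_eq_zero.2, encard_eq_zero.2]
      · rw [eq_empty_iff_forall_notMem]
        rintro S ⟨rfl | rfl, hS⟩
        exacts [h0 _ (by simp) hS, h0 _ (by simp) hS]
      · rw [eq_empty_iff_forall_notMem]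
        rintro S ⟨rfl | rfl, hS⟩
        exacts [h0 _ (by simp) hS, h0 _ (by simp) hS]
  · intro n hn
    rw [cycleCount_eq f a b, cycleCount_mulSwap] at hn ⊢
    have hK : {S | IsCycle f S ∧ a ∉ S ∧ b ∉ S ∧ S.encard = ((n : ℕ) : ℕ∞)}.encard ≠ ⊤ := by
      intro h
      rw [h, top_add, top_add] at hn
      exact hn rfl
    exact ⟨WithTop.add_ne_top.2 ⟨hK, touchCount_ne_top _ _ _ _⟩,
      WithTop.add_ne_top.2 ⟨hK, touchCount_ne_top _ _ _ _⟩⟩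

end Swap

section Relations

variable {Ω : Type*}

/-! ### The relation `FinEquiv` -/

theorem FinEquiv.refl (f : Inj Ω) : FinEquiv f f :=
  ⟨rfl, rfl, by simp, fun _ h => absurd rfl h⟩

theorem FinEquiv.symm {f g : Inj Ω} (h : FinEquiv f g) : FinEquiv g f :=
  ⟨h.1.symm, h.2.1.symm, h.2.2.1.subset fun _ hn => Ne.symm hn,
    fun n hn => (h.2.2.2 n hn.symm).symm⟩

theorem FinEquiv.trans {f g k : Inj Ω} (h₁ : FinEquiv f g) (h₂ : FinEquiv g k) : FinEquiv f k := by
  refine ⟨h₁.1.trans h₂.1, h₁.2.1.trans h₂.2.1, (h₁.2.2.1.union h₂.2.2.1).subset ?_, ?_⟩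
  · intro n hn
    by_cases h : cycleCount f n = cycleCount g n
    · exact .inr fun h' => hn (h.trans h')
    · exact .inl h
  · intro n hn
    by_cases h : cycleCount f n = cycleCount g n
    · rw [h] at hn ⊢
      exact h₂.2.2.2 n hn
    · obtain ⟨h3, h4⟩ := h₁.2.2.2 n h
      refine ⟨h3, ?_⟩
      by_cases h' : cycleCount g n = cycleCount k n
      · rwa [← h']
      · exact (h₂.2.2.2 n h').2

theorem FinEquiv.cycleCount_eq_top_iff {f g : Inj Ω} (h : FinEquiv f g) (n : ℕ+) :
    cycleCount f n = ⊤ ↔ cycleCount g n = ⊤ := by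
  by_cases hn : cycleCount f n = cycleCount g n
  · rw [hn]
  · exact iff_of_false (h.2.2.2 n hn).1 (h.2.2.2 n hn).2

theorem infiniteCycleCount_eq (f : Inj Ω) : infiniteCycleCount f = openCount f + fwdCount f := by
  rw [infiniteCycleCount, openCount, fwdCount, ← encard_union_eq]
  · congr 1
    ext S
    simp only [mem_union, mem_ofPred_eq, IsOpenCycle, IsForwardCycle]
    tauto
  · rw [disjoint_left]
    rintro S h h'
    exact h.2.2 h'

theorem FinEquiv.infiniteCycleCount_eq {f g : Inj Ω} (h : FinEquiv f g) :
    infiniteCycleCount f = infiniteCycleCount g := by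
  rw [NormalInj.infiniteCycleCount_eq, NormalInj.infiniteCycleCount_eq, h.1, h.2.1]

theorem FinEquiv.coimageCard_eq {f g : Inj Ω} (h : FinEquiv f g) :
    coimageCard f = coimageCard g := by
  rw [← fwdCount_eq_coimageCard, h.2.1, fwdCount_eq_coimageCard]

open Classical in
theorem exists_mulSwap_eq {t : Equiv.Perm Ω} (ht : t.IsSwap) :
    ∃ a b, a ≠ b ∧ ∀ f : Inj Ω, f * ofPerm t = mulSwap f a b := by
  obtain ⟨a, b, hab, rfl⟩ := ht
  exact ⟨a, b, hab, fun _ => rfl⟩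

open Classical in
theorem finEquiv_mul_list (f : Inj Ω) {l : List (Equiv.Perm Ω)} (hl : ∀ t ∈ l, t.IsSwap) :
    FinEquiv f (f * ofPerm l.prod) := by
  induction l with
  | nil => exact FinEquiv.refl f
  | cons t l ih =>
    obtain ⟨a, b, hab, h⟩ := exists_mulSwap_eq (hl t (by simp))
    rw [List.prod_cons, ← ofPerm_mul, ← mul_assoc, h]
    exact (ih fun s hs => hl s (by simp [hs])).trans (finEquiv_mulSwap hab)

/-! ### The difference of the cycle counts -/

open Classical in
/-- The sum of the differences of the cycle counts of `f` and `g`. -/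
noncomputable def cycleDiff (f g : Inj Ω) : ℤ :=
  ∑ᶠ n : ℕ+, if cycleCount f n = cycleCount g n then (0 : ℤ)
    else ((cycleCount f n).toNat : ℤ) - ((cycleCount g n).toNat : ℤ)

theorem evenEquiv_iff {f g : Inj Ω} : EvenEquiv f g ↔ FinEquiv f g ∧ Even (cycleDiff f g) := Iff.rfl

/-- Equal counts, even infinite ones, have the same `toNat`, so the case distinction can be dropped.
-/
theorem cycleDiff_eq (f g : Inj Ω) : cycleDiff f g =
    ∑ᶠ n : ℕ+, (((cycleCount f n).toNat : ℤ) - ((cycleCount g n).toNat : ℤ)) := by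
  refine finsum_congr fun n => ?_
  split_ifs with h
  · rw [h, sub_self]
  · rfl

theorem cycleDiff_swap (f g : Inj Ω) : cycleDiff g f = -cycleDiff f g := by
  rw [cycleDiff_eq, cycleDiff_eq, ← finsum_neg_distrib]
  exact finsum_congr fun n => (neg_sub _ _).symm

theorem FinEquiv.finite_support {f g : Inj Ω} (h : FinEquiv f g) :
    (support fun n : ℕ+ =>
      ((cycleCount f n).toNat : ℤ) - ((cycleCount g n).toNat : ℤ)).Finite := by
  refine h.2.2.1.subset fun n hn h' => hn ?_
  dsimp only
  rw [h', sub_self]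

theorem FinEquiv.cycleDiff_add {f g h : Inj Ω} (h₁ : FinEquiv f g) (h₂ : FinEquiv g h) :
    cycleDiff f h = cycleDiff f g + cycleDiff g h := by
  rw [cycleDiff_eq, cycleDiff_eq, cycleDiff_eq,
    ← finsum_add_distrib h₁.finite_support h₂.finite_support]
  exact finsum_congr fun n => (sub_add_sub_cancel _ _ _).symm

theorem EvenEquiv.symm {f g : Inj Ω} (h : EvenEquiv f g) : EvenEquiv g f := by
  rw [evenEquiv_iff] at h ⊢
  rw [cycleDiff_swap, even_neg]
  exact ⟨h.1.symm, h.2⟩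

open Classical in
/-- The indicator function of the cardinality of a set. -/
noncomputable def cardIndicator (S : Set Ω) (n : ℕ+) : ℤ :=
  if S.encard = ((n : ℕ) : ℕ∞) then 1 else 0

theorem finite_support_cardIndicator (S : Set Ω) : (support (cardIndicator S)).Finite := by
  refine Set.Subsingleton.finite fun n hn m hm => ?_
  simp only [cardIndicator, mem_support, ne_eq, ite_eq_right_iff, one_ne_zero, imp_false,
    not_not] at hn hm
  rw [hn] at hm
  exact PNat.coe_injective (by exact_mod_cast hm)

theorem finsum_cardIndicator_of_infinite {S : Set Ω} (h : S.Infinite) :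
    ∑ᶠ n, cardIndicator S n = 0 := by
  rw [← finsum_zero (α := ℕ+)]
  refine finsum_congr fun n => if_neg ?_
  rw [h.encard_eq]
  exact (ENat.natCast_ne_top _).symm

theorem finsum_cardIndicator_of_finite {S : Set Ω} (hS : S.Nonempty) (h : S.Finite) :
    ∑ᶠ n, cardIndicator S n = 1 := by
  obtain ⟨k, hk⟩ := h.exists_encard_eq_coe
  have hk0 : 0 < k := by
    refine Nat.pos_of_ne_zero fun h0 => hS.ne_empty (encard_eq_zero.1 ?_)
    rw [hk, h0]; rfl
  let m : ℕ+ := ⟨k, hk0⟩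
  rw [finsum_eq_single (cardIndicator S) m]
  · exact if_pos hk
  · refine fun n hn => if_neg fun h' => hn (PNat.coe_injective ?_)
    rw [hk] at h'
    exact (Nat.cast_injective h').symm

/-- Splitting a finite or an infinite cycle yields one more finite cycle. By `hfin`, `toNat` gives
the true counts. -/
theorem cycleDiff_of_split {f : Inj Ω} {a b : Ω} (hab : a ≠ b) (h : cyc f a = cyc f b)
    (hfin : ∀ n, cycleCount f n ≠ ⊤) : cycleDiff f (mulSwap f a b) = -1 := by
  classical
  obtain ⟨h1, h2⟩ := split_of_mem_cyc hab (cyc_eq_iff.1 h)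
  have hU := union_cyc_mulSwap f a b
  rw [← h, union_self] at hU
  set A := cyc (mulSwap f a b) a
  set B := cyc (mulSwap f a b) b
  have hA : A.Nonempty := ⟨a, mem_cyc_self _ _⟩
  have hB : B.Nonempty := ⟨b, mem_cyc_self _ _⟩
  have key : cycleDiff f (mulSwap f a b) =
      ∑ᶠ n, cardIndicator (cyc f a) n - (∑ᶠ n, cardIndicator A n + ∑ᶠ n, cardIndicator B n) := by
    rw [← finsum_add_distrib (finite_support_cardIndicator A) (finite_support_cardIndicator B),
      ← finsum_sub_distrib (finite_support_cardIndicator _)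
        (((finite_support_cardIndicator A).union (finite_support_cardIndicator B)).subset
          (support_add _ _)), cycleDiff_eq]
    refine finsum_congr fun n => ?_
    have hf := hfin n
    rw [cycleCount_eq f a b n] at hf ⊢
    rw [cycleCount_mulSwap, touchCount_of_eq h, touchCount_of_ne h1]
    obtain ⟨k, hk⟩ := ENat.ne_top_iff_exists.1 (WithTop.add_ne_top.1 hf).1
    rw [← hk]
    have e : ∀ m : ℕ, ((k : ℕ∞) + m).toNat = k + m := fun m => by
      rw [← Nat.cast_add, ENat.toNat_natCast]
    have e1 : ((k : ℕ∞) + 1).toNat = k + 1 := e 1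
    have e2 : ((k : ℕ∞) + 2).toNat = k + 2 := e 2
    unfold cardIndicator
    split_ifs <;> norm_num [e1, e2]
  rw [key, ← hU]
  rcases h2 with h2 | h2
  · rw [finsum_cardIndicator_of_finite hA h2]
    by_cases h3 : B.Finite
    · rw [finsum_cardIndicator_of_finite hB h3,
        finsum_cardIndicator_of_finite (hA.mono subset_union_left) (h2.union h3)]
      norm_num
    · have h4 : (A ∪ B).Infinite := fun h => h3 (h.subset subset_union_right)
      rw [finsum_cardIndicator_of_infinite h3, finsum_cardIndicator_of_infinite h4]
      norm_num
  · rw [finsum_cardIndicator_of_finite hB h2]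
    by_cases h3 : A.Finite
    · rw [finsum_cardIndicator_of_finite hA h3,
        finsum_cardIndicator_of_finite (hA.mono subset_union_left) (h3.union h2)]
      norm_num
    · have h4 : (A ∪ B).Infinite := fun h => h3 (h.subset subset_union_left)
      rw [finsum_cardIndicator_of_infinite h3, finsum_cardIndicator_of_infinite h4]
      norm_num

/-- A split contributes -1 and a merger 1; the remaining case would need two infinite cycles. -/
theorem odd_cycleDiff_mulSwap {f : Inj Ω} {a b : Ω} (hab : a ≠ b)
    (hinf : infiniteCycleCount f = 1) (hfin : ∀ n, cycleCount f n ≠ ⊤) :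
    Odd (cycleDiff f (mulSwap f a b)) := by
  by_cases h : cyc f a = cyc f b
  · rw [cycleDiff_of_split hab h hfin]
    decide
  by_cases h' : cyc (mulSwap f a b) a = cyc (mulSwap f a b) b
  · have h1 := cycleDiff_of_split hab h' fun n =>
      mt (((finEquiv_mulSwap (f := f) hab).cycleCount_eq_top_iff n).2) (hfin n)
    rw [mulSwap_mulSwap, cycleDiff_swap] at h1
    rw [neg_inj.1 h1]
    exact odd_one
  · obtain ⟨h1, h2⟩ := infinite_of_ne_of_ne h h'
    have : (2 : ℕ∞) ≤ 1 := by
      rw [← hinf, ← encard_pair h]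
      refine encard_le_encard ?_
      rintro S (rfl | rfl)
      exacts [⟨isCycle_cyc f a, h1⟩, ⟨isCycle_cyc f b, h2⟩]
    exact absurd this (by decide)

open Classical in
theorem even_cycleDiff_mul_list {f : Inj Ω} (hinf : infiniteCycleCount f = 1)
    (hfin : ∀ n, cycleCount f n ≠ ⊤) {l : List (Equiv.Perm Ω)} (hl : ∀ t ∈ l, t.IsSwap) :
    Even (cycleDiff f (f * ofPerm l.prod)) ↔ Even l.length := by
  induction l with
  | nil =>
    have : cycleDiff f (f * ofPerm ([] : List (Equiv.Perm Ω)).prod) = 0 := by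
      change cycleDiff f f = 0
      rw [cycleDiff_eq]
      simp
    rw [this]
    simp
  | cons t l ih =>
    have hl' : ∀ s ∈ l, s.IsSwap := fun s hs => hl s (by simp [hs])
    obtain ⟨a, b, hab, h⟩ := exists_mulSwap_eq (hl t (by simp))
    have h1 := finEquiv_mul_list f hl'
    rw [List.prod_cons, ← ofPerm_mul, ← mul_assoc, h, h1.cycleDiff_add (finEquiv_mulSwap hab),
      Int.even_add, ih hl', List.length_cons, Nat.even_add_one]
    have h2 := odd_cycleDiff_mulSwap hab (h1.infiniteCycleCount_eq ▸ hinf)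
      fun n => mt (h1.cycleCount_eq_top_iff n).2 (hfin n)
    rw [← Int.not_even_iff_odd] at h2
    tauto

/-! ### Merging finite cycles into a forward cycle -/

/-- Transposing an omitted point with a point of an `n`-cycle merges that cycle into a forward one.
The additive form allows infinite counts. -/
theorem exists_mulSwap_cycleCount_add {f : Inj Ω} (hf : coimageCard f ≠ 0) {n : ℕ+}
    (hn : cycleCount f n ≠ 0) :
    ∃ a b, a ≠ b ∧ ∀ k, cycleCount (mulSwap f a b) k + (if k = n then 1 else 0) = cycleCount f k := by
  classical
  obtain ⟨s, hs⟩ := encard_ne_zero.1 hf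
  obtain ⟨S, hS, hSn⟩ := encard_ne_zero.1 hn
  obtain ⟨c, rfl⟩ := isCycle_iff.1 hS
  have hcfin : (cyc f c).Finite := finite_of_encard_eq_coe hSn
  have hsinf : (cyc f s).Infinite :=
    infinite_of_diff_range_nonempty (isCycle_cyc f s) ⟨s, mem_cyc_self f s, hs⟩
  have hne : cyc f c ≠ cyc f s := fun h => hsinf (h ▸ hcfin)
  have hcs : c ≠ s := fun h => hne (by rw [h])
  have heq : cyc (mulSwap f c s) c = cyc (mulSwap f c s) s := by
    by_contra h
    exact (infinite_of_ne_of_ne hne h).1 hcfin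
  have hU := union_cyc_mulSwap f c s
  rw [← heq, union_self] at hU
  refine ⟨c, s, hcs, fun k => ?_⟩
  have h1 : ¬ (cyc (mulSwap f c s) c).encard = ((k : ℕ) : ℕ∞) := fun h =>
    hsinf ((finite_of_encard_eq_coe (hU ▸ h)).subset subset_union_right)
  have h2 : ¬ (cyc f s).encard = ((k : ℕ) : ℕ∞) := fun h => hsinf (finite_of_encard_eq_coe h)
  have h3 : (cyc f c).encard = ((k : ℕ) : ℕ∞) ↔ k = n := by
    rw [hSn]
    exact ⟨fun h => PNat.coe_injective (by exact_mod_cast h.symm), fun h => by rw [h]⟩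
  rw [cycleCount_eq f c s, cycleCount_mulSwap, touchCount_of_eq heq, touchCount_of_ne hne]
  simp only [h1, h2, h3, if_false, add_zero]

open Classical in
theorem exists_list_cycleCount_add (n : ℕ+) (k : ℕ) : ∀ f : Inj Ω, coimageCard f ≠ 0 →
    (k : ℕ∞) ≤ cycleCount f n → ∃ l : List (Equiv.Perm Ω), (∀ t ∈ l, t.IsSwap) ∧ l.length = k ∧
      ∀ m, cycleCount (f * ofPerm l.prod) m + (if m = n then (k : ℕ∞) else 0) = cycleCount f m := by
  induction k with
  | zero =>
    intro f _ _
    refine ⟨[], by simp, rfl, fun m => ?_⟩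
    simp [ofPerm_one]
  | succ k ih =>
    intro f hf hk
    obtain ⟨a, b, hab, h⟩ := exists_mulSwap_cycleCount_add hf (n := n) (by
      rintro h0
      rw [h0] at hk
      simp at hk)
    have hk' : (k : ℕ∞) ≤ cycleCount (mulSwap f a b) n := by
      have := h n
      rw [if_pos rfl] at this
      rw [← this, Nat.cast_add, Nat.cast_one] at hk
      exact (WithTop.add_le_add_iff_right ENat.one_ne_top).1 hk
    obtain ⟨l, hl, hlen, h'⟩ := ih (mulSwap f a b) (by rwa [coimageCard_mulSwap]) hk'
    refine ⟨l ++ [Equiv.swap a b], ?_, by simp [hlen], fun m => ?_⟩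
    · intro t ht
      rcases List.mem_append.1 ht with ht | ht
      · exact hl t ht
      · rw [List.mem_singleton.1 ht]
        exact ⟨a, b, hab, rfl⟩
    · have e : f * ofPerm (l ++ [Equiv.swap a b]).prod = mulSwap f a b * ofPerm l.prod := by
        rw [List.prod_append, List.prod_singleton, ← ofPerm_mul, ← mul_assoc]
        rfl
      rw [e, ← h m, ← h' m]
      split_ifs <;> simp [add_assoc]

open Classical in
theorem exists_list_cycleCount_add_finset (s : Finset ℕ+) (k : ℕ+ → ℕ) : ∀ f : Inj Ω,
    coimageCard f ≠ 0 → (∀ n ∈ s, (k n : ℕ∞) ≤ cycleCount f n) →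
    ∃ l : List (Equiv.Perm Ω), (∀ t ∈ l, t.IsSwap) ∧ l.length = ∑ n ∈ s, k n ∧
      ∀ m, cycleCount (f * ofPerm l.prod) m + (if m ∈ s then (k m : ℕ∞) else 0) =
        cycleCount f m := by
  induction s using Finset.induction_on with
  | empty =>
    intro f _ _
    refine ⟨[], by simp, rfl, fun m => ?_⟩
    simp [ofPerm_one]
  | insert n s hn ih =>
    intro f hf hk
    obtain ⟨l₁, hl₁, hlen₁, h₁⟩ := ih f hf fun m hm => hk m (Finset.mem_insert_of_mem hm)
    have hn' := h₁ n
    rw [if_neg hn, add_zero] at hn'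
    obtain ⟨l₂, hl₂, hlen₂, h₂⟩ := exists_list_cycleCount_add n (k n) (f * ofPerm l₁.prod)
      (by rwa [coimageCard_mul_ofPerm]) (by rw [hn']; exact hk n (Finset.mem_insert_self n s))
    refine ⟨l₂ ++ l₁, ?_, ?_, fun m => ?_⟩
    · intro t ht
      rcases List.mem_append.1 ht with ht | ht
      exacts [hl₂ t ht, hl₁ t ht]
    · rw [List.length_append, hlen₁, hlen₂, Finset.sum_insert hn]
    · rw [List.prod_append, ← ofPerm_mul, ← mul_assoc, ← h₁ m, ← h₂ m]
      by_cases hmn : m = n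
      · subst hmn
        simp [hn]
      · simp [hmn]

open Classical in
theorem exists_list_conj {l : List (Equiv.Perm Ω)} (hl : ∀ t ∈ l, t.IsSwap) (a : Equiv.Perm Ω) :
    ∃ l' : List (Equiv.Perm Ω), (∀ t ∈ l', t.IsSwap) ∧ l'.length = l.length ∧
      l'.prod = a⁻¹ * l.prod * a := by
  induction l with
  | nil => exact ⟨[], by simp, rfl, by simp⟩
  | cons t l ih =>
    obtain ⟨l', h1, h2, h3⟩ := ih fun s hs => hl s (by simp [hs])
    obtain ⟨x, y, hxy, rfl⟩ := hl t (by simp)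
    refine ⟨Equiv.swap (a⁻¹ x) (a⁻¹ y) :: l', ?_, by simp [h2], ?_⟩
    · intro s hs
      rcases List.mem_cons.1 hs with rfl | hs
      · exact ⟨_, _, a⁻¹.injective.ne hxy, rfl⟩
      · exact h1 s hs
    · rw [List.prod_cons, List.prod_cons, h3, Equiv.swap_apply_apply]
      group

open Classical in
theorem exists_list_inv {l : List (Equiv.Perm Ω)} (hl : ∀ t ∈ l, t.IsSwap) :
    ∃ l' : List (Equiv.Perm Ω), (∀ t ∈ l', t.IsSwap) ∧ l'.length = l.length ∧
      l'.prod = l.prod⁻¹ := by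
  refine ⟨(l.map (·⁻¹)).reverse, ?_, by simp, (List.prod_inv_reverse l).symm⟩
  intro t ht
  rw [List.mem_reverse, List.mem_map] at ht
  obtain ⟨s, hs, rfl⟩ := ht
  obtain ⟨x, y, hxy, rfl⟩ := hl s hs
  exact ⟨x, y, hxy, Equiv.swap_inv x y⟩

open Classical in
/-- Equivalent maps differ by a conjugation and a finitary permutation. -/
theorem FinEquiv.exists_eq_conj_mul [Countable Ω] {f g : Inj Ω} (h : FinEquiv f g)
    (hf : coimageCard f ≠ 0) :
    ∃ (a : Equiv.Perm Ω) (l : List (Equiv.Perm Ω)), (∀ t ∈ l, t.IsSwap) ∧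
      g = conj a f * ofPerm l.prod ∧ (Even l.length ↔ Even (cycleDiff f g)) := by
  set s := h.2.2.1.toFinset with hs
  have hmem : ∀ n, n ∈ s ↔ cycleCount f n ≠ cycleCount g n := fun n => by simp [hs]
  set F : ℕ+ → ℕ := fun n => (cycleCount f n).toNat with hF
  set G : ℕ+ → ℕ := fun n => (cycleCount g n).toNat with hG
  have hFn : ∀ n ∈ s, cycleCount f n = F n := fun n hn =>
    (ENat.natCast_toNat (h.2.2.2 n ((hmem n).1 hn)).1).symm
  have hGn : ∀ n ∈ s, cycleCount g n = G n := fun n hn =>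
    (ENat.natCast_toNat (h.2.2.2 n ((hmem n).1 hn)).2).symm
  -- With truncated subtraction, both maps keep `min (F n) (G n)` cycles of each size `n` in `s`, so
  -- they become conjugate.
  obtain ⟨l₁, hl₁, hlen₁, h₁⟩ := exists_list_cycleCount_add_finset s (fun n => F n - G n) f hf
    fun n hn => by rw [hFn n hn]; exact_mod_cast Nat.sub_le _ _
  obtain ⟨l₂, hl₂, hlen₂, h₂⟩ := exists_list_cycleCount_add_finset s (fun n => G n - F n) g
    (h.coimageCard_eq ▸ hf) fun n hn => by rw [hGn n hn]; exact_mod_cast Nat.sub_le _ _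
  have hcount : ∀ n, cycleCount (f * ofPerm l₁.prod) n = cycleCount (g * ofPerm l₂.prod) n := by
    intro n
    have e1 := h₁ n
    have e2 := h₂ n
    by_cases hn : n ∈ s
    · rw [if_pos hn, hFn n hn] at e1
      rw [if_pos hn, hGn n hn] at e2
      obtain ⟨x, hx⟩ := ENat.ne_top_iff_exists.1 (WithTop.add_ne_top.1 (e1 ▸ ENat.natCast_ne_top _)).1
      obtain ⟨y, hy⟩ := ENat.ne_top_iff_exists.1 (WithTop.add_ne_top.1 (e2 ▸ ENat.natCast_ne_top _)).1
      rw [← hx] at e1 ⊢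
      rw [← hy] at e2 ⊢
      have e1' : x + (F n - G n) = F n := by exact_mod_cast e1
      have e2' : y + (G n - F n) = G n := by exact_mod_cast e2
      have : x = y := by omega
      rw [this]
    · rw [if_neg hn, add_zero] at e1 e2
      rw [e1, e2]
      exact not_not.1 fun h' => hn ((hmem n).2 h')
  have q₁ := finEquiv_mul_list f hl₁
  have q₂ := finEquiv_mul_list g hl₂
  obtain ⟨a, ha⟩ := exists_conj_eq_of_counts (q₁.1.symm.trans (h.1.trans q₂.1))
    (q₁.2.1.symm.trans (h.2.1.trans q₂.2.1)) hcount
  obtain ⟨l₁', h1, h2, h3⟩ := exists_list_conj hl₁ a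
  obtain ⟨l₂', h4, h5, h6⟩ := exists_list_inv hl₂
  refine ⟨a, l₂' ++ l₁', ?_, ?_, ?_⟩
  · intro t ht
    rcases List.mem_append.1 ht with ht | ht
    exacts [h4 t ht, h1 t ht]
  · rw [List.prod_append, h3, h6, ← ofPerm_mul, ← mul_assoc, ← conj_ofPerm, ← conj_mul, ← ha,
      mul_ofPerm_cancel]
  · have e : cycleDiff f g = ∑ n ∈ s, ((F n : ℤ) - G n) := by
      rw [cycleDiff_eq]
      refine finsum_eq_sum_of_support_subset _ fun n hn => ?_
      rw [Finset.mem_coe, hmem]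
      intro h'
      refine hn ?_
      dsimp only
      rw [h', sub_self]
    -- The lengths are the sums of the positive and of the negative parts of `F n - G n`.
    have e' : cycleDiff f g = (l₁.length : ℤ) - l₂.length := by
      rw [e, hlen₁, hlen₂]
      push_cast
      rw [← Finset.sum_sub_distrib]
      exact Finset.sum_congr rfl fun n _ => by omega
    rw [e', List.length_append, h2, h5, Int.even_sub, Int.even_coe_nat, Int.even_coe_nat,
      Nat.even_add]
    tauto

open Classical in
/-- A map with two infinite cycles or infinitely many cycles of the same finite cardinality is
conjugate to its product with some transposition. -/
theorem exists_swap_mul_eq_conj [Countable Ω] {f : Inj Ω} (hf : coimageCard f ≠ 0)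
    (h : 2 ≤ infiniteCycleCount f ∨ ∃ n : ℕ+, cycleCount f n = ⊤) :
    ∃ (t : Equiv.Perm Ω) (a : Equiv.Perm Ω), t.IsSwap ∧ f * ofPerm t = conj a f := by
  suffices h : ∃ a b, a ≠ b ∧ ∀ k, cycleCount (mulSwap f a b) k = cycleCount f k by
    obtain ⟨a, b, hab, h⟩ := h
    obtain ⟨c, hc⟩ := exists_conj_eq_of_counts (openCount_mulSwap hab).symm
      (fwdCount_mulSwap f a b).symm fun n => (h n).symm
    exact ⟨Equiv.swap a b, c, ⟨a, b, hab, rfl⟩, hc⟩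
  rcases h with h | ⟨n, hn⟩
  · have h' : 1 < infiniteCycleCount f := lt_of_lt_of_le (by decide) h
    obtain ⟨S, T, ⟨hS, hSi⟩, ⟨hT, hTi⟩, hST⟩ := one_lt_encard_iff.1 h'
    obtain ⟨a, rfl⟩ := isCycle_iff.1 hS
    obtain ⟨b, rfl⟩ := isCycle_iff.1 hT
    have hab : a ≠ b := fun h => hST (by rw [h])
    -- Had the cycles merged, undoing the transposition would split off a finite cycle.
    have hST' : cyc (mulSwap f a b) a ≠ cyc (mulSwap f a b) b := by
      intro h1
      have := (split_of_mem_cyc hab (cyc_eq_iff.1 h1)).2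
      rw [mulSwap_mulSwap] at this
      exact this.elim hSi hTi
    have hi := infinite_of_ne_of_ne (f := mulSwap f a b) (a := a) (b := b) hST'
      (by rwa [mulSwap_mulSwap])
    refine ⟨a, b, hab, fun k => ?_⟩
    have aux : ∀ {S : Set Ω}, S.Infinite → ¬ S.encard = ((k : ℕ) : ℕ∞) := fun hS h' =>
      hS (finite_of_encard_eq_coe h')
    rw [cycleCount_eq f a b, cycleCount_mulSwap, touchCount_of_ne hST, touchCount_of_ne hST',
      if_neg (aux hSi), if_neg (aux hTi), if_neg (aux hi.1), if_neg (aux hi.2)]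
  · obtain ⟨a, b, hab, h⟩ := exists_mulSwap_cycleCount_add hf (n := n) (by simp [hn])
    refine ⟨a, b, hab, fun k => ?_⟩
    by_cases hk : k = n
    · subst hk
      exact ((finEquiv_mulSwap (f := f) hab).cycleCount_eq_top_iff k).1 hn |>.trans hn.symm
    · rw [← h k, if_neg hk, add_zero]

end Relations

section Classification

variable {Ω : Type*}

/-! ### The structure of a normal submonoid -/

theorem eq_gpPart_union (M : Set (Inj Ω)) : M = gpPart M ∪ finPart M ∪ infPart M := by
  refine Subset.antisymm (fun f hf => ?_)
    (union_subset (union_subset inter_subset_left inter_subset_left) inter_subset_left)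
  by_cases h0 : coimageCard f = 0
  · exact .inl (.inl ⟨hf, coimageCard_eq_zero.1 h0⟩)
  by_cases h1 : coimageCard f = ⊤
  · exact .inr ⟨hf, h1⟩
  · exact .inl (.inr ⟨hf, Order.one_le_iff_ne_zero.2 h0, lt_top_iff_ne_top.2 h1⟩)

theorem infPart_mem [Countable Ω] {M : Submonoid (Inj Ω)} (hM : IsNormal (M : Set (Inj Ω))) :
    infPart (M : Set (Inj Ω)) ∈ ({∅, injInf Ω} : Set (Set (Inj Ω))) := by
  rcases (infPart (M : Set (Inj Ω))).eq_empty_or_nonempty with h | ⟨f, hf, hf'⟩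
  · exact .inl h
  · refine .inr (Subset.antisymm inter_subset_right fun g hg => ⟨?_, hg⟩)
    have hf' : coimageCard f = ⊤ := hf'
    have hg : coimageCard g = ⊤ := hg
    have h1 : HasInfiniteOrbit f := hasInfiniteOrbit_of_coimageCard_ne_zero (by simp [hf'])
    exact hM.mem_of_coimageCard_eq_add hf hf h1 h1
      (hasInfiniteOrbit_of_coimageCard_ne_zero (by simp [hg])) (by simp [hf', hg])

/-- The cardinalities of the finite coimages of the elements of `M`. -/
def coimageSubmonoid (M : Submonoid (Inj Ω)) : AddSubmonoid ℕ where
  carrier := {n | ∃ f ∈ M, coimageCard f = n}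
  zero_mem' := ⟨1, one_mem M, by simp⟩
  add_mem' := by
    rintro _ _ ⟨f, hf, hf'⟩ ⟨g, hg, hg'⟩
    exact ⟨f * g, mul_mem hf hg, by rw [coimageCard_mul, hf', hg', Nat.cast_add]⟩

theorem ne_zero_of_coimageCard_eq {f : Inj Ω} {n : ℕ} (h : coimageCard f = n) (hn : n ≠ 0) :
    coimageCard f ≠ 0 := by
  rw [h]
  exact_mod_cast hn

theorem mem_injFin_of_coimageCard_eq {f : Inj Ω} {n : ℕ} (h : coimageCard f = n) (hn : n ≠ 0) :
    f ∈ injFin Ω :=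
  ⟨Order.one_le_iff_ne_zero.2 (ne_zero_of_coimageCard_eq h hn), h ▸ ENat.natCast_lt_top n⟩

theorem isNormal_setOf_coimageCard (p : ℕ∞ → Prop) : IsNormal {f : Inj Ω | p (coimageCard f)} :=
  fun a f (hf : p (coimageCard f)) =>
    show p (coimageCard (conj a f)) by rwa [coimageCard_conj]

/-- If a nonzero `n` is a sum of two nonzero cardinalities that occur in `M`, every map omitting `n`
points factors into conjugates of elements of `M`. -/
theorem exists_hasFinForm [Countable Ω] {M : Submonoid (Inj Ω)}
    (hM : IsNormal (M : Set (Inj Ω))) :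
    ∃ (N : AddSubmonoid ℕ) (B : Set (Inj Ω)), HasFinForm (finPart (M : Set (Inj Ω))) N B := by
  refine ⟨coimageSubmonoid M, (M : Set (Inj Ω)) ∩ generatorPart Ω (coimageSubmonoid M),
    Subset.antisymm ?_ ?_, ?_, Subset.antisymm ?_ ?_⟩
  · rintro f ⟨hf, hf1, hf2⟩
    obtain ⟨n, hn⟩ := ENat.ne_top_iff_exists.1 hf2.ne
    by_cases hG : n ∈ Gn (coimageSubmonoid M)
    · exact .inl ⟨hf, n, hG, hn.symm⟩
    · refine .inr ⟨n, ⟨⟨f, hf, hn.symm⟩, ?_⟩, hn.symm⟩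
      rintro (h | h)
      · exact hG h
      · have h : n = 0 := h
        subst h
        rw [← hn] at hf1
        simp at hf1
  · refine union_subset ?_ ?_
    · rintro f ⟨hf, n, hn, hf'⟩
      exact ⟨hf, mem_injFin_of_coimageCard_eq hf' (mem_Gn_iff.1 hn).2.1⟩
    · rintro f ⟨n, ⟨hn, hn'⟩, hf⟩
      have hn0 : n ≠ 0 := fun h => hn' (.inr h)
      refine ⟨?_, mem_injFin_of_coimageCard_eq hf hn0⟩
      by_contra hfM
      refine hn' (.inl (mem_Gn_iff.2 ⟨hn, hn0, ?_⟩))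
      rintro m ⟨g, hg, hg'⟩ k ⟨h, hh, hh'⟩ hmk
      by_contra! hne
      refine hfM (hM.mem_of_coimageCard_eq_add hg hh
        (hasInfiniteOrbit_of_coimageCard_ne_zero (ne_zero_of_coimageCard_eq hg' hne.1))
        (hasInfiniteOrbit_of_coimageCard_ne_zero (ne_zero_of_coimageCard_eq hh' hne.2))
        (hasInfiniteOrbit_of_coimageCard_ne_zero (ne_zero_of_coimageCard_eq hf hn0)) ?_)
      rw [hf, hg', hh', ← hmk, Nat.cast_add]
  · rintro a f ⟨hf, hf'⟩
    exact ⟨hM a f hf, isNormal_setOf_coimageCard (fun c => ∃ n ∈ Gn _, c = (n : ℕ∞)) a f hf'⟩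
  · rintro _ ⟨f, ⟨-, n, hn, hf⟩, rfl⟩
    exact ⟨n, hn, hf.symm⟩
  · rintro _ ⟨n, hn, rfl⟩
    obtain ⟨f, hf, hf'⟩ := (mem_Gn_iff.1 hn).1
    exact ⟨f, ⟨hf, n, hn, hf'⟩, hf'⟩

/-! ### Necessity of the additional conditions. -/

theorem HasFinForm.mem_generatorPart {F B : Set (Inj Ω)} {N : AddSubmonoid ℕ}
    (h : HasFinForm F N B) {f : Inj Ω} (hf : f ∈ B) : f ∈ generatorPart Ω N := by
  obtain ⟨n, hn, hn'⟩ := h.2.2.subset (mem_image_of_mem _ hf)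
  exact ⟨n, hn, hn'.symm⟩

theorem coimageCard_ne_zero_of_mem_generatorPart {f : Inj Ω} {N : AddSubmonoid ℕ}
    (h : f ∈ generatorPart Ω N) : coimageCard f ≠ 0 := by
  obtain ⟨n, hn, hf⟩ := h
  exact ne_zero_of_coimageCard_eq hf (mem_Gn_iff.1 hn).2.1

/-- The decomposable part avoids the cardinalities in `Gn N`, so any admissible `B` is the part of
`M` with those cardinalities. -/
theorem HasFinForm.mem_of_mem {M B : Set (Inj Ω)} {N : AddSubmonoid ℕ}
    (h : HasFinForm (finPart M) N B) {f : Inj Ω} (hf : f ∈ M) (hf' : f ∈ generatorPart Ω N) :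
    f ∈ B := by
  obtain ⟨n, hn, hfn⟩ := hf'
  have h1 : f ∈ finPart M := ⟨hf, mem_injFin_of_coimageCard_eq hfn (mem_Gn_iff.1 hn).2.1⟩
  rw [h.1] at h1
  refine h1.resolve_right ?_
  rintro ⟨m, ⟨-, hm⟩, hfm⟩
  rw [hfn] at hfm
  exact hm (.inl (Nat.cast_injective hfm ▸ hn))

theorem HasFinForm.mem_of_mem_left {M B : Set (Inj Ω)} {N : AddSubmonoid ℕ}
    (h : HasFinForm (finPart M) N B) {f : Inj Ω} (hf : f ∈ B) : f ∈ M :=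
  (h.1.symm.subset (.inl hf)).1

theorem HasFinForm.conj_mul_mem {M : Submonoid (Inj Ω)} (hM : IsNormal (M : Set (Inj Ω)))
    {B : Set (Inj Ω)} {N : AddSubmonoid ℕ} (h : HasFinForm (finPart (M : Set (Inj Ω))) N B)
    {f : Inj Ω} (hf : f ∈ B) (a : Equiv.Perm Ω) {b : Equiv.Perm Ω} (hb : ofPerm b ∈ M) :
    conj a f * ofPerm b ∈ B := by
  refine h.mem_of_mem (mul_mem (hM.conj_mem a (h.mem_of_mem_left hf)) hb) ?_
  obtain ⟨n, hn, hfn⟩ := h.mem_generatorPart hf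
  exact ⟨n, hn, by rw [coimageCard_mul_ofPerm, coimageCard_conj, hfn]⟩

theorem IsClosedUnder.of_symm {r : Inj Ω → Inj Ω → Prop} {B : Set (Inj Ω)}
    (hr : ∀ f g, r f g → r g f) (h : ∀ f g, r f g → f ∈ B → g ∈ B) : IsClosedUnder r B :=
  fun f g hfg => ⟨h f g hfg, h g f (hr f g hfg)⟩

theorem extraConditions [Countable Ω] {M : Submonoid (Inj Ω)} (hM : IsNormal (M : Set (Inj Ω)))
    {N : AddSubmonoid ℕ} {B : Set (Inj Ω)} (h : HasFinForm (finPart (M : Set (Inj Ω))) N B) :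
    ExtraConditions (gpPart (M : Set (Inj Ω))) N B := by
  classical
  refine ⟨fun hP => ⟨IsClosedUnder.of_symm (fun _ _ => FinEquiv.symm) ?_,
    IsClosedUnder.of_symm (fun _ _ => EvenEquiv.symm) ?_⟩,
    fun hP => IsClosedUnder.of_symm (fun _ _ => FinEquiv.symm) ?_, fun hP => ?_⟩
  · rintro f g hfg ⟨hf, hf'⟩
    refine ⟨?_, hf'.imp (hfg.infiniteCycleCount_eq ▸ id)
      fun ⟨n, hn⟩ => ⟨n, (hfg.cycleCount_eq_top_iff n).1 hn⟩⟩
    have hf0 := coimageCard_ne_zero_of_mem_generatorPart (h.mem_generatorPart hf)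
    obtain ⟨a, l, hl, rfl, -⟩ := hfg.exists_eq_conj_mul hf0
    by_cases hlen : Even l.length
    · exact h.conj_mul_mem hM hf a (hP.symm.subset ⟨l, hl, hlen, rfl⟩).1
    -- Replacing a conjugate of `f` by a conjugate of `f * ofPerm t` adds one transposition, which
    -- makes the total even.
    · obtain ⟨t, b, ht, htb⟩ := exists_swap_mul_eq_conj hf0 hf'
      obtain ⟨l', hl', hlen', hprod⟩ := exists_list_conj (l := [t]) (by simpa using ht) (b⁻¹ * a)
      have e : conj a f * ofPerm l.prod =
          conj (b⁻¹ * a) f * ofPerm (l ++ l').prod := by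
        rw [List.prod_append, hprod, List.prod_singleton, ← ofPerm_mul, ← mul_assoc,
          ← conj_ofPerm, ← conj_mul, htb, conj_conj, mul_inv_cancel_left]
      rw [e]
      refine h.conj_mul_mem hM hf _ (hP.symm.subset ⟨l ++ l', ?_, ?_, rfl⟩).1
      · intro s hs
        rcases List.mem_append.1 hs with hs | hs
        exacts [hl s hs, hl' s hs]
      · rw [List.length_append, hlen', Nat.even_add, List.length_singleton]
        simp [hlen]
  · rintro f g hfg ⟨hf, hf1, hf2⟩
    have hfg' := evenEquiv_iff.1 hfg
    refine ⟨?_, hfg.1.infiniteCycleCount_eq ▸ hf1,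
      fun n => mt (hfg.1.cycleCount_eq_top_iff n).2 (hf2 n)⟩
    obtain ⟨a, l, hl, rfl, hlen⟩ := hfg.1.exists_eq_conj_mul
      (coimageCard_ne_zero_of_mem_generatorPart (h.mem_generatorPart hf))
    exact h.conj_mul_mem hM hf a (hP.symm.subset ⟨l, hl, hlen.2 hfg'.2, rfl⟩).1
  · intro f g hfg hf
    obtain ⟨a, l, hl, rfl, -⟩ := hfg.exists_eq_conj_mul
      (coimageCard_ne_zero_of_mem_generatorPart (h.mem_generatorPart hf))
    exact h.conj_mul_mem hM hf a (hP.symm.subset (list_prod_mem_finSet hl)).1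
  · refine Subset.antisymm (fun f => h.mem_generatorPart) fun g hg => ?_
    obtain ⟨n, hn, hgn⟩ := id hg
    obtain ⟨f, hf, hfn⟩ := h.2.2.symm.subset (mem_image_of_mem _ hn)
    obtain ⟨a, rfl⟩ := exists_mul_ofPerm_eq (hfn.trans hgn.symm)
    exact h.mem_of_mem (mul_mem (h.mem_of_mem_left hf) (hP.symm.subset ⟨a, rfl⟩).1) hg

/-! ### The converse -/

theorem mul_mem_altSet {f g : Inj Ω} (hf : f ∈ altSet Ω) (hg : g ∈ altSet Ω) :
    f * g ∈ altSet Ω := by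
  classical
  obtain ⟨l, hl, hlen, rfl⟩ := hf
  obtain ⟨k, hk, hlen', rfl⟩ := hg
  refine ⟨k ++ l, fun t ht => ?_, ?_, ?_⟩
  · exact (List.mem_append.1 ht).elim (hk t) (hl t)
  · rw [List.length_append]
    exact hlen'.add hlen
  · rw [List.prod_append, ofPerm_mul]

theorem mul_mem_finSet {f g : Inj Ω} (hf : f ∈ finSet Ω) (hg : g ∈ finSet Ω) :
    f * g ∈ finSet Ω := by
  obtain ⟨a, ha, rfl⟩ := hf
  obtain ⟨b, hb, rfl⟩ := hg
  refine ⟨b * a, (ha.union hb).subset fun x hx => ?_, ofPerm_mul a b⟩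
  by_contra! h
  rw [mem_union, mem_ofPred_eq, mem_ofPred_eq] at h
  push Not at h
  exact hx (by rw [Equiv.Perm.mul_apply, h.1, h.2])

theorem isNormal_altSet : IsNormal (altSet Ω) := by
  classical
  rintro a _ ⟨l, hl, hlen, rfl⟩
  obtain ⟨l', h1, h2, h3⟩ := exists_list_conj hl a
  exact ⟨l', h1, h2 ▸ hlen, by rw [h3]; rfl⟩

theorem isNormal_finSet : IsNormal (finSet Ω) := by
  rintro a _ ⟨b, hb, rfl⟩
  refine ⟨a⁻¹ * b * a, (hb.preimage a.injective.injOn).subset fun x hx => ?_, rfl⟩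
  intro h
  exact hx (by rw [Equiv.Perm.mul_apply, Equiv.Perm.mul_apply, h]; exact a.symm_apply_apply x)

theorem isNormal_symSet : IsNormal (symSet Ω) := by
  rintro a _ ⟨b, rfl⟩
  exact ⟨a⁻¹ * b * a, rfl⟩

theorem subset_symSet {P : Set (Inj Ω)}
    (hP : P ∈ ({{1}, altSet Ω, finSet Ω, symSet Ω} : Set (Set (Inj Ω)))) : P ⊆ symSet Ω := by
  have h : finSet Ω ⊆ symSet Ω := by
    rintro _ ⟨a, -, rfl⟩
    exact ⟨a, rfl⟩
  rcases hP with rfl | rfl | rfl | rfl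
  exacts [singleton_subset_iff.2 ⟨1, rfl⟩, altSet_subset_finSet.trans h, h, Subset.rfl]

theorem one_mem_of_mem {P : Set (Inj Ω)}
    (hP : P ∈ ({{1}, altSet Ω, finSet Ω, symSet Ω} : Set (Set (Inj Ω)))) : 1 ∈ P := by
  rcases hP with rfl | rfl | rfl | rfl
  exacts [rfl, ⟨[], by simp, by simp, rfl⟩, ⟨1, by simp, rfl⟩, ⟨1, rfl⟩]

theorem mul_mem_of_mem {P : Set (Inj Ω)}
    (hP : P ∈ ({{1}, altSet Ω, finSet Ω, symSet Ω} : Set (Set (Inj Ω)))) {f g : Inj Ω}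
    (hf : f ∈ P) (hg : g ∈ P) : f * g ∈ P := by
  rcases hP with rfl | rfl | rfl | rfl
  · rw [mem_singleton_iff.1 hf, mem_singleton_iff.1 hg]
    exact mul_one _
  · exact mul_mem_altSet hf hg
  · exact mul_mem_finSet hf hg
  · obtain ⟨a, rfl⟩ := hf
    obtain ⟨b, rfl⟩ := hg
    exact ⟨b * a, rfl⟩

theorem isNormal_of_mem {P : Set (Inj Ω)}
    (hP : P ∈ ({{1}, altSet Ω, finSet Ω, symSet Ω} : Set (Set (Inj Ω)))) : IsNormal P := by
  rcases hP with rfl | rfl | rfl | rfl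
  · rintro a f rfl
    exact conj_one a
  exacts [isNormal_altSet, isNormal_finSet, isNormal_symSet]

/-- A finitary factor stays within the `FinEquiv` class. An even one also preserves `EvenEquiv` if
there is one infinite cycle and all counts are finite; there is at least one infinite cycle, because
maps in `B` omit a point. -/
theorem ExtraConditions.mul_ofPerm_mem {P B : Set (Inj Ω)} {N : AddSubmonoid ℕ}
    (hP : P ∈ ({{1}, altSet Ω, finSet Ω, symSet Ω} : Set (Set (Inj Ω))))
    (hB : B ⊆ generatorPart Ω N) (h : ExtraConditions P N B) {f : Inj Ω} (hf : f ∈ B)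
    {a : Equiv.Perm Ω} (ha : ofPerm a ∈ P) : f * ofPerm a ∈ B := by
  classical
  obtain ⟨h1, h2, h3⟩ := h
  rcases hP with rfl | rfl | rfl | rfl
  · rwa [mem_singleton_iff.1 ha, mul_one]
  · obtain ⟨l, hl, hlen, hal⟩ := ha
    rw [hal]
    have hfin := finEquiv_mul_list f hl
    by_cases hc : 2 ≤ infiniteCycleCount f ∨ ∃ n : ℕ+, cycleCount f n = ⊤
    · exact (((h1 rfl).1 _ _ hfin).1 ⟨hf, hc⟩).1
    · push Not at hc
      have hinf : infiniteCycleCount f = 1 := by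
        refine le_antisymm (Order.le_of_lt_add_one hc.1) (Order.one_le_iff_ne_zero.2 ?_)
        rw [infiniteCycleCount_eq, fwdCount_eq_coimageCard]
        exact fun h => coimageCard_ne_zero_of_mem_generatorPart (hB hf) (add_eq_zero.1 h).2
      exact (((h1 rfl).2 _ _ (evenEquiv_iff.2
        ⟨hfin, (even_cycleDiff_mul_list hinf hc.2 hl).2 hlen⟩)).1 ⟨hf, hinf, hc.2⟩).1
  · obtain ⟨b, hb, hab⟩ := ha
    obtain ⟨l, hl, rfl⟩ := exists_list_swap hb
    rw [hab]
    exact (h2 rfl _ _ (finEquiv_mul_list f hl)).1 hf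
  · rw [h3 rfl] at hf ⊢
    obtain ⟨n, hn, hfn⟩ := hf
    exact ⟨n, hn, by rw [coimageCard_mul_ofPerm, hfn]⟩

theorem mul_mem_decomposablePart {N : AddSubmonoid ℕ} {f g : Inj Ω} {m n : ℕ} (hm : m ∈ N)
    (hn : n ∈ N) (hm0 : m ≠ 0) (hn0 : n ≠ 0) (hf : coimageCard f = m) (hg : coimageCard g = n) :
    f * g ∈ decomposablePart Ω N := by
  refine ⟨m + n, ⟨add_mem hm hn, ?_⟩, by rw [coimageCard_mul, hf, hg, Nat.cast_add]⟩
  rintro (h | h)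
  · exact ((mem_Gn_iff.1 h).2.2 m hm n hn rfl).elim hm0 hn0
  · have h : m + n = 0 := h
    omega

theorem HasFinForm.exists_coimageCard_eq {F B : Set (Inj Ω)} {N : AddSubmonoid ℕ}
    (h : HasFinForm F N B) {f : Inj Ω} (hf : f ∈ F) :
    ∃ n ∈ N, n ≠ 0 ∧ coimageCard f = n := by
  rw [h.1] at hf
  rcases hf with hf | ⟨n, ⟨hn, hn'⟩, hfn⟩
  · obtain ⟨n, hn, hfn⟩ := h.mem_generatorPart hf
    exact ⟨n, (mem_Gn_iff.1 hn).1, (mem_Gn_iff.1 hn).2.1, hfn⟩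
  · exact ⟨n, hn, fun h => hn' (.inr h), hfn⟩

/-- A product of two elements of `F` omits a reducible number of points, so it is decomposable
whatever `B` is. Only products of `B` with permutations need the additional conditions. -/
theorem exists_submonoid {P F I B : Set (Inj Ω)} {N : AddSubmonoid ℕ}
    (hP : P ∈ ({{1}, altSet Ω, finSet Ω, symSet Ω} : Set (Set (Inj Ω))))
    (hF : HasFinForm F N B) (hE : ExtraConditions P N B)
    (hI : I ∈ ({∅, injInf Ω} : Set (Set (Inj Ω)))) :
    ∃ M : Submonoid (Inj Ω), (M : Set (Inj Ω)) = P ∪ F ∪ I ∧ IsNormal (M : Set (Inj Ω)) := by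
  have hFnormal : IsNormal F := by
    rw [hF.1]
    rintro a f (hf | hf)
    · exact .inl (hF.2.1 a f hf)
    · exact .inr (isNormal_setOf_coimageCard
        (fun c => ∃ n : ℕ, n ∈ (N : Set ℕ) \ (Gn N ∪ {0}) ∧ c = n) a f hf)
  have hFP : ∀ f ∈ F, ∀ a, ofPerm a ∈ P → f * ofPerm a ∈ F := by
    intro f hf a ha
    rw [hF.1] at hf ⊢
    rcases hf with hf | ⟨n, hn, hfn⟩
    · exact .inl (hE.mul_ofPerm_mem hP (fun _ => hF.mem_generatorPart) hf ha)
    · exact .inr ⟨n, hn, by rw [coimageCard_mul_ofPerm, hfn]⟩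
  have hIl : ∀ f ∈ I, ∀ g, f * g ∈ I := by
    rcases hI with rfl | rfl
    · simp
    · intro f hf g
      have hf : coimageCard f = ⊤ := hf
      exact (coimageCard_mul f g).trans (by rw [hf, top_add])
  have hIr : ∀ f ∈ I, ∀ g, g * f ∈ I := by
    rcases hI with rfl | rfl
    · simp
    · intro f hf g
      have hf : coimageCard f = ⊤ := hf
      exact (coimageCard_mul g f).trans (by rw [hf, add_top])
  have hInormal : IsNormal I := fun a f hf => hIl _ (hIr _ hf _) _
  refine ⟨⟨⟨P ∪ F ∪ I, ?_⟩, .inl (.inl (one_mem_of_mem hP))⟩, rfl, ?_⟩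
  · rintro f g ((hf | hf) | hf) ((hg | hg) | hg)
    · exact .inl (.inl (mul_mem_of_mem hP hf hg))
    · obtain ⟨a, rfl⟩ := subset_symSet hP hf
      -- Normality moves a permutation from the left of `g` to its right.
      have e : ofPerm a * g = conj a (g * ofPerm a) := by
        ext x
        simp
      rw [e]
      exact .inl (.inr (hFnormal.conj_mem a (hFP g hg a hf)))
    · exact .inr (hIr g hg f)
    · obtain ⟨a, rfl⟩ := subset_symSet hP hg
      exact .inl (.inr (hFP f hf a hg))
    · obtain ⟨m, hm, hm0, hfm⟩ := hF.exists_coimageCard_eq hf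
      obtain ⟨n, hn, hn0, hgn⟩ := hF.exists_coimageCard_eq hg
      rw [hF.1]
      exact .inl (.inr (.inr (mul_mem_decomposablePart hm hn hm0 hn0 hfm hgn)))
    · exact .inr (hIr g hg f)
    · exact .inr (hIl f hf g)
    · exact .inr (hIl f hf g)
    · exact .inr (hIl f hf g)
  · rintro a f ((hf | hf) | hf)
    exacts [.inl (.inl (isNormal_of_mem hP a f hf)), .inl (.inr (hFnormal a f hf)),
      .inr (hInormal a f hf)]

end Classification

end NormalInj

theorem mainTheorem1 {Ω : Type*} [Countable Ω] [Infinite Ω] :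
    (∀ M : Submonoid (NormalInj.Inj Ω), NormalInj.IsNormal (M : Set (NormalInj.Inj Ω)) →
      (M : Set (NormalInj.Inj Ω)) =
        NormalInj.gpPart (M : Set (NormalInj.Inj Ω)) ∪
          NormalInj.finPart (M : Set (NormalInj.Inj Ω)) ∪
          NormalInj.infPart (M : Set (NormalInj.Inj Ω)) ∧
      NormalInj.gpPart (M : Set (NormalInj.Inj Ω)) ∈
        ({{1}, NormalInj.altSet Ω, NormalInj.finSet Ω, NormalInj.symSet Ω} :
          Set (Set (NormalInj.Inj Ω))) ∧
      (∃ (N : AddSubmonoid ℕ) (B : Set (NormalInj.Inj Ω)),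
        NormalInj.HasFinForm (NormalInj.finPart (M : Set (NormalInj.Inj Ω))) N B) ∧
      (∀ (N : AddSubmonoid ℕ) (B : Set (NormalInj.Inj Ω)),
        NormalInj.HasFinForm (NormalInj.finPart (M : Set (NormalInj.Inj Ω))) N B →
          NormalInj.ExtraConditions (NormalInj.gpPart (M : Set (NormalInj.Inj Ω))) N B) ∧
      NormalInj.infPart (M : Set (NormalInj.Inj Ω)) ∈
        ({∅, NormalInj.injInf Ω} : Set (Set (NormalInj.Inj Ω)))) ∧
    (∀ (P F I : Set (NormalInj.Inj Ω)) (N : AddSubmonoid ℕ) (B : Set (NormalInj.Inj Ω)),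
      P ∈ ({{1}, NormalInj.altSet Ω, NormalInj.finSet Ω, NormalInj.symSet Ω} :
          Set (Set (NormalInj.Inj Ω))) →
      NormalInj.HasFinForm F N B →
      NormalInj.ExtraConditions P N B →
      I ∈ ({∅, NormalInj.injInf Ω} : Set (Set (NormalInj.Inj Ω))) →
      ∃ M : Submonoid (NormalInj.Inj Ω),
        (M : Set (NormalInj.Inj Ω)) = P ∪ F ∪ I ∧
        NormalInj.IsNormal (M : Set (NormalInj.Inj Ω))) := by
  refine ⟨fun M hM => ⟨NormalInj.eq_gpPart_union _, NormalInj.gpPart_mem hM,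
    NormalInj.exists_hasFinForm hM, fun N B => NormalInj.extraConditions hM,
    NormalInj.infPart_mem hM⟩, fun P F I N B => NormalInj.exists_submonoid⟩
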